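/- **Model.** The nodes of the ring are the elements of $\mathbb{Z}/n\mathbb{Z}$, $u$ being adjacent to $u\pm1$. Four robots occupy nodes. They are anonymous (identical), oblivious and deterministic: when activated, a robot sees only the cyclic sequence of multiplicities (numbers of robots on the nodes), read from its own node in one of the two directions, which the adversary chooses (the ring has no labels and no orientation); as a fixed function of this sequence it stays, or moves to one of the two adjacent nodes. In the ATOM model, at each time $t\in\mathbb{N}$ a scheduler selects a set of robots, and these perform simultaneously one complete Look–Compute–Move cycle. The scheduler is arbitrary but fair: every robot is activated infinitely often. **Terms.** A *tower* is a node with at least two robots. Two robots are *neighbors* along a direction if no robot lies strictly between them in this direction; they then share the hole made of the empty nodes between them. The *inter-distance* $d$ is the minimum distance between two distinct robots ($0$ if there is a tower). For $k\ge1$, a *$k$.block* is a maximal path, with at least two occupied nodes, having one occupied node every $k$ edges and empty nodes in between; its size is the number of occupied nodes. A robot is *isolated* if no other robot is at distance $d$ from it (in the presence of a tower: if it is alone on its node). A configuration is *symmetric* if some reflection $u\mapsto a-u$ preserves the multiplicities; the image of a robot is its symmetric robot. The distance of two symmetric robots, and of two neighboring robots on the same side of the axis, is measured along the hole that they share. For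 $n$ odd and four robots on distinct nodes, a symmetric configuration has one axis; one symmetric pair is at an even distance $E$, the other at an odd distance $O$, and the distance of neighboring robots on the same side of the axis is the same on both sides; call it $y$. * *S-tower-plan*: the configuration is symmetric and two 1.blocks share a hole of size 1. * *A-tower-plan*: the configuration is not symmetric and a 1.block of size 3 has an isolated robot as neighbor at distance 2. * *Tower-guide*: five consecutive nodes that carry, in this order or the reverse one, a tower, no robot, one robot, no robot, one robot. * *Tower-block*: there is a tower with exactly one robot on each of its two adjacent nodes. * *Tower-sole*: the configuration has a tower, is symmetric, and has a 1.block that does not contain the tower. **The Odd-Exploration protocol.** If there is a tower-block or a tower-sole, no robot moves. Otherwise, if there is no tower and neither an S-tower-plan nor an A-tower-plan, Phase 1 is executed; if there is no tower but there is an S- or A-tower-plan, Phase 2; if there is a tower, Phase 3. A robot that is not told to move stays. *Phase 1, symmetric configuration.* 1. $E=O+1$ and $y$ even: the two robots at even distance move towards each other if $E>2$, and away from each other if $E=2$. 2. $E=O+1$, $y$ odd, $y\ne1$: the two robots at odd distance move away from each other. 3. $E=O+1$, $y=1$: the two robots at even distance move towards each other. 4. $E\ne O+1$: a robot at even distance from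 its symmetric robot moves towards it if $E>2$ and the robot is in a 1.block (it stays otherwise); a robot at odd distance from its symmetric robot moves away from it if the robot is not part of a 1.block that contains a robot other than itself and its symmetric robot. *Phase 1, non-symmetric configuration.* If there is a single $d$.block and it has size 2, an isolated robot closest to it moves towards it along a shortest path. If there is a single $d$.block, it has size 3 and $d>1$, its two border robots move towards the inside of the block. If there is a single $d$.block, it has size 3 and $d=1$, the isolated robot moves towards it along a shortest path, provided that at least two nodes lie between them on it. *Phase 2.* If there are two 1.blocks, the robots that share a hole of size 1 with their symmetric robot move towards it. Otherwise the middle robot of a 1.block of size 3 moves to the adjacent node whose robot has no neighbor at distance 2. *Phase 3.* 1. No robot is at distance 1 from the tower, and there is a tower-guide: an isolated robot not at distance 2 from the tower moves towards the other isolated robot, through the hole that they share, if at least one empty node separates them there. 2. No robot is at distance 1 from the tower, and there is no tower-guide: a robot at distance 2 from the tower moves towards the tower if it is in a 1.block, and away from the tower otherwise; if no robot is at distance 2 from the tower, each isolated robot not at distance $(n-1)/2$ from the tower moves away from the tower. 3. Some robot is at distance 1 from the tower: an isolated robot not at distance 1 from the tower moves towards the tower through the hole that it shares with it. **Theorem.**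 Let $n>7$ be odd. In every execution of Odd-Exploration by four robots on the ring of size $n$ in the ATOM model, with a fair scheduler, starting from any configuration without a tower (the four robots on distinct nodes), there is a time $T$ such that the configuration at time $T$ contains a tower-block or a tower-sole; this configuration is terminal (whichever robots are activated, none of them ever moves again, so the configuration is the same at all times $t\ge T$); and every node of the ring has been occupied by some robot at some time $t\le T$. -/

import Mathlib

namespace RingExploration

/-! ### Robots on an anonymous, unoriented ring (ATOM model)

The nodes of the ring are the elements of `ZMod n`; a direction is a unit `e : ℤˣ` (`1` or `-1`). -/

/-- The node reached from `u` after `k` edges in direction `e`. -/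
def ahead {n : ℕ} (u : ZMod n) (e : ℤˣ) (k : ℕ) : ZMod n :=
  u + ((e : ℤ) : ZMod n) * (k : ZMod n)

/-- The number of robots at each node, where `p r` is the node of robot `r`. -/
def multiplicity {n k : ℕ} (p : Fin k → ZMod n) (u : ZMod n) : ℕ :=
  (Finset.univ.filter fun r => p r = u).card

/-- The snapshot taken by robot `r`: the sequence of multiplicities read from its own node in
direction `e`. The ring is unoriented, so `e` will be chosen by the adversary at each activation. -/
def view {n k : ℕ} (p : Fin k → ZMod n) (r : Fin k) (e : ℤˣ) (j : ZMod n) : ℕ :=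
  multiplicity p (p r + ((e : ℤ) : ZMod n) * j)

/-- A deterministic, anonymous and oblivious protocol: a function of the snapshot only. The answer
is to stay (`none`), to move to the adjacent node in the direction in which the snapshot was read
(`some 1`), or to move to the other adjacent node (`some (-1)`). -/
abbrev Protocol (n : ℕ) := (ZMod n → ℕ) → Option ℤˣ

/-- The node of robot `r` after a full Look-Compute-Move cycle. -/
def cycle {n k : ℕ} (P : Protocol n) (p : Fin k → ZMod n) (r : Fin k) (e : ℤˣ) : ZMod n :=
  match P (view p r e) with
  | none => p r
  | some f => ahead (p r) (e * f) 1

/-- An execution in the ATOM model: at time `t` the robots in `act t` simultaneously perform a full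
cycle; `ori t r` is the orientation under which robot `r` sees the ring at that time. -/
def IsExecution {n k : ℕ} (P : Protocol n) (act : ℕ → Finset (Fin k)) (ori : ℕ → Fin k → ℤˣ)
    (p : ℕ → Fin k → ZMod n) : Prop :=
  ∀ t r, p (t + 1) r = if r ∈ act t then cycle P (p t) r (ori t r) else p t r

/-- Each robot is activated infinitely many times. -/
def IsFair {k : ℕ} (act : ℕ → Finset (Fin k)) : Prop :=
  ∀ r t, ∃ t', t ≤ t' ∧ r ∈ act t'

/-- No robot can move, whatever the scheduler does. -/
def IsTerminal {n k : ℕ} (P : Protocol n) (p : Fin k → ZMod n) : Prop :=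
  ∀ r e, P (view p r e) = none

/-! ### Vocabulary for configurations

A configuration is given by the multiplicities `m u` of the nodes `u`. -/

section Vocabulary

variable {n : ℕ}

def Occupied (m : ZMod n → ℕ) (u : ZMod n) : Prop := 1 ≤ m u

/-- There is a tower on `u`. -/
def Tower (m : ZMod n → ℕ) (u : ZMod n) : Prop := 2 ≤ m u

def HasTower (m : ZMod n → ℕ) : Prop := ∃ u, Tower m u

/-- The distance on the ring, in number of edges. -/
def ringDist (u v : ZMod n) : ℕ := min (v - u).val (u - v).val

/-- In direction `e`, the first occupied node after the occupied node `u` is `k` edges away, so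
that (for `k ≥ 2`) the two nodes share a hole of size `k - 1`. -/
def Neighbor (m : ZMod n → ℕ) (u : ZMod n) (e : ℤˣ) (k : ℕ) : Prop :=
  1 ≤ k ∧ Occupied m u ∧ Occupied m (ahead u e k) ∧
    ∀ j, 1 ≤ j → j < k → ¬ Occupied m (ahead u e j)

/-- The reflection `u ↦ a - u` is a symmetry of the configuration. -/
def IsAxis (m : ZMod n → ℕ) (a : ZMod n) : Prop := ∀ u, m (a - u) = m u

/-- The configuration has an axis of symmetry. -/
def Symmetric (m : ZMod n → ℕ) : Prop := ∃ a, IsAxis m a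

/-- The minimum distance between two distinct robots (it is `0` if there is a tower). -/
noncomputable def interDist (m : ZMod n → ℕ) : ℕ :=
  sInf {d | ∃ u v, Occupied m u ∧ Occupied m v ∧ (u ≠ v ∨ Tower m u) ∧ ringDist u v = d}

/-- The nodes `b, b + d, …, b + (s - 1) d` form a `d`.block of size `s`: a maximal path, with at
least two robots, having one robot every `d` edges. -/
def IsBlock (m : ZMod n → ℕ) (d : ℕ) (b : ZMod n) (s : ℕ) : Prop :=
  2 ≤ s ∧ (∀ i, i + 1 < s → Neighbor m (ahead b 1 (i * d)) 1 d) ∧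
    ¬ Neighbor m (ahead b 1 ((s - 1) * d)) 1 d ∧ ¬ Neighbor m b (-1) d

/-- `u` is one of the nodes `b, b + d, …, b + (s - 1) d`. -/
def InBlock (d : ℕ) (b : ZMod n) (s : ℕ) (u : ZMod n) : Prop :=
  ∃ i, i < s ∧ u = ahead b 1 (i * d)

/-- `u` belongs to some 1.block. -/
def InOneBlock (m : ZMod n → ℕ) (u : ZMod n) : Prop :=
  ∃ b s, IsBlock m 1 b s ∧ InBlock 1 b s u

/-- The configuration contains a single `d`.block, where `d` is the inter-distance; it starts at
`b` and has size `s`. -/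
def SingleBlock (m : ZMod n → ℕ) (b : ZMod n) (s : ℕ) : Prop :=
  IsBlock m (interDist m) b s ∧ ∀ b' s', IsBlock m (interDist m) b' s' → b' = b ∧ s' = s

/-- The robot on `u` belongs to no `d`.block, where `d` is the inter-distance: no other robot is at
distance `d` from it. If there is a tower, `d = 0`, and the isolated robots are those that are
alone on their node. -/
def Isolated (m : ZMod n → ℕ) (u : ZMod n) : Prop :=
  m u = 1 ∧ ∀ v, v ≠ u → Occupied m v → ringDist u v ≠ interDist m

/-- The distance from `u` to the block `b, b + d, …, b + (s - 1) d`. -/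
noncomputable def blockDist (d : ℕ) (b : ZMod n) (s : ℕ) (u : ZMod n) : ℕ :=
  sInf {k | ∃ e, InBlock d b s (ahead u e k)}

/-- From `u`, a shortest path to the block starts in direction `e`. -/
def TowardsBlock (d : ℕ) (b : ZMod n) (s : ℕ) (u : ZMod n) (e : ℤˣ) : Prop :=
  InBlock d b s (ahead u e (blockDist d b s u))

/-- The robot on `u` and its symmetric robot share a hole: they are neighbors in direction `e`, and
`k` edges apart along that hole. -/
def SymNeighbor (m : ZMod n → ℕ) (u : ZMod n) (e : ℤˣ) (k : ℕ) : Prop :=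
  ∃ a, IsAxis m a ∧ Neighbor m u e k ∧ ahead u e k = a - u

/-- The distance of two neighboring robots that are on the same side of the axis is `k`. -/
def AxisSideDist (m : ZMod n → ℕ) (k : ℕ) : Prop :=
  ∃ u e a, IsAxis m a ∧ Neighbor m u e k ∧ ahead u e k ≠ a - u

/-- The distance of the symmetric robots that are at an even distance is one more than the distance
of the symmetric robots that are at an odd distance. -/
def EvenIsOddPlusOne (m : ZMod n → ℕ) : Prop :=
  ∃ k, Odd k ∧ (∃ u e, SymNeighbor m u e k) ∧ (∃ u e, SymNeighbor m u e (k + 1))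

/-- The robot on `u` is part of a 1.block that contains a robot that is not its symmetric robot. -/
def InBlockWithNonSym (m : ZMod n → ℕ) (u : ZMod n) : Prop :=
  ∃ a b s, IsAxis m a ∧ IsBlock m 1 b s ∧ InBlock 1 b s u ∧
    ∃ v, InBlock 1 b s v ∧ v ≠ u ∧ v ≠ a - u

/-- Two different 1.blocks. -/
def TwoOneBlocks (m : ZMod n → ℕ) : Prop :=
  ∃ b s b' s', IsBlock m 1 b s ∧ IsBlock m 1 b' s' ∧ b ≠ b'

/-- The configuration is symmetric and two 1.blocks share a hole of size 1. -/
def STowerPlan (m : ZMod n → ℕ) : Prop :=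
  Symmetric m ∧ ∃ b s b' s', IsBlock m 1 b s ∧ IsBlock m 1 b' s' ∧ b ≠ b' ∧
    Neighbor m (ahead b 1 (s - 1)) 1 2 ∧ b' = ahead b 1 (s + 1)

/-- The configuration is not symmetric and a 1.block of size 3 has an isolated robot as a neighbor
at distance 2. -/
def ATowerPlan (m : ZMod n → ℕ) : Prop :=
  ¬ Symmetric m ∧ ∃ b, IsBlock m 1 b 3 ∧
    ((Neighbor m (ahead b 1 2) 1 2 ∧ Isolated m (ahead b 1 4)) ∨
      (Neighbor m b (-1) 2 ∧ Isolated m (ahead b (-1) 2)))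

/-- A tower, an empty node, a single robot, an empty node and a single robot, in this order. -/
def TowerGuide (m : ZMod n → ℕ) : Prop :=
  ∃ u e, Tower m u ∧ m (ahead u e 1) = 0 ∧ m (ahead u e 2) = 1 ∧ m (ahead u e 3) = 0 ∧
    m (ahead u e 4) = 1

/-- On each side of the tower there is one robot at distance 1. -/
def TowerBlock (m : ZMod n → ℕ) : Prop :=
  ∃ u, Tower m u ∧ m (u + 1) = 1 ∧ m (u - 1) = 1

/-- The configuration has a tower, it is symmetric, and there is a 1.block that does not contain
the tower. -/
def TowerSole (m : ZMod n → ℕ) : Prop :=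
  HasTower m ∧ Symmetric m ∧ ∃ b s, IsBlock m 1 b s ∧ ∀ u, InBlock 1 b s u → ¬ Tower m u

/-- `u` is at distance `k` from a tower. -/
def AtTowerDist (m : ZMod n → ℕ) (u : ZMod n) (k : ℕ) : Prop :=
  ∃ t, Tower m t ∧ ringDist t u = k

/-! ### The protocol Odd-Exploration

Each phase is described by the relation "in the configuration `m`, the robot on node `u` is told to
move to the adjacent node in direction `e`". -/

open Classical in
/-- Phase 1, symmetric configurations. Here `f` is the direction from the robot on `u` to its
symmetric robot, and `k` is their distance. -/
def Phase1Sym (m : ZMod n → ℕ) (u : ZMod n) (e : ℤˣ) : Prop :=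
  ∃ f k, SymNeighbor m u f k ∧
    if EvenIsOddPlusOne m then
      if ∃ y, Even y ∧ AxisSideDist m y then
        Even k ∧ (if 2 < k then e = f else e = -f)
      else if ¬ AxisSideDist m 1 then
        Odd k ∧ e = -f
      else
        Even k ∧ e = f
    else
      if Even k then
        2 < k ∧ InOneBlock m u ∧ e = f
      else
        ¬ InBlockWithNonSym m u ∧ e = -f

open Classical in
/-- Phase 1, configurations that are not symmetric. -/
def Phase1Asym (m : ZMod n → ℕ) (u : ZMod n) (e : ℤˣ) : Prop :=
  (∃ b, SingleBlock m b 2 ∧ Isolated m u ∧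
    (∀ w, Isolated m w → blockDist (interDist m) b 2 u ≤ blockDist (interDist m) b 2 w) ∧
    TowardsBlock (interDist m) b 2 u e) ∨
  (∃ b, SingleBlock m b 3 ∧
    if 1 < interDist m then
      (u = b ∧ e = 1) ∨ (u = ahead b 1 (2 * interDist m) ∧ e = -1)
    else
      Isolated m u ∧ 3 ≤ blockDist (interDist m) b 3 u ∧ TowardsBlock (interDist m) b 3 u e)

open Classical in
def Phase1 (m : ZMod n → ℕ) (u : ZMod n) (e : ℤˣ) : Prop :=
  if Symmetric m then Phase1Sym m u e else Phase1Asym m u e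

open Classical in
def Phase2 (m : ZMod n → ℕ) (u : ZMod n) (e : ℤˣ) : Prop :=
  if TwoOneBlocks m then
    SymNeighbor m u e 2
  else
    ∃ b, IsBlock m 1 b 3 ∧ u = ahead b 1 1 ∧ ¬ ∃ f, Neighbor m (ahead u e 1) f 2

open Classical in
def Phase3 (m : ZMod n → ℕ) (u : ZMod n) (e : ℤˣ) : Prop :=
  if ¬ ∃ v, Occupied m v ∧ AtTowerDist m v 1 then
    if TowerGuide m then
      ¬ AtTowerDist m u 2 ∧ Isolated m u ∧
        ∃ k, 2 ≤ k ∧ Neighbor m u e k ∧ Isolated m (ahead u e k)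
    else if AtTowerDist m u 2 then
      if InOneBlock m u then
        Tower m (ahead u e 2)
      else
        Tower m (ahead u (-e) 2)
    else
      (¬ ∃ v, Occupied m v ∧ AtTowerDist m v 2) ∧
        Isolated m u ∧ ¬ AtTowerDist m u ((n - 1) / 2) ∧
        ∃ t, Tower m t ∧ u = ahead t e (ringDist t u)
  else
    Isolated m u ∧ ¬ AtTowerDist m u 1 ∧ ∃ k, Neighbor m u e k ∧ Tower m (ahead u e k)

open Classical in
/-- In the configuration `m`, the robot on `u` is told to move in direction `e`. -/
def Moves (m : ZMod n → ℕ) (u : ZMod n) (e : ℤˣ) : Prop :=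
  if ¬ TowerBlock m ∧ ¬ TowerSole m then
    if ¬ HasTower m ∧ ¬ STowerPlan m ∧ ¬ ATowerPlan m then
      Phase1 m u e
    else if ¬ HasTower m then
      Phase2 m u e
    else
      Phase3 m u e
  else
    False

end Vocabulary

open Classical in
/-- Odd-Exploration: a robot sees the configuration as the snapshot `v`, with itself on node `0`. -/
noncomputable def oddExploration (n : ℕ) : Protocol n := fun v =>
  if Moves v 0 1 then some 1 else if Moves v 0 (-1) then some (-1) else none

end RingExploration

namespace RingExploration

/-! ### Invariance under the isometries of the ring -/

/-! The protocol commutes with the isometries of the ring (`moves_comp`), so the adversary's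
orientations leave only the relation `Moves`, and a configuration without a tower amounts to a
cyclic sequence of four gaps with sum `n`. The proof is a potential argument. Each `Stage` carries a
bound; it is either finished, or some robot may move and every effective step, whichever robots take
part in it, leads to a stage with a smaller bound (`Stage.finished_or_descends`). Fairness forces
effective steps to occur, and strong induction on the bound concludes (`exists_finished`).

Symmetric stage, gaps `E, y, O, y` with `E` even and `O` odd. The rules collapse to three
(`moves_sym_iff`): the pair at even distance closes, the same pair opens, or the pair at odd
distance opens. The potential is `2 * (E + y)` with two small corrections. If only one robot of the
pair moves, either the symmetry is lost for good or, when `E = O + 1`, a new axis appears with a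
smaller potential (`descends_sym`). The symmetric regime can also end with the even pair meeting,
from the gaps `2, 1, n - 4, 1`.

Asymmetric stage, gaps `a, b, c, d` with `a` shortest and `b` the smaller of the two gaps beside it,
so that `a ≤ b < d` and `a < c`. These inequalities persist, so symmetry never returns, and `(a + b,
c)` decreases lexicographically until the gaps are `1, 1, 2, n - 4` and the middle robot creates a
tower (`descends_asym`).

Tower stages. After a symmetric meeting the two single robots retreat from the tower until both are
at distance `(n - 1) / 2`; the arcs that they sweep cover the ring, and a tower-sole appears. After
an asymmetric meeting one robot settles beside the tower while the other walks around the ring to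
its far side, and a tower-block appears. These stages record the visited arc in fixed coordinates,
which yields the exploration. -/

theorem exists_iff_of_surjective {α β : Sort*} {f : α → β} (hf : Function.Surjective f)
    {q : α → Prop} {r : β → Prop} (h : ∀ a, q a ↔ r (f a)) : (∃ a, q a) ↔ ∃ b, r b :=
  (exists_congr h).trans hf.exists.symm

theorem forall_iff_of_surjective {α β : Sort*} {f : α → β} (hf : Function.Surjective f)
    {q : α → Prop} {r : β → Prop} (h : ∀ a, q a ↔ r (f a)) : (∀ a, q a) ↔ ∀ b, r b :=
  (forall_congr' h).trans hf.forall.symm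

/-- Both decidability instances are left free: the classical ones found in the two configurations
belong to different propositions. -/
theorem ite_prop_congr {a b q r q' r' : Prop} {_ : Decidable a} {_ : Decidable b} (h : a ↔ b)
    (hq : q ↔ q') (hr : r ↔ r') : (if a then q else r) ↔ if b then q' else r' :=
  iff_of_eq (if_congr h (propext hq) (propext hr))

section Isometry

variable {n : ℕ}

/-- The isometry `u ↦ x + ε u` of the ring. -/
def isom (x : ZMod n) (ε : ℤˣ) (u : ZMod n) : ZMod n := x + ((ε : ℤ) : ZMod n) * u

theorem unit_cast_mul_self (ε : ℤˣ) : ((ε : ℤ) : ZMod n) * ((ε : ℤ) : ZMod n) = 1 := by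
  rcases Int.units_eq_one_or ε with rfl | rfl <;> simp

theorem isom_injective (x : ZMod n) (ε : ℤˣ) : Function.Injective (isom x ε) := by
  intro u v h
  rcases Int.units_eq_one_or ε with rfl | rfl <;> simpa [isom] using h

theorem isom_surjective (x : ZMod n) (ε : ℤˣ) : Function.Surjective (isom x ε) := fun v =>
  ⟨((ε : ℤ) : ZMod n) * (v - x), by
    simp only [isom, ← mul_assoc, unit_cast_mul_self]; ring⟩

theorem isom_inj {x : ZMod n} {ε : ℤˣ} {u v : ZMod n} : isom x ε u = isom x ε v ↔ u = v :=
  (isom_injective x ε).eq_iff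

theorem mul_unit_surjective (ε : ℤˣ) : Function.Surjective fun e : ℤˣ => ε * e :=
  fun e => ⟨ε⁻¹ * e, mul_inv_cancel_left ε e⟩

theorem isom_ahead (x : ZMod n) (ε : ℤˣ) (u : ZMod n) (e : ℤˣ) (k : ℕ) :
    isom x ε (ahead u e k) = ahead (isom x ε u) (ε * e) k := by
  simp only [isom, ahead]; push_cast; ring

theorem isom_one (x u : ZMod n) : isom x 1 u = x + u := by simp [isom]

theorem isom_neg_one (x u : ZMod n) : isom x (-1) u = x - u := by simp [isom, sub_eq_add_neg]

theorem ahead_one (u : ZMod n) (k : ℕ) : ahead u 1 k = u + k := by simp [ahead]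

theorem ahead_neg_one (u : ZMod n) (k : ℕ) : ahead u (-1) k = u - k := by
  simp [ahead, sub_eq_add_neg]

theorem ahead_ahead_neg (u : ZMod n) (e : ℤˣ) (k : ℕ) : ahead (ahead u e k) (-e) k = u := by
  simp [ahead]

variable {m : ZMod n → ℕ} (x : ZMod n) (ε : ℤˣ)

theorem occupied_comp (u : ZMod n) : Occupied (m ∘ isom x ε) u ↔ Occupied m (isom x ε u) := Iff.rfl

theorem tower_comp (u : ZMod n) : Tower (m ∘ isom x ε) u ↔ Tower m (isom x ε u) := Iff.rfl

theorem hasTower_comp : HasTower (m ∘ isom x ε) ↔ HasTower m :=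
  ((isom_surjective x ε).exists (p := fun u => Tower m u)).symm

theorem ringDist_isom (u v : ZMod n) : ringDist (isom x ε u) (isom x ε v) = ringDist u v := by
  rcases Int.units_eq_one_or ε with rfl | rfl
  · simp [isom, ringDist]
  · rw [ringDist, ringDist, min_comm]
    simp only [isom_neg_one]
    rw [sub_sub_sub_cancel_left, sub_sub_sub_cancel_left]

theorem neighbor_comp (u : ZMod n) (e : ℤˣ) (k : ℕ) :
    Neighbor (m ∘ isom x ε) u e k ↔ Neighbor m (isom x ε u) (ε * e) k := by
  simp only [Neighbor, occupied_comp, isom_ahead]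

theorem Neighbor.reverse {u : ZMod n} {e : ℤˣ} {k : ℕ} (h : Neighbor m u e k) :
    Neighbor m (ahead u e k) (-e) k := by
  obtain ⟨h1, h2, h3, h4⟩ := h
  refine ⟨h1, h3, by rwa [ahead_ahead_neg], fun j hj hjk => ?_⟩
  have := h4 (k - j) (by omega) (by omega)
  convert this using 1
  simp only [ahead, Nat.cast_sub hjk.le]; push_cast; ring_nf

/-- Conjugating a reflection by an isometry gives a reflection again; the new parameter is the
source of the formula for `axisMap`. -/
theorem isom_sub (a u : ZMod n) :
    isom x ε (a - u) = (2 * x + ((ε : ℤ) : ZMod n) * a) - isom x ε u := by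
  simp only [isom]; ring

/-- The image of the axis `a`. -/
def axisMap (a : ZMod n) : ZMod n := isom (2 * x) ε a

theorem axisMap_sub (a u : ZMod n) : isom x ε (a - u) = axisMap x ε a - isom x ε u := isom_sub x ε a u

theorem isAxis_comp (a : ZMod n) : IsAxis (m ∘ isom x ε) a ↔ IsAxis m (axisMap x ε a) := by
  simp only [IsAxis, Function.comp, axisMap_sub]
  exact ((isom_surjective x ε).forall
    (p := fun u => m (axisMap x ε a - u) = m u)).symm

theorem axisMap_surjective : Function.Surjective (axisMap x ε) := isom_surjective _ _

theorem symmetric_comp : Symmetric (m ∘ isom x ε) ↔ Symmetric m := by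
  simp only [Symmetric, isAxis_comp]
  exact exists_iff_of_surjective (axisMap_surjective x ε) fun a => Iff.rfl

theorem interDist_comp : interDist (m ∘ isom x ε) = interDist m := by
  simp only [interDist]
  congr 1
  ext d
  exact exists_iff_of_surjective (isom_surjective x ε) fun u =>
    exists_iff_of_surjective (isom_surjective x ε) fun v => by
      simp only [ringDist_isom, Ne, isom_inj, occupied_comp, tower_comp]

/-- The first node, in direction `1`, of the image of the block `b, b + d, …, b + (s - 1) d`. -/
def blockMap (d s : ℕ) (b : ZMod n) : ZMod n :=
  isom x ε (if ε = 1 then b else ahead b 1 ((s - 1) * d))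

theorem blockMap_one (d s : ℕ) (b : ZMod n) : blockMap x 1 d s b = x + b := by
  simp [blockMap, isom]

theorem blockMap_neg_one (d s : ℕ) (b : ZMod n) :
    blockMap x (-1) d s b = x - b - (((s - 1) * d : ℕ) : ZMod n) := by
  rw [blockMap, if_neg (by decide), isom_neg_one, ahead_one]; ring

theorem blockMap_injective (d s : ℕ) : Function.Injective (blockMap x ε d s) := by
  intro u v h
  rcases Int.units_eq_one_or ε with rfl | rfl
  · simpa [blockMap_one] using h
  · simpa [blockMap_neg_one] using h

theorem blockMap_surjective (d s : ℕ) : Function.Surjective (blockMap x ε d s) := by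
  intro v
  rcases Int.units_eq_one_or ε with rfl | rfl
  · exact ⟨v - x, by simp [blockMap_one]⟩
  · exact ⟨x - v - (((s - 1) * d : ℕ) : ZMod n), by rw [blockMap_neg_one]; ring⟩

/-- A reflection reads the block backwards, so index `i` becomes `s - 1 - i`. -/
theorem inBlock_blockMap (d s : ℕ) (b u : ZMod n) :
    InBlock d (blockMap x ε d s b) s (isom x ε u) ↔ InBlock d b s u := by
  rcases Int.units_eq_one_or ε with rfl | rfl
  · simp only [InBlock, blockMap_one, isom_one, ahead_one, add_assoc, add_right_inj]
  · simp only [InBlock, blockMap_neg_one, isom_neg_one, ahead_one]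
    constructor
    · rintro ⟨i, hi, h⟩
      refine ⟨s - 1 - i, by omega, ?_⟩
      obtain ⟨j, hj⟩ : ∃ j, s - 1 = i + j := ⟨s - 1 - i, by omega⟩
      rw [hj] at h ⊢
      rw [Nat.add_sub_cancel_left]
      push_cast at h ⊢
      linear_combination -h
    · rintro ⟨i, hi, h⟩
      refine ⟨s - 1 - i, by omega, ?_⟩
      obtain ⟨j, hj⟩ : ∃ j, s - 1 = i + j := ⟨s - 1 - i, by omega⟩
      rw [hj] at ⊢
      rw [Nat.add_sub_cancel_left]
      push_cast at h ⊢
      linear_combination -h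

theorem IsBlock.blockMap {d s : ℕ} {b : ZMod n} (h : IsBlock (m ∘ isom x ε) d b s) :
    IsBlock m d (blockMap x ε d s b) s := by
  obtain ⟨h1, h2, h3, h4⟩ := h
  rcases Int.units_eq_one_or ε with rfl | rfl
  · simp only [neighbor_comp, isom_ahead, one_mul] at h2 h3 h4
    rw [blockMap_one, ← isom_one]
    exact ⟨h1, h2, h3, h4⟩
  · simp only [neighbor_comp, isom_ahead, neg_mul, one_mul, neg_neg, mul_one] at h2 h3 h4
    have e1 : RingExploration.blockMap x (-1) d s b = ahead (isom x (-1) b) (-1) ((s - 1) * d) := by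
      rw [blockMap_neg_one, isom_neg_one, ahead_neg_one]
    refine ⟨h1, fun i hi => ?_, ?_, by rwa [e1]⟩
    -- Edge `i` of the reflected block is edge `s - 2 - i` of the original one, traversed in the
    -- opposite direction.
    · have := (h2 (s - 2 - i) (by omega)).reverse
      rw [neg_neg] at this
      convert this using 1
      · obtain ⟨j, hj⟩ : ∃ j, s = i + j + 2 := ⟨s - 2 - i, by omega⟩
        rw [e1, hj]
        simp only [ahead_one, ahead_neg_one, show i + j + 2 - 2 - i = j by omega,
          show i + j + 2 - 1 = i + j + 1 by omega]
        push_cast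
        ring
    · rw [e1]
      convert h4 using 2
      simp only [ahead_one, ahead_neg_one]
      ring

theorem isom_isom_inv (u : ZMod n) :
    isom x ε (isom (-(((ε : ℤ) : ZMod n) * x)) ε u) = u := by
  rcases Int.units_eq_one_or ε with rfl | rfl <;> simp [isom]

/-- With this, a one-way transport lemma becomes an equivalence: apply it once more to the inverse
isometry. -/
theorem comp_isom_comp_inv :
    (m ∘ isom x ε) ∘ isom (-(((ε : ℤ) : ZMod n) * x)) ε = m :=
  funext fun u => congrArg m (isom_isom_inv x ε u)

theorem isBlock_comp {d s : ℕ} {b : ZMod n} :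
    IsBlock (m ∘ isom x ε) d b s ↔ IsBlock m d (blockMap x ε d s b) s := by
  refine ⟨IsBlock.blockMap x ε, fun h => ?_⟩
  rw [← comp_isom_comp_inv (m := m) x ε] at h
  have := h.blockMap
  convert this using 1
  rcases Int.units_eq_one_or ε with rfl | rfl
  · simp [blockMap_one]
  · simp only [blockMap_neg_one]; push_cast; ring

theorem inOneBlock_comp (u : ZMod n) :
    InOneBlock (m ∘ isom x ε) u ↔ InOneBlock m (isom x ε u) := by
  simp only [InOneBlock]
  -- The size is quantified first, because the image of the starting node depends on it.
  rw [exists_comm, exists_comm (α := ZMod n)]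
  exact exists_congr fun s => exists_iff_of_surjective (blockMap_surjective x ε 1 s) fun b => by
    rw [isBlock_comp, inBlock_blockMap]

theorem singleBlock_comp (b : ZMod n) (s : ℕ) :
    SingleBlock (m ∘ isom x ε) b s ↔ SingleBlock m (blockMap x ε (interDist m) s b) s := by
  simp only [SingleBlock, isBlock_comp, interDist_comp]
  refine and_congr_right fun _ => ?_
  rw [forall_comm, forall_comm (α := ZMod n)]
  refine forall_congr' fun s' => forall_iff_of_surjective (blockMap_surjective x ε _ s') fun b' =>
    imp_congr_right fun _ => ?_
  constructor
  · rintro ⟨rfl, rfl⟩; exact ⟨rfl, rfl⟩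
  · rintro ⟨h, rfl⟩; exact ⟨blockMap_injective x ε _ _ h, rfl⟩

theorem isolated_comp (u : ZMod n) : Isolated (m ∘ isom x ε) u ↔ Isolated m (isom x ε u) := by
  simp only [Isolated, interDist_comp]
  exact and_congr Iff.rfl (forall_iff_of_surjective (isom_surjective x ε) fun v => by
    simp only [Ne, isom_inj, ringDist_isom, occupied_comp])

theorem blockDist_blockMap (d s : ℕ) (b u : ZMod n) :
    blockDist d (blockMap x ε d s b) s (isom x ε u) = blockDist d b s u := by
  simp only [blockDist]
  congr 1
  ext k
  exact (exists_iff_of_surjective (mul_unit_surjective ε) fun e => by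
    rw [← isom_ahead, inBlock_blockMap]).symm

theorem towardsBlock_blockMap (d s : ℕ) (b u : ZMod n) (e : ℤˣ) :
    TowardsBlock d (blockMap x ε d s b) s (isom x ε u) (ε * e) ↔ TowardsBlock d b s u e := by
  simp only [TowardsBlock, blockDist_blockMap, ← isom_ahead, inBlock_blockMap]

theorem symNeighbor_comp (u : ZMod n) (e : ℤˣ) (k : ℕ) :
    SymNeighbor (m ∘ isom x ε) u e k ↔ SymNeighbor m (isom x ε u) (ε * e) k := by
  simp only [SymNeighbor, isAxis_comp, neighbor_comp]
  exact exists_iff_of_surjective (axisMap_surjective x ε) fun a => by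
    rw [← isom_ahead, ← axisMap_sub, isom_inj]

theorem axisSideDist_comp (k : ℕ) : AxisSideDist (m ∘ isom x ε) k ↔ AxisSideDist m k := by
  simp only [AxisSideDist, isAxis_comp, neighbor_comp]
  exact exists_iff_of_surjective (isom_surjective x ε) fun u =>
    exists_iff_of_surjective (mul_unit_surjective ε) fun e =>
    exists_iff_of_surjective (axisMap_surjective x ε) fun a => by
      simp only [← isom_ahead, ← axisMap_sub, Ne, isom_inj]

theorem exists_symNeighbor_comp (k : ℕ) :
    (∃ u e, SymNeighbor (m ∘ isom x ε) u e k) ↔ ∃ u e, SymNeighbor m u e k := by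
  simp only [symNeighbor_comp]
  exact exists_iff_of_surjective (isom_surjective x ε) fun u =>
    exists_iff_of_surjective (mul_unit_surjective ε) fun e => Iff.rfl

theorem evenIsOddPlusOne_comp : EvenIsOddPlusOne (m ∘ isom x ε) ↔ EvenIsOddPlusOne m := by
  simp only [EvenIsOddPlusOne, exists_symNeighbor_comp]

theorem inBlockWithNonSym_comp (u : ZMod n) :
    InBlockWithNonSym (m ∘ isom x ε) u ↔ InBlockWithNonSym m (isom x ε u) := by
  simp only [InBlockWithNonSym, isAxis_comp]
  refine exists_iff_of_surjective (axisMap_surjective x ε) fun a => ?_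
  rw [exists_comm, exists_comm (α := ZMod n)]
  exact exists_congr fun s => exists_iff_of_surjective (blockMap_surjective x ε 1 s) fun b =>
    and_congr Iff.rfl (and_congr (isBlock_comp x ε) (and_congr (inBlock_blockMap x ε 1 s b u).symm
      (exists_iff_of_surjective (isom_surjective x ε) fun v => by
        simp only [inBlock_blockMap, Ne, isom_inj, ← axisMap_sub])))

/-- By maximality a block is determined by its first node. Since `blockMap` depends on the size, its
injectivity can be used for two blocks only after their sizes have been identified. -/
theorem blockMap_eq_iff {d s s' : ℕ} {b b' : ZMod n} (h : IsBlock m d (blockMap x ε d s b) s)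
    (h' : IsBlock m d (blockMap x ε d s' b') s') (e : blockMap x ε d s b = blockMap x ε d s' b') :
    s = s' := by
  rw [e] at h
  by_contra hs
  rcases Nat.lt_or_gt_of_ne hs with hlt | hlt
  · have h2 := h.1
    exact h.2.2.1 (h'.2.1 (s - 1) (by omega))
  · have h2 := h'.1
    exact h'.2.2.1 (h.2.1 (s' - 1) (by omega))

theorem TwoOneBlocks.image (h : TwoOneBlocks (m ∘ isom x ε)) : TwoOneBlocks m := by
  obtain ⟨b, s, b', s', h1, h2, h3⟩ := h
  rw [isBlock_comp] at h1 h2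
  refine ⟨_, s, _, s', h1, h2, fun e => h3 ?_⟩
  obtain rfl := blockMap_eq_iff x ε h1 h2 e
  exact blockMap_injective x ε _ _ e

theorem twoOneBlocks_comp : TwoOneBlocks (m ∘ isom x ε) ↔ TwoOneBlocks m := by
  refine ⟨TwoOneBlocks.image x ε, fun h => ?_⟩
  rw [← comp_isom_comp_inv (m := m) x ε] at h
  exact h.image

theorem STowerPlan.image (h : STowerPlan (m ∘ isom x ε)) : STowerPlan m := by
  obtain ⟨h0, b, s, b', s', h1, h2, h3, h4, h5⟩ := h
  have hs := h1.1
  have hs' := h2.1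
  rw [isBlock_comp] at h1 h2
  refine ⟨(symmetric_comp x ε).1 h0, ?_⟩
  have hne : RingExploration.blockMap x ε 1 s b ≠ RingExploration.blockMap x ε 1 s' b' := by
    intro e
    obtain rfl := blockMap_eq_iff x ε h1 h2 e
    exact h3 (blockMap_injective x ε _ _ e)
  rw [neighbor_comp] at h4
  rcases Int.units_eq_one_or ε with rfl | rfl
  · refine ⟨_, s, _, s', h1, h2, hne, ?_, ?_⟩
    · rw [one_mul] at h4
      convert h4 using 1
      simp only [blockMap_one, isom_one, ahead_one]; ring
    · simp only [blockMap_one, h5, ahead_one]; ring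
  -- A reflection exchanges the left block and the right block.
  · refine ⟨_, s', _, s, h2, h1, hne.symm, ?_, ?_⟩
    · have h6 := h4.reverse
      rw [mul_one, neg_neg] at h6
      convert h6 using 1
      rw [h5]
      simp only [blockMap_neg_one, isom_neg_one, ahead_one, mul_one, ahead_neg_one]
      push_cast [Nat.cast_sub (show 1 ≤ s by omega), Nat.cast_sub (show 1 ≤ s' by omega)]
      ring
    · rw [h5]
      simp only [blockMap_neg_one, ahead_one, mul_one]
      push_cast [Nat.cast_sub (show 1 ≤ s by omega), Nat.cast_sub (show 1 ≤ s' by omega)]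
      ring

theorem sTowerPlan_comp : STowerPlan (m ∘ isom x ε) ↔ STowerPlan m := by
  refine ⟨STowerPlan.image x ε, fun h => ?_⟩
  rw [← comp_isom_comp_inv (m := m) x ε] at h
  exact h.image

theorem ATowerPlan.image (h : ATowerPlan (m ∘ isom x ε)) : ATowerPlan m := by
  obtain ⟨h0, b, h1, h2⟩ := h
  rw [isBlock_comp] at h1
  simp only [neighbor_comp, isolated_comp] at h2
  refine ⟨fun hs => h0 ((symmetric_comp x ε).2 hs), _, h1, ?_⟩
  rcases Int.units_eq_one_or ε with rfl | rfl
  · simpa only [blockMap_one, isom_one, ahead_one, ahead_neg_one, add_assoc, add_sub_assoc,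
      one_mul] using h2
  · simp only [blockMap_neg_one, isom_neg_one, ahead_one, ahead_neg_one, mul_one, neg_mul, one_mul,
      neg_neg] at h2 ⊢
    rw [or_comm]
    push_cast at h2 ⊢
    rw [show x - b - 2 + 2 = x - b by ring, show x - b - 2 + 4 = x - (b - 2) by ring,
      show x - b - 2 = x - (b + 2) by ring, show x - (b + 2) - 2 = x - (b + 4) by ring]
    exact h2

theorem aTowerPlan_comp : ATowerPlan (m ∘ isom x ε) ↔ ATowerPlan m := by
  refine ⟨ATowerPlan.image x ε, fun h => ?_⟩
  rw [← comp_isom_comp_inv (m := m) x ε] at h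
  exact h.image

theorem towerGuide_comp : TowerGuide (m ∘ isom x ε) ↔ TowerGuide m := by
  simp only [TowerGuide, tower_comp, Function.comp, isom_ahead]
  exact exists_iff_of_surjective (isom_surjective x ε) fun u =>
    exists_iff_of_surjective (mul_unit_surjective ε) fun e => Iff.rfl

theorem towerBlock_comp : TowerBlock (m ∘ isom x ε) ↔ TowerBlock m := by
  simp only [TowerBlock, tower_comp, Function.comp]
  refine exists_iff_of_surjective (isom_surjective x ε) fun u => and_congr_right fun _ => ?_
  rcases Int.units_eq_one_or ε with rfl | rfl
  · simp only [isom_one, add_assoc, add_sub_assoc]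
  · rw [and_comm]
    simp only [isom_neg_one]
    rw [show x - (u - 1) = x - u + 1 by ring, show x - (u + 1) = x - u - 1 by ring]

theorem towerSole_comp : TowerSole (m ∘ isom x ε) ↔ TowerSole m := by
  simp only [TowerSole, hasTower_comp, symmetric_comp]
  refine and_congr_right fun _ => and_congr_right fun _ => ?_
  rw [exists_comm, exists_comm (α := ZMod n)]
  exact exists_congr fun s => exists_iff_of_surjective (blockMap_surjective x ε 1 s) fun b =>
    and_congr (isBlock_comp x ε) (forall_iff_of_surjective (isom_surjective x ε) fun u => by
      rw [inBlock_blockMap, tower_comp])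

theorem atTowerDist_comp (u : ZMod n) (k : ℕ) :
    AtTowerDist (m ∘ isom x ε) u k ↔ AtTowerDist m (isom x ε u) k := by
  exact exists_iff_of_surjective (isom_surjective x ε) fun t => by
    rw [ringDist_isom, tower_comp]

theorem phase1Sym_comp (u : ZMod n) (e : ℤˣ) :
    Phase1Sym (m ∘ isom x ε) u e ↔ Phase1Sym m (isom x ε u) (ε * e) := by
  refine exists_iff_of_surjective (mul_unit_surjective ε) fun f => exists_congr fun k =>
    and_congr (symNeighbor_comp x ε u f k) (ite_prop_congr (evenIsOddPlusOne_comp x ε)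
      (ite_prop_congr ?_ ?_ (ite_prop_congr ?_ ?_ ?_)) ?_) <;>
  simp only [axisSideDist_comp, inOneBlock_comp, inBlockWithNonSym_comp, ← mul_neg, mul_right_inj]

theorem phase1Asym_comp (u : ZMod n) (e : ℤˣ) :
    Phase1Asym (m ∘ isom x ε) u e ↔ Phase1Asym m (isom x ε u) (ε * e) := by
  simp only [Phase1Asym, singleBlock_comp, isolated_comp, interDist_comp]
  refine or_congr ?_ ?_
  · refine exists_iff_of_surjective (blockMap_surjective x ε (interDist m) 2) fun b => ?_
    simp only [blockDist_blockMap, towardsBlock_blockMap]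
    refine and_congr_right fun _ => and_congr_right fun _ => and_congr_left fun _ => ?_
    exact forall_iff_of_surjective (isom_surjective x ε) fun w => by rw [blockDist_blockMap]
  · refine exists_iff_of_surjective (blockMap_surjective x ε (interDist m) 3) fun b =>
      and_congr_right fun _ => ?_
    simp only [blockDist_blockMap, towardsBlock_blockMap]
    refine ite_prop_congr Iff.rfl ?_ Iff.rfl
    rcases Int.units_eq_one_or ε with rfl | rfl
    · simp only [blockMap_one, isom_one, ahead_one, add_assoc, add_right_inj, one_mul]
    · rw [or_comm]
      simp only [blockMap_neg_one, isom_neg_one, ahead_one]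
      rw [show x - b - (((3 - 1) * interDist m : ℕ) : ZMod n) + ((2 * interDist m : ℕ) : ZMod n)
        = x - b by push_cast; ring, show x - b - (((3 - 1) * interDist m : ℕ) : ZMod n)
        = x - (b + ((2 * interDist m : ℕ) : ZMod n)) by push_cast; ring]
      simp only [sub_right_inj, neg_mul, one_mul, neg_eq_iff_eq_neg, neg_neg]

theorem phase2_comp (u : ZMod n) (e : ℤˣ) :
    Phase2 (m ∘ isom x ε) u e ↔ Phase2 m (isom x ε u) (ε * e) := by
  refine ite_prop_congr (twoOneBlocks_comp x ε) (symNeighbor_comp x ε u e 2)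
    (exists_iff_of_surjective (blockMap_surjective x ε 1 3) fun b =>
      and_congr (isBlock_comp x ε) (and_congr ?_ (not_congr ?_)))
  · rcases Int.units_eq_one_or ε with rfl | rfl
    · simp only [blockMap_one, isom_one, ahead_one, add_assoc, add_right_inj]
    · simp only [blockMap_neg_one, isom_neg_one, ahead_one]
      rw [show x - b - (((3 - 1) * 1 : ℕ) : ZMod n) + ((1 : ℕ) : ZMod n)
        = x - (b + ((1 : ℕ) : ZMod n)) by push_cast; ring, sub_right_inj]
  · exact exists_iff_of_surjective (mul_unit_surjective ε) fun f => by
      rw [neighbor_comp, isom_ahead]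

theorem phase3_comp (u : ZMod n) (e : ℤˣ) :
    Phase3 (m ∘ isom x ε) u e ↔ Phase3 m (isom x ε u) (ε * e) := by
  have key : ∀ k, (∃ v, Occupied (m ∘ isom x ε) v ∧ AtTowerDist (m ∘ isom x ε) v k) ↔
      ∃ v, Occupied m v ∧ AtTowerDist m v k := fun k =>
    exists_iff_of_surjective (isom_surjective x ε) fun v => by rw [atTowerDist_comp, occupied_comp]
  refine ite_prop_congr (not_congr (key 1)) (ite_prop_congr (towerGuide_comp x ε) ?_
    (ite_prop_congr (atTowerDist_comp x ε u 2) (ite_prop_congr (inOneBlock_comp x ε u) ?_ ?_) ?_)) ?_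
  · simp only [atTowerDist_comp, isolated_comp, neighbor_comp, isom_ahead]
  · simp only [tower_comp, isom_ahead]
  · simp only [tower_comp, isom_ahead, mul_neg]
  · refine and_congr (not_congr (key 2)) (and_congr (isolated_comp x ε u)
      (and_congr (not_congr (atTowerDist_comp x ε u _)) ?_))
    exact exists_iff_of_surjective (isom_surjective x ε) fun t => by
      rw [ringDist_isom, ← isom_ahead, isom_inj, tower_comp]
  · simp only [atTowerDist_comp, isolated_comp, neighbor_comp, isom_ahead, tower_comp]

theorem moves_comp (u : ZMod n) (e : ℤˣ) :
    Moves (m ∘ isom x ε) u e ↔ Moves m (isom x ε u) (ε * e) := by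
  refine ite_prop_congr ?_ (ite_prop_congr ?_ (ite_prop_congr (symmetric_comp x ε)
    (phase1Sym_comp x ε u e) (phase1Asym_comp x ε u e)) (ite_prop_congr ?_ (phase2_comp x ε u e)
    (phase3_comp x ε u e))) Iff.rfl
  · rw [towerBlock_comp, towerSole_comp]
  · rw [hasTower_comp, sTowerPlan_comp, aTowerPlan_comp]
  · rw [hasTower_comp]

end Isometry

/-! ### From snapshots to absolute configurations -/

section Cycle

variable {n k : ℕ} {p : Fin k → ZMod n}

/-- A snapshot is the configuration pulled back along `isom (p r) e`, with the observer at the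
origin, so this is equivariance at node `0`. -/
theorem moves_view (r : Fin k) (e f : ℤˣ) :
    Moves (view p r e) 0 f ↔ Moves (multiplicity p) (p r) (e * f) := by
  have := moves_comp (m := multiplicity p) (p r) e 0 f
  rwa [isom, mul_zero, add_zero] at this

/-- What the activation of a robot does. -/
theorem cycle_oddExploration (r : Fin k) (e : ℤˣ) :
    (∃ f, Moves (multiplicity p) (p r) f ∧ cycle (oddExploration n) p r e = ahead (p r) f 1) ∨
      ((∀ f, ¬ Moves (multiplicity p) (p r) f) ∧ cycle (oddExploration n) p r e = p r) := by
  by_cases h1 : Moves (view p r e) 0 1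
  · exact .inl ⟨e * 1, (moves_view r e 1).1 h1, by simp [cycle, oddExploration, h1]⟩
  by_cases h2 : Moves (view p r e) 0 (-1)
  · exact .inl ⟨e * -1, (moves_view r e (-1)).1 h2, by simp [cycle, oddExploration, h1, h2]⟩
  · refine .inr ⟨fun f hf => ?_, by simp [cycle, oddExploration, h1, h2]⟩
    obtain ⟨f, rfl⟩ := mul_unit_surjective e f
    rw [← moves_view] at hf
    rcases Int.units_eq_one_or f with rfl | rfl
    · exact h1 hf
    · exact h2 hf

theorem isTerminal_oddExploration
    (h : TowerBlock (multiplicity p) ∨ TowerSole (multiplicity p)) :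
    IsTerminal (oddExploration n) p := by
  have key : ∀ r e f, ¬ Moves (view p r e) 0 f := by
    intro r e f
    rw [moves_view, Moves, if_neg (by tauto)]
    exact id
  intro r e
  simp [oddExploration, key]

end Cycle

/-! ### Coordinates -/

section Coordinates

variable {n : ℕ}

theorem natCast_eq_iff {i j : ℕ} (hi : i < n) (hj : j < n) : (i : ZMod n) = (j : ZMod n) ↔ i = j := by
  rw [ZMod.natCast_eq_natCast_iff', Nat.mod_eq_of_lt hi, Nat.mod_eq_of_lt hj]

theorem exists_natCast (hn : 0 < n) (u : ZMod n) : ∃ i < n, u = (i : ZMod n) := by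
  have : NeZero n := ⟨hn.ne'⟩
  exact ⟨u.val, ZMod.val_lt u, by simp⟩

theorem ahead_natCast (i k : ℕ) :
    ahead (i : ZMod n) 1 k = ((if i + k < n then i + k else i + k - n : ℕ) : ZMod n) := by
  rw [ahead_one]
  split_ifs with h1
  · push_cast; rfl
  · rw [Nat.cast_sub (by omega)]; simp

theorem sub_natCast {i k : ℕ} (hk : k ≤ n) :
    (i : ZMod n) - k = ((if k ≤ i then i - k else i + n - k : ℕ) : ZMod n) := by
  split_ifs with h1
  · rw [Nat.cast_sub h1]
  · rw [Nat.cast_sub (by omega)]; simp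

theorem ahead_neg_natCast {i k : ℕ} (hk : k ≤ n) :
    ahead (i : ZMod n) (-1) k = ((if k ≤ i then i - k else i + n - k : ℕ) : ZMod n) := by
  rw [ahead_neg_one, sub_natCast hk]

theorem ringDist_natCast {i j : ℕ} (hi : i < n) (hj : j < n) :
    ringDist (i : ZMod n) (j : ZMod n) =
      if i ≤ j then min (j - i) (n - (j - i)) else min (i - j) (n - (i - j)) := by
  have hv : ∀ k, k < n → ((k : ℕ) : ZMod n).val = k := fun k hk => ZMod.val_natCast_of_lt hk
  rw [ringDist, sub_natCast hi.le, sub_natCast hj.le]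
  rcases lt_trichotomy i j with h | rfl | h
  · rw [if_pos h.le, if_neg (by omega), if_pos h.le, hv _ (by omega), hv _ (by omega)]
    omega
  · simp
  · rw [if_pos h.le, if_neg (by omega), if_neg (by omega), hv _ (by omega), hv _ (by omega)]
    omega

theorem Neighbor.unique {m : ZMod n → ℕ} {u : ZMod n} {e : ℤˣ} {k l : ℕ} (h : Neighbor m u e k)
    (h' : Neighbor m u e l) : k = l := by
  by_contra hkl
  rcases Nat.lt_or_gt_of_ne hkl with hlt | hlt
  · exact h'.2.2.2 k h.1 hlt h.2.2.1
  · exact h.2.2.2 l h'.1 hlt h'.2.2.1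

theorem neighbor_reverse_iff {m : ZMod n → ℕ} {u : ZMod n} {e : ℤˣ} {k : ℕ} :
    Neighbor m (ahead u e k) (-e) k ↔ Neighbor m u e k := by
  refine ⟨fun h => ?_, Neighbor.reverse⟩
  have := h.reverse
  rwa [ahead_ahead_neg, neg_neg] at this

end Coordinates

theorem forall_fin_four {q : Fin 4 → Prop} : (∀ j, q j) ↔ q 0 ∧ q 1 ∧ q 2 ∧ q 3 :=
  ⟨fun h => ⟨h 0, h 1, h 2, h 3⟩, fun ⟨h0, h1, h2, h3⟩ j => by
    fin_cases j
    exacts [h0, h1, h2, h3]⟩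

theorem exists_fin_four {q : Fin 4 → Prop} : (∃ j, q j) ↔ q 0 ∨ q 1 ∨ q 2 ∨ q 3 := by
  have := forall_fin_four (q := fun j => ¬ q j)
  rw [← not_iff_not]
  push Not
  exact this

/-- The four nodes `0, a, a + b, a + b + c`. -/
def stdNode (a b c : ℕ) (i : Fin 4) : ℕ := ![0, a, a + b, a + b + c] i

/-- The configuration with one robot on each of the nodes `0, a, a + b, a + b + c`. -/
def std (n a b c : ℕ) : ZMod n → ℕ :=
  multiplicity fun i : Fin 4 => ((stdNode a b c i : ℕ) : ZMod n)

theorem std_natCast {n a b c i : ℕ} (h : a + b + c < n) (hi : i < n) :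
    std n a b c (i : ZMod n) = (if i = 0 then 1 else 0) + (if i = a then 1 else 0) +
      (if i = a + b then 1 else 0) + (if i = a + b + c then 1 else 0) := by
  have key : ∀ j : ℕ, j < n → (((j : ℕ) : ZMod n) = (i : ZMod n) ↔ i = j) := fun j hj => by
    rw [natCast_eq_iff hj hi, eq_comm]
  rw [std, multiplicity, Finset.card_filter, Fin.sum_univ_four]
  simp only [stdNode, Matrix.cons_val]
  simp only [key 0 (by omega), key a (by omega), key (a + b) (by omega), key (a + b + c) (by omega)]

/-! ### The occupied nodes of four separated robots -/

section NoTower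

variable {n a b c d : ℕ}

theorem std_eq_one_iff (ha : 0 < a) (hb : 0 < b) (hc : 0 < c) (h : a + b + c < n) {i : ℕ}
    (hi : i < n) : std n a b c (i : ZMod n) = 1 ↔ i = 0 ∨ i = a ∨ i = a + b ∨ i = a + b + c := by
  rw [std_natCast h hi]; split_ifs <;> omega

theorem std_le_one (ha : 0 < a) (hb : 0 < b) (hc : 0 < c) (h : a + b + c < n) (u : ZMod n) :
    std n a b c u ≤ 1 := by
  obtain ⟨i, hi, rfl⟩ := exists_natCast (by omega) u
  rw [std_natCast h hi]; split_ifs <;> omega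

theorem not_hasTower_std (ha : 0 < a) (hb : 0 < b) (hc : 0 < c) (h : a + b + c < n) :
    ¬ HasTower (std n a b c) := by
  rintro ⟨u, hu⟩
  have := std_le_one ha hb hc h u
  rw [Tower] at hu
  omega

theorem occupied_std_iff (ha : 0 < a) (hb : 0 < b) (hc : 0 < c) (h : a + b + c < n) {i : ℕ}
    (hi : i < n) :
    Occupied (std n a b c) (i : ZMod n) ↔ i = 0 ∨ i = a ∨ i = a + b ∨ i = a + b + c := by
  rw [Occupied, std_natCast h hi]; split_ifs <;> omega

theorem eq_stdNode_of_occupied {u : ZMod n}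
    (hu : Occupied (std n a b c) u) : ∃ j, u = (stdNode a b c j : ℕ) := by
  rw [Occupied, std, multiplicity, Nat.one_le_iff_ne_zero, Finset.card_ne_zero] at hu
  obtain ⟨j, hj⟩ := hu
  exact ⟨j, ((Finset.mem_filter.1 hj).2).symm⟩

end NoTower

/-- The nodes `P 0, P 1, P 2, P 3` are occupied, in this cyclic order, by one robot each, and `g j`
is the distance from `P j` to `P (j + 1)`. -/
structure Layout {n : ℕ} (m : ZMod n → ℕ) (g : Fin 4 → ℕ) (P : Fin 4 → ZMod n) : Prop where
  neighbor_iff : ∀ u k, Neighbor m u 1 k ↔ ∃ j, u = P j ∧ k = g j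
  next : ∀ j, ahead (P j) 1 (g j) = P (j + 1)
  injective : Function.Injective P
  occupied_iff : ∀ u, Occupied m u ↔ ∃ j, u = P j

/-! ### Neighbors, blocks, axes and inter-distance in terms of gaps -/

section Layout

variable {n : ℕ} {m : ZMod n → ℕ} {g : Fin 4 → ℕ} {P : Fin 4 → ZMod n}

theorem layout_std {a b c d : ℕ} (ha : 0 < a) (hb : 0 < b) (hc : 0 < c) (hd : 0 < d)
    (h : a + b + c + d = n) :
    Layout (std n a b c) ![a, b, c, d] fun j => ((stdNode a b c j : ℕ) : ZMod n) := by
  have hlt : ∀ j, stdNode a b c j < n := by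
    rw [forall_fin_four]; simp [stdNode]; omega
  have hnext : ∀ j, ahead ((stdNode a b c j : ℕ) : ZMod n) 1 (![a, b, c, d] j) =
      ((stdNode a b c (j + 1) : ℕ) : ZMod n) := by
    rw [forall_fin_four]
    refine ⟨?_, ?_, ?_, ?_⟩ <;> simp only [stdNode, Matrix.cons_val, ahead_natCast]
    · rw [if_pos (by omega), zero_add]; rfl
    · rw [if_pos (by omega)]; rfl
    · rw [if_pos (by omega)]; rfl
    · rw [if_neg (by omega), h, Nat.sub_self]; rfl
  have hocc : ∀ i < n, Occupied (std n a b c) ((i : ℕ) : ZMod n) ↔ _ := fun i hi =>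
    occupied_std_iff ha hb hc (by omega) hi
  have hocc' : ∀ j, Occupied (std n a b c) ((stdNode a b c j : ℕ) : ZMod n) := by
    intro j
    rw [hocc _ (hlt j)]
    revert j
    rw [forall_fin_four]; simp [stdNode]
  have hnbr : ∀ j, Neighbor (std n a b c) ((stdNode a b c j : ℕ) : ZMod n) 1 (![a, b, c, d] j) := by
    have hpos : ∀ j, 0 < ![a, b, c, d] j := by
      rw [forall_fin_four]; simp; omega
    have hempty : ∀ j k, 1 ≤ k → k < ![a, b, c, d] j →
        ¬ Occupied (std n a b c) (ahead ((stdNode a b c j : ℕ) : ZMod n) 1 k) := by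
      rw [forall_fin_four]
      refine ⟨fun k hk hkj => ?_, fun k hk hkj => ?_, fun k hk hkj => ?_, fun k hk hkj => ?_⟩ <;>
      simp only [stdNode, Matrix.cons_val] at hkj ⊢ <;>
      rw [ahead_natCast, if_pos (by omega), hocc _ (by omega)] <;> omega
    exact fun j => ⟨hpos j, hocc' j, (hnext j).symm ▸ hocc' _, hempty j⟩
  refine ⟨fun u k => ⟨fun hu => ?_, ?_⟩, hnext, ?_, fun u => ⟨eq_stdNode_of_occupied, ?_⟩⟩
  · obtain ⟨j, rfl⟩ := eq_stdNode_of_occupied hu.2.1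
    exact ⟨j, rfl, hu.unique (hnbr j)⟩
  · rintro ⟨j, rfl, rfl⟩; exact hnbr j
  · intro i j hij
    have := (natCast_eq_iff (hlt i) (hlt j)).1 hij
    fin_cases i <;> fin_cases j <;> simp [stdNode] at this ⊢ <;> omega
  · rintro ⟨j, rfl⟩; exact (hnbr j).2.1

theorem Layout.neighbor_neg_iff (L : Layout m g P) (u : ZMod n) (k : ℕ) :
    Neighbor m u (-1) k ↔ ∃ j, u = P (j + 1) ∧ k = g j := by
  have e : u = ahead (ahead u (-1) k) 1 k := by simp [ahead]
  constructor
  · intro h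
    have := h.reverse
    rw [neg_neg, L.neighbor_iff] at this
    obtain ⟨j, hj, rfl⟩ := this
    exact ⟨j, by rw [e, hj, L.next], rfl⟩
  · rintro ⟨j, rfl, rfl⟩
    rw [← L.next, neighbor_reverse_iff, L.neighbor_iff]
    exact ⟨j, rfl, rfl⟩

theorem Layout.neighbor_node (L : Layout m g P) (j : Fin 4) (k : ℕ) :
    Neighbor m (P j) 1 k ↔ k = g j := by
  rw [L.neighbor_iff]
  exact ⟨fun ⟨i, hi, hk⟩ => L.injective hi ▸ hk, fun h => ⟨j, rfl, h⟩⟩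

theorem Layout.neighbor_neg_node (L : Layout m g P) (j : Fin 4) (k : ℕ) :
    Neighbor m (P (j + 1)) (-1) k ↔ k = g j := by
  rw [L.neighbor_neg_iff]
  exact ⟨fun ⟨i, hi, hk⟩ => add_right_cancel (L.injective hi) ▸ hk, fun h => ⟨j, rfl, h⟩⟩

theorem ahead_add (u : ZMod n) (e : ℤˣ) (k l : ℕ) : ahead u e (k + l) = ahead (ahead u e k) e l := by
  simp only [ahead]; push_cast; ring

theorem ahead_zero (u : ZMod n) (e : ℤˣ) : ahead u e 0 = u := by simp [ahead]

/-- The blocks of a configuration without a tower. -/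
theorem Layout.isBlock_iff (L : Layout m g P) {k s : ℕ} {u : ZMod n} (hk : ∃ j, g j ≠ k) :
    IsBlock m k u s ↔ ∃ j, u = P j ∧ g j = k ∧ g (j + 3) ≠ k ∧ ((s = 2 ∧ g (j + 1) ≠ k) ∨
      (s = 3 ∧ g (j + 1) = k ∧ g (j + 2) ≠ k) ∨ (s = 4 ∧ g (j + 1) = k ∧ g (j + 2) = k)) := by
  have e13 : ∀ j : Fin 4, j + 1 + 1 = j + 2 ∧ j + 1 + 2 = j + 3 ∧ j + 2 + 1 = j + 3 ∧
      j + 3 + 1 = j := by decide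
  have hn1 : ∀ j, g j = k → ahead (P j) 1 (1 * k) = P (j + 1) := by
    rintro j rfl; rw [one_mul, L.next]
  have hn2 : ∀ j, g j = k → g (j + 1) = k → ahead (P j) 1 (2 * k) = P (j + 2) := by
    intro j h1 h2
    rw [show 2 * k = 1 * k + 1 * k by ring, ahead_add, hn1 _ h1, hn1 _ h2, (e13 j).1]
  have hn3 : ∀ j, g j = k → g (j + 1) = k → g (j + 2) = k →
      ahead (P j) 1 (3 * k) = P (j + 3) := by
    intro j h1 h2 h3
    rw [show 3 * k = 2 * k + 1 * k by ring, ahead_add, hn2 _ h1 h2, hn1 _ h3, (e13 j).2.2.1]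
  have hneg : ∀ j, Neighbor m (P j) (-1) k ↔ k = g (j + 3) := by
    intro j
    have := L.neighbor_neg_node (j + 3) k
    rwa [(e13 j).2.2.2] at this
  constructor
  · rintro ⟨h1, h2, h3, h4⟩
    have h0 := h2 0 (by omega)
    rw [zero_mul, ahead_zero, L.neighbor_iff] at h0
    obtain ⟨j, rfl, hj⟩ := h0
    refine ⟨j, rfl, hj.symm, fun h => h4 ((hneg j).2 h.symm), ?_⟩
    have h5 := hn1 j hj.symm
    rcases h1.eq_or_lt with rfl | hs
    · rw [show (2 - 1) * k = 1 * k by norm_num, h5, L.neighbor_node] at h3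
      exact .inl ⟨rfl, fun h => h3 h.symm⟩
    have h6 := h2 1 (by omega)
    rw [h5, L.neighbor_node] at h6
    have h7 := hn2 j hj.symm h6.symm
    rcases (show 3 ≤ s from hs).eq_or_lt with rfl | hs
    · rw [show (3 - 1) * k = 2 * k by norm_num, h7, L.neighbor_node] at h3
      exact .inr (.inl ⟨rfl, h6.symm, fun h => h3 h.symm⟩)
    have h8 := h2 2 (by omega)
    rw [h7, L.neighbor_node] at h8
    have h9 := hn3 j hj.symm h6.symm h8.symm
    rcases (show 4 ≤ s from hs).eq_or_lt with rfl | hs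
    · exact .inr (.inr ⟨rfl, h6.symm, h8.symm⟩)
    -- A fifth node would make the gap that returns to the first node equal to `k`, so the block
    -- could be extended backwards.
    have h10 := h2 3 (by omega)
    rw [h9, L.neighbor_node] at h10
    exact absurd ((hneg j).2 h10) h4
  · rintro ⟨j, rfl, hj, hj3, ⟨rfl, h⟩ | ⟨rfl, h, h'⟩ | ⟨rfl, h, h'⟩⟩
    · refine ⟨le_rfl, fun i hi => ?_, ?_, fun h => hj3 ((hneg j).1 h).symm⟩
      · obtain rfl : i = 0 := by omega
        rw [zero_mul, ahead_zero, L.neighbor_node, hj]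
      · rw [show (2 - 1) * k = 1 * k by norm_num, hn1 j hj, L.neighbor_node]
        exact fun e => h e.symm
    · refine ⟨by norm_num, fun i hi => ?_, ?_, fun h => hj3 ((hneg j).1 h).symm⟩
      · obtain rfl | rfl : i = 0 ∨ i = 1 := by omega
        · rw [zero_mul, ahead_zero, L.neighbor_node, hj]
        · rw [hn1 j hj, L.neighbor_node, h]
      · rw [show (3 - 1) * k = 2 * k by norm_num, hn2 j hj h, L.neighbor_node]
        exact fun e => h' e.symm
    · refine ⟨by norm_num, fun i hi => ?_, ?_, fun h => hj3 ((hneg j).1 h).symm⟩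
      · obtain rfl | rfl | rfl : i = 0 ∨ i = 1 ∨ i = 2 := by omega
        · rw [zero_mul, ahead_zero, L.neighbor_node, hj]
        · rw [hn1 j hj, L.neighbor_node, h]
        · rw [hn2 j hj h, L.neighbor_node, h']
      · rw [show (4 - 1) * k = 3 * k by norm_num, hn3 j hj h h', L.neighbor_node]
        exact fun e => hj3 e.symm

theorem Layout.inBlock_two (L : Layout m g P) (j : Fin 4) (u : ZMod n) :
    InBlock (g j) (P j) 2 u ↔ u = P j ∨ u = P (j + 1) := by
  constructor
  · rintro ⟨i, hi, rfl⟩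
    obtain rfl | rfl : i = 0 ∨ i = 1 := by omega
    · left; rw [zero_mul, ahead_zero]
    · right; rw [one_mul, L.next]
  · rintro (rfl | rfl)
    · exact ⟨0, by omega, by rw [zero_mul, ahead_zero]⟩
    · exact ⟨1, by omega, by rw [one_mul, L.next]⟩

theorem Layout.inBlock_three (L : Layout m g P) {j : Fin 4} (h : g (j + 1) = g j) (u : ZMod n) :
    InBlock (g j) (P j) 3 u ↔ u = P j ∨ u = P (j + 1) ∨ u = P (j + 2) := by
  have e : ahead (P j) 1 (2 * g j) = P (j + 2) := by
    rw [two_mul, ahead_add, L.next, ← h, L.next, add_assoc]; rfl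
  constructor
  · rintro ⟨i, hi, rfl⟩
    obtain rfl | rfl | rfl : i = 0 ∨ i = 1 ∨ i = 2 := by omega
    · left; rw [zero_mul, ahead_zero]
    · right; left; rw [one_mul, L.next]
    · right; right; exact e
  · rintro (rfl | rfl | rfl)
    · exact ⟨0, by omega, by rw [zero_mul, ahead_zero]⟩
    · exact ⟨1, by omega, by rw [one_mul, L.next]⟩
    · exact ⟨2, by omega, e.symm⟩

/-- The block is the maximal run of unit gaps around gap `l`; the run stops because some gap is not
`1`. The cases record how far it extends on either side, at most two gaps backwards being needed. -/
theorem Layout.exists_oneBlock (L : Layout m g P) (hk : ∃ j, g j ≠ 1) {l : Fin 4} (hl : g l = 1) :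
    ∃ b s, IsBlock m 1 b s ∧ InBlock 1 b s (P l) ∧ InBlock 1 b s (P (l + 1)) := by
  have e : ∀ j : Fin 4, j + 3 + 3 = j + 2 ∧ j + 3 + 1 = j ∧ j + 3 + 2 = j + 1 ∧
      j + 2 + 3 = j + 1 ∧ j + 2 + 1 = j + 3 ∧ j + 2 + 2 = j := by decide
  have hn : ∀ j, g j = 1 → ahead (P j) 1 1 = P (j + 1) := fun j hj => by
    have := L.next j
    rwa [hj] at this
  have e1 : ahead (P l) 1 (1 * 1) = P (l + 1) := hn l hl
  by_cases h3 : g (l + 3) = 1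
  · have e3 : ahead (P (l + 3)) 1 (1 * 1) = P l := by
      rw [one_mul, hn _ h3, (e l).2.1]
    have e4 : ahead (P (l + 3)) 1 (2 * 1) = P (l + 1) := by
      rw [show 2 * 1 = 1 * 1 + 1 from rfl, ahead_add, e3, hn _ hl]
    by_cases h2 : g (l + 2) = 1
    · have h1 : g (l + 1) ≠ 1 := by
        obtain ⟨j, hj⟩ := hk
        have : ∀ j l : Fin 4, j = l ∨ j = l + 1 ∨ j = l + 2 ∨ j = l + 3 := by decide
        rcases this j l with rfl | rfl | rfl | rfl
        exacts [absurd hl hj, hj, absurd h2 hj, absurd h3 hj]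
      have e5 : ahead (P (l + 2)) 1 (2 * 1) = P l := by
        rw [show 2 * 1 = 1 + 1 from rfl, ahead_add, hn _ h2, (e l).2.2.2.2.1, hn _ h3, (e l).2.1]
      have e6 : ahead (P (l + 2)) 1 (3 * 1) = P (l + 1) := by
        rw [show 3 * 1 = 2 * 1 + 1 from rfl, ahead_add, e5, hn _ hl]
      refine ⟨P (l + 2), 4, (L.isBlock_iff hk).2 ⟨l + 2, rfl, h2, ?_, .inr (.inr ⟨rfl, ?_, ?_⟩)⟩,
        ⟨2, by omega, e5.symm⟩, ⟨3, by omega, e6.symm⟩⟩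
      · rwa [(e l).2.2.2.1]
      · rwa [(e l).2.2.2.2.1]
      · rwa [(e l).2.2.2.2.2]
    · by_cases h1 : g (l + 1) = 1
      · refine ⟨P (l + 3), 4, (L.isBlock_iff hk).2 ⟨l + 3, rfl, h3, ?_, .inr (.inr ⟨rfl, ?_, ?_⟩)⟩,
          ⟨1, by omega, e3.symm⟩, ⟨2, by omega, e4.symm⟩⟩
        · rwa [(e l).1]
        · rwa [(e l).2.1]
        · rwa [(e l).2.2.1]
      · refine ⟨P (l + 3), 3, (L.isBlock_iff hk).2 ⟨l + 3, rfl, h3, ?_, .inr (.inl ⟨rfl, ?_, ?_⟩)⟩,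
          ⟨1, by omega, e3.symm⟩, ⟨2, by omega, e4.symm⟩⟩
        · rwa [(e l).1]
        · rwa [(e l).2.1]
        · rwa [(e l).2.2.1]
  · have key : ∀ s, 2 ≤ s → InBlock 1 (P l) s (P l) ∧ InBlock 1 (P l) s (P (l + 1)) := fun s hs =>
      ⟨⟨0, by omega, by rw [zero_mul, ahead_zero]⟩, ⟨1, by omega, e1.symm⟩⟩
    by_cases h1 : g (l + 1) = 1
    · by_cases h2 : g (l + 2) = 1
      · exact ⟨P l, 4, (L.isBlock_iff hk).2 ⟨l, rfl, hl, h3, .inr (.inr ⟨rfl, h1, h2⟩)⟩,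
          key 4 (by omega)⟩
      · exact ⟨P l, 3, (L.isBlock_iff hk).2 ⟨l, rfl, hl, h3, .inr (.inl ⟨rfl, h1, h2⟩)⟩,
          key 3 (by omega)⟩
    · exact ⟨P l, 2, (L.isBlock_iff hk).2 ⟨l, rfl, hl, h3, .inl ⟨rfl, h1⟩⟩, key 2 (by omega)⟩

theorem neighbor_of_inBlock {k s : ℕ} {b u : ZMod n} (hb : IsBlock m k b s)
    (hu : InBlock k b s u) : Neighbor m u 1 k ∨ Neighbor m u (-1) k := by
  obtain ⟨h1, h2, -, -⟩ := hb
  obtain ⟨i, hi, rfl⟩ := hu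
  by_cases h : i + 1 < s
  · exact .inl (h2 i h)
  · right
    obtain ⟨i, rfl⟩ : ∃ i', i = i' + 1 := ⟨i - 1, by omega⟩
    have := (h2 i (by omega)).reverse
    rwa [← ahead_add, ← Nat.succ_mul] at this

/-- A robot is in a 1.block iff it has a neighbor at distance 1. -/
theorem Layout.inOneBlock_iff (L : Layout m g P) (hk : ∃ j, g j ≠ 1) (j : Fin 4) :
    InOneBlock m (P j) ↔ g j = 1 ∨ g (j + 3) = 1 := by
  have e : j + 3 + 1 = j := by revert j; decide
  constructor
  · rintro ⟨b, s, hb, hu⟩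
    rcases neighbor_of_inBlock hb hu with h | h
    · exact .inl ((L.neighbor_node j 1).1 h).symm
    · have := L.neighbor_neg_node (j + 3) 1
      rw [e] at this
      exact .inr (this.1 h).symm
  · rintro (h | h)
    · obtain ⟨b, s, h1, h2, -⟩ := L.exists_oneBlock hk h
      exact ⟨b, s, h1, h2⟩
    · obtain ⟨b, s, h1, -, h2⟩ := L.exists_oneBlock hk h
      rw [e] at h2
      exact ⟨b, s, h1, h2⟩

/-- The image `z` of node `0` must be occupied, which leaves four candidates. Since `n` is odd, a
reflection fixes exactly one node, so it cannot fix a robot and permute the other three. Hence the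
robot at `0` is exchanged with an adjacent robot of the cyclic order, and the two gaps beside theirs
must agree. -/
theorem isAxis_std_iff {a b c d z : ℕ} (hn : Odd n) (ha : 0 < a) (hb : 0 < b) (hc : 0 < c) (hd : 0 < d)
    (h : a + b + c + d = n) (hz : z < n) : IsAxis (std n a b c) (z : ZMod n) ↔
      (b = d ∧ z = a) ∨ (a = c ∧ z = a + b + c) := by
  have hlt : ∀ i < n, (if i ≤ z then z - i else z + n - i) < n := fun i hi => by
    split_ifs <;> omega
  have hone : ∀ i < n, std n a b c (i : ZMod n) = 1 ↔ _ := fun i hi =>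
    std_eq_one_iff ha hb hc (by omega) hi
  obtain ⟨q, hq⟩ := hn
  constructor
  · intro hax
    have key : ∀ i < n, (i = 0 ∨ i = a ∨ i = a + b ∨ i = a + b + c) →
        ((if i ≤ z then z - i else z + n - i) = 0 ∨ (if i ≤ z then z - i else z + n - i) = a ∨
        (if i ≤ z then z - i else z + n - i) = a + b ∨
        (if i ≤ z then z - i else z + n - i) = a + b + c) := by
      intro i hi h1
      rw [← hone _ (hlt i hi), ← sub_natCast hi.le, hax]
      exact (hone i hi).2 h1
    have h0 := key 0 (by omega) (by omega)
    have h1 := key a (by omega) (by omega)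
    have h2 := key (a + b) (by omega) (by omega)
    have h3 := key (a + b + c) (by omega) (by omega)
    rw [if_pos (Nat.zero_le z), Nat.sub_zero] at h0
    rcases h0 with rfl | rfl | rfl | rfl
    · rw [if_neg (by omega)] at h1 h2 h3
      omega
    · rw [if_pos (by omega)] at h1
      rw [if_neg (by omega)] at h2 h3
      omega
    · rw [if_pos (by omega)] at h1 h2
      rw [if_neg (by omega)] at h3
      omega
    · rw [if_pos (by omega)] at h1 h2 h3
      omega
  · intro hz' u
    obtain ⟨i, hi, rfl⟩ := exists_natCast (by omega) u
    have h1 := std_le_one ha hb hc (by omega) (i : ZMod n)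
    have h2 := std_le_one ha hb hc (by omega) ((z : ZMod n) - (i : ZMod n))
    have h3 : std n a b c ((z : ZMod n) - (i : ZMod n)) = 1 ↔ std n a b c (i : ZMod n) = 1 := by
      rw [sub_natCast hi.le, hone _ (hlt i hi), hone _ hi]
      rcases hz' with ⟨rfl, rfl⟩ | ⟨rfl, rfl⟩ <;> split_ifs <;> omega
    omega

/-- Any arc between two distinct robots contains at least one whole gap, and the shortest gap `a` is
attained. -/
theorem interDist_std {a b c d : ℕ} (ha : 0 < a) (hab : a ≤ b) (hac : a ≤ c) (had : a ≤ d)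
    (h : a + b + c + d = n) : interDist (std n a b c) = a := by
  have hocc : ∀ i < n, Occupied (std n a b c) ((i : ℕ) : ZMod n) ↔ _ := fun i hi =>
    occupied_std_iff ha (by omega) (by omega) (by omega) hi
  have hmem : a ∈ {k | ∃ u v, Occupied (std n a b c) u ∧ Occupied (std n a b c) v ∧
      (u ≠ v ∨ Tower (std n a b c) u) ∧ ringDist u v = k} := by
    refine ⟨((0 : ℕ) : ZMod n), ((a : ℕ) : ZMod n), ?_, ?_, .inl ?_, ?_⟩
    · rw [hocc _ (by omega)]; omega
    · rw [hocc _ (by omega)]; omega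
    · rw [Ne, natCast_eq_iff (by omega) (by omega)]; omega
    · rw [ringDist_natCast (by omega) (by omega), if_pos (by omega)]; omega
  refine le_antisymm (Nat.sInf_le hmem) ?_
  obtain ⟨u, v, hu, hv, huv, he⟩ := Nat.sInf_mem ⟨a, hmem⟩
  rw [interDist, ← he]
  obtain ⟨i, hi, rfl⟩ := exists_natCast (by omega) u
  obtain ⟨j, hj, rfl⟩ := exists_natCast (by omega) v
  have hij : i ≠ j := by
    rcases huv with huv | huv
    · rintro rfl; exact huv rfl
    · exact absurd ⟨_, huv⟩ (not_hasTower_std ha (by omega) (by omega) (by omega))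
  rw [hocc _ hi] at hu
  rw [hocc _ hj] at hv
  rw [ringDist_natCast hi hj]
  split_ifs <;> omega

end Layout

theorem not_towerBlock_of_not_hasTower {n : ℕ} {m : ZMod n → ℕ} (h : ¬ HasTower m) :
    ¬ TowerBlock m := fun ⟨u, hu, _⟩ => h ⟨u, hu⟩

theorem Layout.gaps_of_sTowerPlan {n : ℕ} {m : ZMod n → ℕ} {g : Fin 4 → ℕ} {P : Fin 4 → ZMod n}
    (L : Layout m g P) (h : STowerPlan m) : ∃ j, g j = 1 ∧ g (j + 1) = 2 ∧ g (j + 2) = 1 := by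
  obtain ⟨-, b, s, b', s', h1, h2, -, h3, rfl⟩ := h
  have hs := h1.1
  have h4 := h1.2.1 (s - 2) (by omega)
  have h5 := h2.2.1 0 (by have := h2.1; omega)
  rw [zero_mul, ahead_zero] at h5
  rw [mul_one, L.neighbor_iff] at h4
  obtain ⟨j, hj, hgj⟩ := h4
  have e1 : ahead b 1 (s - 1) = P (j + 1) := by
    rw [show s - 1 = s - 2 + 1 by omega, ahead_add, hj, hgj, L.next]
  rw [e1, L.neighbor_node] at h3
  have e2 : ahead b 1 (s + 1) = P (j + 2) := by
    rw [show s + 1 = s - 1 + 2 by omega, ahead_add, e1, h3, L.next, add_assoc]; rfl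
  rw [e2, L.neighbor_node] at h5
  exact ⟨j, hgj.symm, h3.symm, h5.symm⟩

/-! ### Symmetric configurations without a tower -/

section Symmetric

variable {n E y O : ℕ}

theorem isAxis_sym_iff (hE : Even E) (hE0 : 0 < E) (hy : 0 < y) (hO : Odd O)
    (h : E + y + O + y = n) (z : ZMod n) : IsAxis (std n E y O) z ↔ z = (E : ZMod n) := by
  have hn : Odd n := by
    rw [← h]; obtain ⟨q, rfl⟩ := hE; obtain ⟨r, rfl⟩ := hO; exact ⟨q + r + y, by ring⟩
  obtain ⟨i, hi, rfl⟩ := exists_natCast (by omega) z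
  rw [isAxis_std_iff hn hE0 hy hO.pos hy h hi, natCast_eq_iff hi (by omega)]
  obtain ⟨q, rfl⟩ := hE
  obtain ⟨r, rfl⟩ := hO
  omega

/-- In `Fin 4`, `j ↦ 1 - j` exchanges `0` with `1` and `2` with `3`: the even pair and the odd pair.
-/
theorem sub_stdNode (hE0 : 0 < E) (hy : 0 < y) (hO0 : 0 < O) (h : E + y + O + y = n) (j : Fin 4) :
    (E : ZMod n) - ((stdNode E y O j : ℕ) : ZMod n) = ((stdNode E y O (1 - j) : ℕ) : ZMod n) := by
  revert j
  rw [forall_fin_four]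
  refine ⟨?_, ?_, ?_, ?_⟩ <;> simp only [stdNode, Matrix.cons_val]
  · rw [sub_natCast (by omega), if_pos (by omega)]; rfl
  · rw [sub_natCast (by omega), if_pos (by omega), Nat.sub_self]; rfl
  · rw [sub_natCast (by omega), if_neg (by omega), show E + n - (E + y) = E + y + O by omega]; rfl
  · rw [sub_natCast (by omega), if_neg (by omega), show E + n - (E + y + O) = E + y by omega]; rfl

theorem neighbor_sym_iff (hE : Even E) (hE0 : 0 < E) (hy : 0 < y) (hO : Odd O)
    (h : E + y + O + y = n) (u : ZMod n) (e : ℤˣ) (k : ℕ) :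
    SymNeighbor (std n E y O) u e k ↔
      k = E ∧ ((u = (stdNode E y O 0 : ℕ) ∧ e = 1) ∨ (u = (stdNode E y O 1 : ℕ) ∧ e = -1)) ∨
      k = O ∧ ((u = (stdNode E y O 2 : ℕ) ∧ e = 1) ∨ (u = (stdNode E y O 3 : ℕ) ∧ e = -1)) := by
  have L := layout_std hE0 hy hO.pos hy h
  have hinj := L.injective
  have hsub := sub_stdNode hE0 hy hO.pos h
  have h1 : SymNeighbor (std n E y O) u e k ↔
      Neighbor (std n E y O) u e k ∧ ahead u e k = (E : ZMod n) - u := by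
    simp only [SymNeighbor, isAxis_sym_iff hE hE0 hy hO h, exists_eq_left]
  rw [h1]
  have hne : (1 : ℤˣ) ≠ -1 := by decide
  constructor
  · rcases Int.units_eq_one_or e with rfl | rfl
    · rw [L.neighbor_iff]
      rintro ⟨⟨j, rfl, rfl⟩, h2⟩
      rw [L.next, hsub] at h2
      have := hinj h2
      fin_cases j
      · simp
      · exact absurd this (by decide)
      · simp
      · exact absurd this (by decide)
    · rw [L.neighbor_neg_iff]
      rintro ⟨⟨j, rfl, rfl⟩, h2⟩
      rw [← L.next, ahead_ahead_neg, L.next, hsub] at h2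
      have := hinj h2
      fin_cases j
      · simp
      · exact absurd this (by decide)
      · simp
      · exact absurd this (by decide)
  · rintro (⟨rfl, ⟨rfl, rfl⟩ | ⟨rfl, rfl⟩⟩ | ⟨rfl, ⟨rfl, rfl⟩ | ⟨rfl, rfl⟩⟩)
    · exact ⟨(L.neighbor_node 0 k).2 rfl, (L.next 0).trans (hsub 0).symm⟩
    · refine ⟨(L.neighbor_neg_node 0 k).2 rfl, Eq.trans ?_ (hsub 1).symm⟩
      exact (congrArg (ahead · (-1) k) (L.next 0).symm).trans (ahead_ahead_neg _ 1 k)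
    · exact ⟨(L.neighbor_node 2 k).2 rfl, (L.next 2).trans (hsub 2).symm⟩
    · refine ⟨(L.neighbor_neg_node 2 k).2 rfl, Eq.trans ?_ (hsub 3).symm⟩
      exact (congrArg (ahead · (-1) k) (L.next 2).symm).trans (ahead_ahead_neg _ 1 k)

theorem axisSideDist_sym_iff (hE : Even E) (hE0 : 0 < E) (hy : 0 < y) (hO : Odd O)
    (h : E + y + O + y = n) (k : ℕ) : AxisSideDist (std n E y O) k ↔ k = y := by
  have L := layout_std hE0 hy hO.pos hy h
  have hinj := L.injective
  have hsub := sub_stdNode hE0 hy hO.pos h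
  constructor
  · rintro ⟨u, e, z, hz, h1, h2⟩
    rw [isAxis_sym_iff hE hE0 hy hO h] at hz
    subst hz
    rcases Int.units_eq_one_or e with rfl | rfl
    · rw [L.neighbor_iff] at h1
      obtain ⟨j, rfl, rfl⟩ := h1
      rw [L.next, hsub] at h2
      fin_cases j
      · exact absurd rfl h2
      · rfl
      · exact absurd rfl h2
      · rfl
    · rw [L.neighbor_neg_iff] at h1
      obtain ⟨j, rfl, rfl⟩ := h1
      rw [← L.next, ahead_ahead_neg, L.next, hsub] at h2
      fin_cases j
      · exact absurd rfl h2
      · rfl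
      · exact absurd rfl h2
      · rfl
  · rintro rfl
    refine ⟨_, 1, _, (isAxis_sym_iff hE hE0 hy hO h _).2 rfl, (L.neighbor_node 1 k).2 rfl, ?_⟩
    rw [hsub]
    intro h2
    exact absurd (hinj ((L.next 1).symm.trans h2)) (by decide)

theorem evenIsOddPlusOne_sym_iff (hE : Even E) (hE0 : 0 < E) (hy : 0 < y) (hO : Odd O)
    (h : E + y + O + y = n) : EvenIsOddPlusOne (std n E y O) ↔ E = O + 1 := by
  have key : ∀ k, (∃ u e, SymNeighbor (std n E y O) u e k) ↔ k = E ∨ k = O := by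
    intro k
    simp only [neighbor_sym_iff hE hE0 hy hO h]
    constructor
    · rintro ⟨u, e, ⟨h1, -⟩ | ⟨h1, -⟩⟩ <;> simp [h1]
    · rintro (h1 | h1)
      · exact ⟨_, 1, .inl ⟨h1, .inl ⟨rfl, rfl⟩⟩⟩
      · exact ⟨_, 1, .inr ⟨h1, .inl ⟨rfl, rfl⟩⟩⟩
  simp only [EvenIsOddPlusOne, key]
  obtain ⟨q, rfl⟩ := hE
  obtain ⟨r, rfl⟩ := hO
  constructor
  · rintro ⟨k, ⟨l, rfl⟩, h1, h2⟩; omega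
  · intro h1; exact ⟨2 * r + 1, ⟨r, rfl⟩, .inr rfl, .inl h1.symm⟩

/-- If `y ≠ 1`, the only possible unit gap is `O`, whose two ends are symmetric to each other. If `y
= 1`, each robot of the odd pair touches a robot of the even pair. -/
theorem inBlockWithNonSym_sym_iff (hE : Even E) (hE0 : 0 < E) (hy : 0 < y) (hO : Odd O)
    (h : E + y + O + y = n) {j : Fin 4} (hj : j = 2 ∨ j = 3) :
    InBlockWithNonSym (std n E y O) ((stdNode E y O j : ℕ) : ZMod n) ↔ y = 1 := by
  have L := layout_std hE0 hy hO.pos hy h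
  have hinj := L.injective
  have hsub := sub_stdNode hE0 hy hO.pos h
  have hE1 : E ≠ 1 := by rintro rfl; exact absurd hE (by decide)
  have hk : ∃ j, ![E, y, O, y] j ≠ 1 := ⟨0, hE1⟩
  constructor
  · rintro ⟨z, b, s, hz, hb, hu, v, hv, hvu, hvz⟩
    rw [isAxis_sym_iff hE hE0 hy hO h] at hz
    subst hz
    by_contra hy1
    rw [L.isBlock_iff hk] at hb
    obtain ⟨l, rfl, hl, -, hs⟩ := hb
    obtain rfl : l = 2 := by
      fin_cases l
      exacts [absurd hl hE1, absurd hl hy1, rfl, absurd hl hy1]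
    obtain ⟨rfl, -⟩ : s = 2 ∧ _ := hs.resolve_right
      (by rintro (⟨-, h1, -⟩ | ⟨-, h1, -⟩) <;> exact hy1 h1)
    rw [hsub] at hvz
    have h2 := L.inBlock_two 2 v
    rw [hl] at h2
    rw [h2] at hv
    rcases hj with rfl | rfl
    · rcases hv with rfl | rfl
      · exact hvu rfl
      · exact hvz rfl
    · rcases hv with rfl | rfl
      · exact hvz rfl
      · exact hvu rfl
  · rintro rfl
    have hax := (isAxis_sym_iff hE hE0 hy hO h _).2 rfl
    rcases hj with rfl | rfl
    · obtain ⟨b, s, h1, h2, h3⟩ := L.exists_oneBlock hk (l := 1) rfl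
      refine ⟨_, b, s, hax, h1, h3, _, h2, ?_, ?_⟩
      · exact hinj.ne (by decide)
      · rw [hsub]; exact hinj.ne (by decide)
    · obtain ⟨b, s, h1, h2, h3⟩ := L.exists_oneBlock hk (l := 3) rfl
      refine ⟨_, b, s, hax, h1, h2, _, h3, ?_, ?_⟩
      · exact hinj.ne (by decide)
      · rw [hsub]; exact hinj.ne (by decide)

/-- The plan requires consecutive gaps `1, 2, 1`. By parity `E` cannot be `1` and `O` cannot be `2`,
so the gap `2` is `E`. Conversely, `n > 7` excludes `O = 1`, which would merge the two blocks. -/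
theorem sTowerPlan_sym_iff (hE : Even E) (hE0 : 0 < E) (hy : 0 < y) (hO : Odd O)
    (h : E + y + O + y = n) (hn : 7 < n) : STowerPlan (std n E y O) ↔ E = 2 ∧ y = 1 := by
  have L := layout_std hE0 hy hO.pos hy h
  have hE1 : E ≠ 1 := by rintro rfl; exact absurd hE (by decide)
  constructor
  · intro hs
    obtain ⟨j, h1, h2, h3⟩ := L.gaps_of_sTowerPlan hs
    fin_cases j
    · exact absurd h1 hE1
    · exact absurd hO ((show O = 2 from h2) ▸ by decide)
    · exact absurd h3 hE1
    · exact ⟨h2, h1⟩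
  · rintro ⟨rfl, rfl⟩
    have hk : ∃ j, ![2, 1, O, 1] j ≠ 1 := ⟨0, hE1⟩
    have hO1 : O ≠ 1 := by omega
    refine ⟨⟨_, (isAxis_sym_iff hE hE0 hy hO h _).2 rfl⟩, _, 2, _, 2,
      (L.isBlock_iff hk).2 ⟨3, rfl, rfl, hO1, .inl ⟨rfl, hE1⟩⟩,
      (L.isBlock_iff hk).2 ⟨1, rfl, rfl, hE1, .inl ⟨rfl, hO1⟩⟩, L.injective.ne (by decide), ?_, ?_⟩
    · exact (L.next 3).symm ▸ (L.neighbor_node 0 2).2 rfl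
    · rw [show 2 + 1 = 1 + 2 from rfl, ahead_add]
      exact ((congrArg (ahead · 1 2) (L.next 3)).trans (L.next 0)).symm

/-- The moves in a symmetric configuration without a tower: the robots at even distance approach
each other, or move away from each other, or the robots at odd distance move away from each
other. -/
theorem moves_sym_iff (hE : Even E) (hE0 : 0 < E) (hy : 0 < y) (hO : Odd O)
    (h : E + y + O + y = n) (hn : 7 < n) (u : ZMod n) (e : ℤˣ) :
    Moves (std n E y O) u e ↔
      (y = 1 ∨ (E = O + 1 ∧ Even y ∧ 2 < E)) ∧
        ((u = (stdNode E y O 0 : ℕ) ∧ e = 1) ∨ (u = (stdNode E y O 1 : ℕ) ∧ e = -1)) ∨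
      (E = O + 1 ∧ Even y ∧ E = 2) ∧
        ((u = (stdNode E y O 0 : ℕ) ∧ e = -1) ∨ (u = (stdNode E y O 1 : ℕ) ∧ e = 1)) ∨
      (y ≠ 1 ∧ ¬ (E = O + 1 ∧ Even y)) ∧
        ((u = (stdNode E y O 2 : ℕ) ∧ e = -1) ∨ (u = (stdNode E y O 3 : ℕ) ∧ e = 1)) := by
  have L := layout_std hE0 hy hO.pos hy h
  have hE1 : E ≠ 1 := by rintro rfl; exact absurd hE (by decide)
  have hk : ∃ j, ![E, y, O, y] j ≠ 1 := ⟨0, hE1⟩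
  have hT : ¬ HasTower (std n E y O) := not_hasTower_std hE0 hy hO.pos (by omega)
  have hS : Symmetric (std n E y O) := ⟨_, (isAxis_sym_iff hE hE0 hy hO h _).2 rfl⟩
  have hnb := neighbor_sym_iff hE hE0 hy hO h
  rw [Moves, if_pos ⟨not_towerBlock_of_not_hasTower hT, fun h => hT h.1⟩]
  -- The Phase 2 rule in this case is the same closing move as the Phase 1 rules for `y = 1`, which
  -- is why all of them share one disjunct.
  by_cases hst : E = 2 ∧ y = 1
  · have hp := (sTowerPlan_sym_iff hE hE0 hy hO h hn).2 hst
    have h2 : TwoOneBlocks (std n E y O) := by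
      obtain ⟨-, b, s, b', s', h1, h2, h3, -⟩ := hp
      exact ⟨b, s, b', s', h1, h2, h3⟩
    rw [if_neg (by tauto), if_pos hT, Phase2, if_pos h2, hnb]
    have hO2 : 2 ≠ O := by rintro rfl; exact absurd hO (by decide)
    have : ¬ Even 1 := by decide
    obtain ⟨rfl, rfl⟩ := hst
    simp [hO2, this]
  · have hp : ¬ STowerPlan (std n E y O) := by
      rwa [sTowerPlan_sym_iff hE hE0 hy hO h hn]
    rw [if_pos ⟨hT, hp, fun h => h.1 hS⟩, Phase1, if_pos hS, Phase1Sym]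
    have hside := axisSideDist_sym_iff hE hE0 hy hO h
    have hy' : (∃ k, Even k ∧ AxisSideDist (std n E y O) k) ↔ Even y := by
      simp only [hside, exists_eq_right]
    have hO' : ¬ Even O := Nat.not_even_iff_odd.2 hO
    have hE' : ¬ Odd E := Nat.not_odd_iff_even.2 hE
    have key : ∀ Q : ℤˣ → ℕ → Prop, (∃ f k, SymNeighbor (std n E y O) u f k ∧ Q f k) ↔
        (u = (stdNode E y O 0 : ℕ) ∧ Q 1 E) ∨ (u = (stdNode E y O 1 : ℕ) ∧ Q (-1) E) ∨
        (u = (stdNode E y O 2 : ℕ) ∧ Q 1 O) ∨ (u = (stdNode E y O 3 : ℕ) ∧ Q (-1) O) := by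
      intro Q
      simp only [hnb]
      constructor
      · rintro ⟨f, k, ⟨rfl, ⟨h1, rfl⟩ | ⟨h1, rfl⟩⟩ | ⟨rfl, ⟨h1, rfl⟩ | ⟨h1, rfl⟩⟩, h2⟩ <;> tauto
      · rintro (⟨h1, h2⟩ | ⟨h1, h2⟩ | ⟨h1, h2⟩ | ⟨h1, h2⟩)
        · exact ⟨1, E, .inl ⟨rfl, .inl ⟨h1, rfl⟩⟩, h2⟩
        · exact ⟨-1, E, .inl ⟨rfl, .inr ⟨h1, rfl⟩⟩, h2⟩
        · exact ⟨1, O, .inr ⟨rfl, .inl ⟨h1, rfl⟩⟩, h2⟩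
        · exact ⟨-1, O, .inr ⟨rfl, .inr ⟨h1, rfl⟩⟩, h2⟩
    have hEO := evenIsOddPlusOne_sym_iff hE hE0 hy hO h
    have hblk0 := L.inOneBlock_iff hk 0
    have hblk1 := L.inOneBlock_iff hk 1
    have hns2 := inBlockWithNonSym_sym_iff hE hE0 hy hO h (j := 2) (.inl rfl)
    have hns3 := inBlockWithNonSym_sym_iff hE hE0 hy hO h (j := 3) (.inr rfl)
    rw [key]
    clear key
    have e0 : InOneBlock (std n E y O) ((stdNode E y O 0 : ℕ) : ZMod n) ↔ y = 1 := by
      rw [hblk0]; exact or_iff_right hE1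
    have e1 : InOneBlock (std n E y O) ((stdNode E y O 1 : ℕ) : ZMod n) ↔ y = 1 := by
      rw [hblk1]; exact or_iff_left hE1
    have hE2 : 2 < E ↔ E ≠ 2 := by omega
    have hO1 : O ≠ 1 → 1 < O := by have := hO.pos; omega
    by_cases hA : E = O + 1
    · simp only [if_pos (hEO.2 hA), hA, true_and]
      by_cases hB : Even y
      · have hy1 : y ≠ 1 := by rintro rfl; exact absurd hB (by decide)
        rw [hA] at hE hE'
        simp only [if_pos (hy'.2 hB), hB, hE, hO', hy1, true_and, false_and, and_false, or_false,
          false_or, not_true]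
        by_cases h2 : 2 < O + 1
        · simp [h2, show O ≠ 1 by omega]
        · simp [show O = 1 by omega]
      · simp only [if_neg (mt hy'.1 hB), hB, hside]
        rw [hA] at hE hE'
        by_cases hy1 : y = 1
        · simp [hy1, hE, hO']
        · simp [hy1, Ne.symm hy1, hE', hO]
    -- When `E ≠ O + 1`, the condition `y = 1` decides which pair acts: it puts the even pair in
    -- 1.blocks and keeps the odd pair still.
    · simp only [if_neg (mt hEO.1 hA), hA, if_pos hE, if_neg hO', false_and, or_false, false_or,
        not_false_iff, and_true]
      have r0 : (u = (stdNode E y O 0 : ℕ) ∧ 2 < E ∧ InOneBlock (std n E y O) u ∧ e = 1) ↔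
          y = 1 ∧ u = (stdNode E y O 0 : ℕ) ∧ e = 1 := by
        constructor
        · rintro ⟨rfl, -, h1, h2⟩; exact ⟨e0.1 h1, rfl, h2⟩
        · rintro ⟨h1, rfl, h2⟩; exact ⟨rfl, by omega, e0.2 h1, h2⟩
      have r1 : (u = (stdNode E y O 1 : ℕ) ∧ 2 < E ∧ InOneBlock (std n E y O) u ∧ e = -1) ↔
          y = 1 ∧ u = (stdNode E y O 1 : ℕ) ∧ e = -1 := by
        constructor
        · rintro ⟨rfl, -, h1, h2⟩; exact ⟨e1.1 h1, rfl, h2⟩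
        · rintro ⟨h1, rfl, h2⟩; exact ⟨rfl, by omega, e1.2 h1, h2⟩
      have r2 : (u = (stdNode E y O 2 : ℕ) ∧ ¬ InBlockWithNonSym (std n E y O) u ∧ e = -1) ↔
          y ≠ 1 ∧ u = (stdNode E y O 2 : ℕ) ∧ e = -1 := by
        constructor
        · rintro ⟨rfl, h1, h2⟩; exact ⟨mt hns2.2 h1, rfl, h2⟩
        · rintro ⟨h1, rfl, h2⟩; exact ⟨rfl, mt hns2.1 h1, h2⟩
      have r3 : (u = (stdNode E y O 3 : ℕ) ∧ ¬ InBlockWithNonSym (std n E y O) u ∧ e = - -1) ↔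
          y ≠ 1 ∧ u = (stdNode E y O 3 : ℕ) ∧ e = 1 := by
        rw [neg_neg]
        constructor
        · rintro ⟨rfl, h1, h2⟩; exact ⟨mt hns3.2 h1, rfl, h2⟩
        · rintro ⟨h1, rfl, h2⟩; exact ⟨rfl, mt hns3.1 h1, h2⟩
      rw [r0, r1, r2, r3]
      by_cases hy1 : y = 1
      · simp only [hy1, true_and, ne_eq, not_true, false_and, or_false]
      · simp only [hy1, true_and, ne_eq, not_false_iff, false_and, false_or]

end Symmetric

theorem blockDist_eq_of {n d s k : ℕ} {b u : ZMod n} {e : ℤˣ} (h : InBlock d b s (ahead u e k))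
    (hlt : ∀ j < k, ∀ f, ¬ InBlock d b s (ahead u f j)) : blockDist d b s u = k := by
  refine le_antisymm (Nat.sInf_le ⟨e, h⟩) ?_
  by_contra hk
  obtain ⟨f, hf⟩ := Nat.sInf_mem (s := {k | ∃ e, InBlock d b s (ahead u e k)}) ⟨k, e, h⟩
  exact hlt _ (not_le.1 hk) f hf

/-! ### Asymmetric configurations without a tower -/

section Asymmetric

variable {n a b c d : ℕ}

/-- Normal form of the asymmetric case: `a` is a shortest gap and `b` the smaller of the two gaps
beside it. The strict inequalities `b < d` and `a < c` rule out both possible axes. -/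
theorem not_symmetric_std (hn : Odd n) (ha : 0 < a) (hab : a ≤ b) (hbd : b < d) (hac : a < c)
    (h : a + b + c + d = n) : ¬ Symmetric (std n a b c) := by
  rintro ⟨z, hz⟩
  obtain ⟨i, hi, rfl⟩ := exists_natCast (by omega) z
  rw [isAxis_std_iff hn ha (by omega) (by omega) (by omega) h hi] at hz
  omega

/-- Only the gap `a`, and possibly `b`, has length `a`, because `c` and `d` are strictly longer.
This makes the block single. -/
theorem isBlock_asym_iff (ha : 0 < a) (hab : a ≤ b) (hbd : b < d) (hac : a < c)
    (h : a + b + c + d = n) (u : ZMod n) (s : ℕ) : IsBlock (std n a b c) a u s ↔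
      u = (stdNode a b c 0 : ℕ) ∧ s = if a = b then 3 else 2 := by
  have L := layout_std ha (by omega : 0 < b) (by omega : 0 < c) (by omega : 0 < d) h
  rw [L.isBlock_iff ⟨2, hac.ne'⟩, exists_fin_four]
  simp only [Matrix.cons_val, Fin.isValue]
  change _ ∧ _ ∧ d ≠ a ∧ ((_ ∧ b ≠ a) ∨ (_ ∧ b = a ∧ c ≠ a) ∨ (_ ∧ b = a ∧ c = a)) ∨
    _ ∧ _ ∧ a ≠ a ∧ _ ∨ _ ∧ c = a ∧ _ ∨ _ ∧ d = a ∧ _ ↔ _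
  constructor
  · rintro (⟨h1, -, -, h2⟩ | ⟨-, -, h2, -⟩ | ⟨-, h2, -⟩ | ⟨-, h2, -⟩)
    · refine ⟨h1, ?_⟩
      split_ifs <;> omega
    · exact absurd rfl h2
    · omega
    · omega
  · rintro ⟨h1, h2⟩
    refine .inl ⟨h1, trivial, by omega, ?_⟩
    split_ifs at h2 <;> omega

theorem not_isBlock_one (ha : 1 < a) (hab : a ≤ b) (hbd : b < d) (hac : a < c)
    (h : a + b + c + d = n) (u : ZMod n) (s : ℕ) : ¬ IsBlock (std n a b c) 1 u s := by
  have L := layout_std (by omega : 0 < a) (by omega : 0 < b) (by omega : 0 < c)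
    (by omega : 0 < d) h
  have hg : ∀ j, ![a, b, c, d] j ≠ 1 := by
    rw [forall_fin_four]
    exact ⟨ha.ne', show b ≠ 1 by omega, show c ≠ 1 by omega, show d ≠ 1 by omega⟩
  rw [L.isBlock_iff ⟨0, hg 0⟩]
  rintro ⟨j, -, hj, -⟩
  exact hg j hj

theorem singleBlock_asym_iff (ha : 0 < a) (hab : a ≤ b) (hbd : b < d) (hac : a < c)
    (h : a + b + c + d = n) (u : ZMod n) (s : ℕ) : SingleBlock (std n a b c) u s ↔
      u = (stdNode a b c 0 : ℕ) ∧ s = if a = b then 3 else 2 := by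
  simp only [SingleBlock, interDist_std ha hab hac.le (by omega : a ≤ d) h,
    isBlock_asym_iff ha hab hbd hac h]
  constructor
  · exact fun h => h.1
  · rintro ⟨rfl, rfl⟩
    exact ⟨⟨rfl, rfl⟩, fun _ _ h => h⟩

theorem not_sTowerPlan_asym (hn : Odd n) (ha : 0 < a) (hab : a ≤ b) (hbd : b < d) (hac : a < c)
    (h : a + b + c + d = n) : ¬ STowerPlan (std n a b c) :=
  fun hs => not_symmetric_std hn ha hab hbd hac h hs.1

theorem gaps_of_aTowerPlan_asym (ha : 0 < a) (hab : a ≤ b) (hbd : b < d)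
    (hac : a < c) (h : a + b + c + d = n) (hp : ATowerPlan (std n a b c)) :
    a = 1 ∧ b = 1 ∧ (c = 2 ∨ d = 2) := by
  obtain ⟨-, u, hu, hor⟩ := hp
  have L := layout_std ha (by omega : 0 < b) (by omega : 0 < c) (by omega : 0 < d) h
  obtain rfl : a = 1 := by
    by_contra h1
    exact not_isBlock_one (by omega) hab hbd hac h u 3 hu
  rw [isBlock_asym_iff ha hab hbd hac h] at hu
  obtain ⟨rfl, hs⟩ := hu
  obtain rfl : 1 = b := by
    by_contra h1
    rw [if_neg h1] at hs
    omega
  refine ⟨rfl, rfl, ?_⟩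
  rcases hor with ⟨h1, -⟩ | ⟨h1, -⟩
  · left
    rw [show 2 = 1 + 1 from rfl, ahead_add] at h1
    have h2 : ahead (ahead ((stdNode 1 1 c 0 : ℕ) : ZMod n) 1 1) 1 1 = (stdNode 1 1 c 2 : ℕ) :=
      (congrArg (ahead · 1 1) (L.next 0)).trans (L.next 1)
    rw [h2] at h1
    exact ((L.neighbor_node 2 2).1 h1).symm
  · right
    exact ((L.neighbor_neg_node 3 2).1 h1).symm

theorem isolated_std_iff (ha : 0 < a) (hab : a ≤ b) (hac : a ≤ c) (had : a ≤ d)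
    (h : a + b + c + d = n) (j : Fin 4) :
    Isolated (std n a b c) ((stdNode a b c j : ℕ) : ZMod n) ↔
      ![a, b, c, d] j ≠ a ∧ ![a, b, c, d] (j + 3) ≠ a := by
  have L := layout_std ha (by omega : 0 < b) (by omega : 0 < c) (by omega : 0 < d) h
  have hlt : ∀ j, stdNode a b c j < n := by
    rw [forall_fin_four]; simp [stdNode]; omega
  have hone : std n a b c ((stdNode a b c j : ℕ) : ZMod n) = 1 :=
    le_antisymm (std_le_one ha (by omega) (by omega) (by omega) _) ((L.occupied_iff _).2 ⟨j, rfl⟩)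
  have key : Isolated (std n a b c) ((stdNode a b c j : ℕ) : ZMod n) ↔
      ∀ i, i ≠ j → ringDist ((stdNode a b c j : ℕ) : ZMod n) ((stdNode a b c i : ℕ) : ZMod n) ≠ a := by
    rw [Isolated, interDist_std ha hab hac had h]
    constructor
    · rintro ⟨-, h1⟩ i hi
      exact h1 _ (L.injective.ne hi) ((L.occupied_iff _).2 ⟨i, rfl⟩)
    · refine fun h1 => ⟨hone, fun v hv hocc => ?_⟩
      obtain ⟨i, rfl⟩ := (L.occupied_iff v).1 hocc
      exact h1 i fun e => hv (e ▸ rfl)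
  rw [key]
  simp only [ringDist_natCast (hlt _) (hlt _)]
  clear key hone
  revert j
  simp only [forall_fin_four]
  refine ⟨?_, ?_, ?_, ?_⟩ <;> 
    simp [stdNode, ha.ne', (ha.trans_le hab).ne', (ha.trans_le hac).ne',
      show a ≤ a + b + c by omega, show ¬ a + b + c ≤ a by omega] <;>
    omega

/-- The block consists of robots `0` and `1`. Robot `2` is at distance `b` from it and robot `3`
strictly farther, at least `min (b + c) d`; so the nearest isolated robot is unique, and so is its
direction. -/
theorem moves_asym_of_lt (hn : Odd n) (ha : 0 < a) (hab : a < b) (hbd : b < d) (hac : a < c)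
    (h : a + b + c + d = n) (u : ZMod n) (f : ℤˣ) :
    Moves (std n a b c) u f ↔ u = (stdNode a b c 2 : ℕ) ∧ f = -1 := by
  have L := layout_std ha (by omega : 0 < b) (by omega : 0 < c) (by omega : 0 < d) h
  have hT := not_hasTower_std ha (by omega : 0 < b) (by omega : 0 < c) (by omega : a + b + c < n)
  have hA : ¬ ATowerPlan (std n a b c) := fun hp => by
    have := gaps_of_aTowerPlan_asym ha hab.le hbd hac h hp
    omega
  rw [Moves, if_pos ⟨not_towerBlock_of_not_hasTower hT, fun h => hT h.1⟩,
    if_pos ⟨hT, not_sTowerPlan_asym hn ha hab.le hbd hac h, hA⟩, Phase1,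
    if_neg (not_symmetric_std hn ha hab.le hbd hac h), Phase1Asym]
  simp only [singleBlock_asym_iff ha hab.le hbd hac h, if_neg hab.ne, and_true, exists_eq_left,
    show ¬ (3 = 2) by norm_num, and_false, false_and, exists_false, or_false]
  rw [interDist_std ha hab.le hac.le (by omega : a ≤ d) h]
  have hiso := isolated_std_iff ha hab.le hac.le (by omega : a ≤ d) h
  have hin : ∀ v, InBlock a ((stdNode a b c 0 : ℕ) : ZMod n) 2 v ↔
      v = (stdNode a b c 0 : ℕ) ∨ v = (stdNode a b c 1 : ℕ) := L.inBlock_two 0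
  have hin' : ∀ i < n, InBlock a ((stdNode a b c 0 : ℕ) : ZMod n) 2 (i : ℕ) ↔ i = 0 ∨ i = a := by
    intro i hi
    rw [hin]
    exact or_congr (natCast_eq_iff hi (by simp [stdNode]; omega))
      (natCast_eq_iff hi (by simp [stdNode]; omega))
  have hforall : ∀ {q : ℤˣ → Prop}, q 1 → q (-1) → ∀ e, q e := fun h1 h2 e => by
    rcases Int.units_eq_one_or e with rfl | rfl <;> assumption
  have hd2 : blockDist a ((stdNode a b c 0 : ℕ) : ZMod n) 2 ((stdNode a b c 2 : ℕ) : ZMod n) = b := by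
    refine blockDist_eq_of (e := -1) ?_ fun j hj => hforall ?_ ?_
    · simp only [stdNode, Matrix.cons_val] at hin' ⊢
      rw [ahead_neg_natCast (by omega), if_pos (by omega), hin' _ (by omega)]; omega
    · simp only [stdNode, Matrix.cons_val] at hin' ⊢
      rw [ahead_natCast, if_pos (by omega), hin' _ (by omega)]; omega
    · simp only [stdNode, Matrix.cons_val] at hin' ⊢
      rw [ahead_neg_natCast (by omega), if_pos (by omega), hin' _ (by omega)]; omega
  -- A path of length at most `b` from robot `3` reaches the block neither forwards, since `b < d`,
  -- nor backwards, since `c > 0`.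
  have hd3 : b < blockDist a ((stdNode a b c 0 : ℕ) : ZMod n) 2
      ((stdNode a b c 3 : ℕ) : ZMod n) := by
    obtain ⟨e, he⟩ := Nat.sInf_mem (s := {k | ∃ e, InBlock a ((stdNode a b c 0 : ℕ) : ZMod n) 2
      (ahead ((stdNode a b c 3 : ℕ) : ZMod n) e k)}) ⟨d, 1, (hin _).2 (.inl (L.next 3))⟩
    change InBlock a _ 2 (ahead _ e (blockDist a ((stdNode a b c 0 : ℕ) : ZMod n) 2
      ((stdNode a b c 3 : ℕ) : ZMod n))) at he
    by_contra hlt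
    rw [not_lt] at hlt
    generalize blockDist a _ 2 _ = k at he hlt
    simp only [stdNode, Matrix.cons_val] at hin' he
    revert he
    rcases Int.units_eq_one_or e with rfl | rfl
    · rw [ahead_natCast, if_pos (by omega), hin' _ (by omega)]; omega
    · rw [ahead_neg_natCast (by omega), if_pos (by omega), hin' _ (by omega)]; omega
  have hnode : ∀ v, Isolated (std n a b c) v → v = (stdNode a b c 2 : ℕ) ∨
      v = (stdNode a b c 3 : ℕ) := by
    intro v hv
    obtain ⟨j, rfl⟩ := eq_stdNode_of_occupied (show Occupied (std n a b c) v from hv.1.ge)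
    rw [hiso] at hv
    revert hv
    revert j
    rw [forall_fin_four]
    refine ⟨fun h => absurd rfl h.1, fun h => absurd rfl h.2, fun _ => .inl rfl, fun _ => .inr rfl⟩
  have hi2 : Isolated (std n a b c) ((stdNode a b c 2 : ℕ) : ZMod n) :=
    (hiso 2).2 ⟨hac.ne', hab.ne'⟩
  constructor
  · rintro ⟨h1, h2, h3⟩
    rcases hnode u h1 with rfl | rfl
    · refine ⟨rfl, (Int.units_eq_one_or f).resolve_left ?_⟩
      rintro rfl
      rw [TowardsBlock, hd2] at h3
      simp only [stdNode, Matrix.cons_val] at hin' h3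
      rw [ahead_natCast, if_pos (by omega), hin' _ (by omega)] at h3
      omega
    · have := h2 _ hi2
      omega
  · rintro ⟨rfl, rfl⟩
    refine ⟨hi2, fun w hw => ?_, ?_⟩
    · rcases hnode w hw with rfl | rfl
      · exact le_rfl
      · rw [hd2]; exact hd3.le
    · rw [TowardsBlock, hd2]
      simp only [stdNode, Matrix.cons_val] at hin' ⊢
      rw [ahead_neg_natCast (by omega), if_pos (by omega), hin' _ (by omega)]
      omega

theorem moves_asym_of_eq (hn : Odd n) (ha : 1 < a) (hbd : a < d) (hac : a < c)
    (h : a + a + c + d = n) (u : ZMod n) (f : ℤˣ) :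
    Moves (std n a a c) u f ↔ (u = (stdNode a a c 0 : ℕ) ∧ f = 1) ∨
      (u = (stdNode a a c 2 : ℕ) ∧ f = -1) := by
  have ha0 : 0 < a := by omega
  have L := layout_std ha0 ha0 (by omega : 0 < c) (by omega : 0 < d) h
  have hT := not_hasTower_std ha0 ha0 (by omega : 0 < c) (by omega : a + a + c < n)
  have hA : ¬ ATowerPlan (std n a a c) := fun hp => by
    have := gaps_of_aTowerPlan_asym ha0 le_rfl hbd hac h hp
    omega
  rw [Moves, if_pos ⟨not_towerBlock_of_not_hasTower hT, fun h => hT h.1⟩,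
    if_pos ⟨hT, not_sTowerPlan_asym hn ha0 le_rfl hbd hac h, hA⟩, Phase1,
    if_neg (not_symmetric_std hn ha0 le_rfl hbd hac h), Phase1Asym]
  simp only [singleBlock_asym_iff ha0 le_rfl hbd hac h, if_true, and_true, exists_eq_left,
    show ¬ (2 = 3) by norm_num, and_false, false_and, exists_false, false_or]
  rw [interDist_std ha0 le_rfl hac.le hbd.le h, if_pos ha]
  have e : ahead ((stdNode a a c 0 : ℕ) : ZMod n) 1 (2 * a) = (stdNode a a c 2 : ℕ) := by
    rw [two_mul, ahead_add]
    exact (congrArg (ahead · 1 a) (L.next 0)).trans (L.next 1)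
  rw [e]

/-- With `c < d` the isolated robot has a unique shortest path to the block, of length `c`; `3 ≤ c`
is the requirement of two nodes in between. -/
theorem moves_asym_one (hn : Odd n) (hc : 3 ≤ c) (hcd : c < d) (h : 1 + 1 + c + d = n) (u : ZMod n)
    (f : ℤˣ) : Moves (std n 1 1 c) u f ↔ u = (stdNode 1 1 c 3 : ℕ) ∧ f = -1 := by
  have L := layout_std one_pos one_pos (by omega : 0 < c) (by omega : 0 < d) h
  have hT := not_hasTower_std one_pos one_pos (by omega : 0 < c) (by omega : 1 + 1 + c < n)
  have hbd : 1 < d := by omega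
  have hac : 1 < c := by omega
  have hA : ¬ ATowerPlan (std n 1 1 c) := fun hp => by
    have := gaps_of_aTowerPlan_asym one_pos le_rfl hbd hac h hp
    omega
  rw [Moves, if_pos ⟨not_towerBlock_of_not_hasTower hT, fun h => hT h.1⟩,
    if_pos ⟨hT, not_sTowerPlan_asym hn one_pos le_rfl hbd hac h, hA⟩, Phase1,
    if_neg (not_symmetric_std hn one_pos le_rfl hbd hac h), Phase1Asym]
  simp only [singleBlock_asym_iff one_pos le_rfl hbd hac h, if_true, and_true, exists_eq_left,
    show ¬ (2 = 3) by norm_num, and_false, false_and, exists_false, false_or]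
  rw [interDist_std one_pos le_rfl hac.le hbd.le h, if_neg (lt_irrefl 1)]
  have hiso := isolated_std_iff one_pos le_rfl hac.le hbd.le h
  have hin : ∀ v, InBlock 1 ((stdNode 1 1 c 0 : ℕ) : ZMod n) 3 v ↔
      v = (stdNode 1 1 c 0 : ℕ) ∨ v = (stdNode 1 1 c 1 : ℕ) ∨ v = (stdNode 1 1 c 2 : ℕ) :=
    L.inBlock_three (j := 0) rfl
  have hin' : ∀ i < n, InBlock 1 ((stdNode 1 1 c 0 : ℕ) : ZMod n) 3 (i : ℕ) ↔
      i = 0 ∨ i = 1 ∨ i = 2 := by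
    intro i hi
    rw [hin]
    exact or_congr (natCast_eq_iff hi (by simp [stdNode]; omega))
      (or_congr (natCast_eq_iff hi (by simp [stdNode]; omega))
      (natCast_eq_iff hi (by simp [stdNode]; omega)))
  have hd3 : blockDist 1 ((stdNode 1 1 c 0 : ℕ) : ZMod n) 3 ((stdNode 1 1 c 3 : ℕ) : ZMod n) = c := by
    simp only [stdNode, Matrix.cons_val] at hin' ⊢
    refine blockDist_eq_of (e := -1) ?_ fun j hj e => ?_
    · rw [ahead_neg_natCast (by omega), if_pos (by omega), hin' _ (by omega)]; omega
    · rcases Int.units_eq_one_or e with rfl | rfl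
      · rw [ahead_natCast, if_pos (by omega), hin' _ (by omega)]; omega
      · rw [ahead_neg_natCast (by omega), if_pos (by omega), hin' _ (by omega)]; omega
  constructor
  · rintro ⟨h1, h2, h3⟩
    obtain rfl : u = (stdNode 1 1 c 3 : ℕ) := by
      obtain ⟨j, rfl⟩ := eq_stdNode_of_occupied (show Occupied (std n 1 1 c) u from h1.1.ge)
      rw [hiso] at h1
      revert h1
      clear h2 h3
      revert j
      rw [forall_fin_four]
      exact ⟨fun h => absurd rfl h.1, fun h => absurd rfl h.1, fun h => absurd rfl h.2,
        fun _ => rfl⟩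
    refine ⟨rfl, (Int.units_eq_one_or f).resolve_left ?_⟩
    rintro rfl
    rw [TowardsBlock, hd3] at h3
    simp only [stdNode, Matrix.cons_val] at hin' h3
    rw [ahead_natCast, if_pos (by omega), hin' _ (by omega)] at h3
    omega
  · rintro ⟨rfl, rfl⟩
    refine ⟨(hiso 3).2 ⟨hbd.ne', hac.ne'⟩, by rw [hd3]; exact hc, ?_⟩
    rw [TowardsBlock, hd3]
    simp only [stdNode, Matrix.cons_val] at hin' ⊢
    rw [ahead_neg_natCast (by omega), if_pos (by omega), hin' _ (by omega)]
    omega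

/-- The end robot `2` has the isolated robot at distance `2`, whereas robot `0` has gaps `1` and `d
> 2`; the middle robot therefore joins robot `0`. -/
theorem moves_aTowerPlan (hn : Odd n) (hd : 2 < d) (h : 1 + 1 + 2 + d = n) (u : ZMod n)
    (f : ℤˣ) : Moves (std n 1 1 2) u f ↔ u = (stdNode 1 1 2 1 : ℕ) ∧ f = -1 := by
  have L := layout_std one_pos one_pos two_pos (by omega : 0 < d) h
  have hT := not_hasTower_std one_pos one_pos two_pos (by omega : 1 + 1 + 2 < n)
  have hbd : 1 < d := by omega
  have hac : 1 < 2 := by omega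
  have hblk := isBlock_asym_iff one_pos le_rfl hbd hac h
  rw [if_pos rfl] at hblk
  have e1 : ahead ((stdNode 1 1 2 0 : ℕ) : ZMod n) 1 1 = (stdNode 1 1 2 1 : ℕ) := L.next 0
  have e2 : ahead ((stdNode 1 1 2 1 : ℕ) : ZMod n) 1 1 = (stdNode 1 1 2 2 : ℕ) := L.next 1
  have hA : ATowerPlan (std n 1 1 2) := by
    refine ⟨not_symmetric_std hn one_pos le_rfl hbd hac h, _, (hblk _ _).2 ⟨rfl, rfl⟩, .inl ?_⟩
    have e3 : ahead ((stdNode 1 1 2 0 : ℕ) : ZMod n) 1 2 = (stdNode 1 1 2 2 : ℕ) := by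
      rw [show 2 = 1 + 1 from rfl, ahead_add, e1, e2]
    have e4 : ahead ((stdNode 1 1 2 0 : ℕ) : ZMod n) 1 4 = (stdNode 1 1 2 3 : ℕ) := by
      refine (ahead_add _ 1 2 2).trans ?_
      rw [e3]; exact L.next 2
    rw [e3, e4]
    exact ⟨(L.neighbor_node 2 2).2 rfl,
      (isolated_std_iff one_pos le_rfl hac.le hbd.le h 3).2 ⟨hbd.ne', hac.ne'⟩⟩
  have h2 : ¬ TwoOneBlocks (std n 1 1 2) := by
    rintro ⟨b, s, b', s', h1, h2, h3⟩
    rw [hblk] at h1 h2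
    exact h3 (h1.1.trans h2.1.symm)
  rw [Moves, if_pos ⟨not_towerBlock_of_not_hasTower hT, fun h => hT h.1⟩,
    if_neg (fun h => h.2.2 hA), if_pos hT, Phase2, if_neg h2]
  simp only [hblk, and_true, exists_eq_left, e1]
  refine and_congr_right fun hu => ?_
  subst hu
  rcases Int.units_eq_one_or f with rfl | rfl
  · rw [e2]
    refine iff_of_false (fun h1 => h1 ⟨1, (L.neighbor_node 2 2).2 rfl⟩) (by decide)
  · rw [← e1, ahead_ahead_neg]
    refine iff_of_true ?_ rfl
    rintro ⟨e, he⟩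
    rcases Int.units_eq_one_or e with rfl | rfl
    · exact absurd ((L.neighbor_node 0 2).1 he) (show (2 : ℕ) ≠ 1 by decide)
    · exact absurd ((L.neighbor_neg_node 3 2).1 he) hd.ne

end Asymmetric

/-! ### Configurations with a tower -/

section WithTower

variable {n x y z : ℕ}

/-- A tower is encoded by a first gap equal to `0`: two robots at the origin and the others at `x`
and `x + z`, the remaining gap being `y`. -/
theorem tower_natCast (hx : 0 < x) (hz : 0 < z) (hy : 0 < y) (h : x + z + y = n) {i : ℕ}
    (hi : i < n) : std n 0 x z (i : ZMod n) =
      if i = 0 then 2 else if i = x ∨ i = x + z then 1 else 0 := by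
  rw [std_natCast (by omega) hi]
  simp only [zero_add]
  split_ifs <;> omega

theorem tower_eq_one_iff (hx : 0 < x) (hz : 0 < z) (hy : 0 < y) (h : x + z + y = n) {i : ℕ}
    (hi : i < n) : std n 0 x z (i : ZMod n) = 1 ↔ i = x ∨ i = x + z := by
  rw [tower_natCast hx hz hy h hi]
  by_cases h0 : i = 0
  · rw [if_pos h0]; omega
  · rw [if_neg h0]
    split_ifs with h1
    · exact iff_of_true rfl h1
    · exact iff_of_false (by norm_num) h1

theorem tower_iff (hx : 0 < x) (hz : 0 < z) (hy : 0 < y) (h : x + z + y = n) (u : ZMod n) :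
    Tower (std n 0 x z) u ↔ u = 0 := by
  obtain ⟨i, hi, rfl⟩ := exists_natCast (by omega) u
  have := natCast_eq_iff hi (by omega : 0 < n)
  rw [Nat.cast_zero] at this
  rw [Tower, tower_natCast hx hz hy h hi, this]
  split_ifs <;> omega

theorem occupied_tower_iff (hx : 0 < x) (hz : 0 < z) (hy : 0 < y) (h : x + z + y = n) {i : ℕ}
    (hi : i < n) : Occupied (std n 0 x z) (i : ZMod n) ↔ i = 0 ∨ i = x ∨ i = x + z := by
  rw [Occupied, tower_natCast hx hz hy h hi]
  split_ifs <;> omega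

theorem atTowerDist_iff (hx : 0 < x) (hz : 0 < z) (hy : 0 < y) (h : x + z + y = n) {i : ℕ}
    (hi : i < n) (k : ℕ) : AtTowerDist (std n 0 x z) (i : ZMod n) k ↔ min i (n - i) = k := by
  simp only [AtTowerDist, tower_iff hx hz hy h, exists_eq_left]
  have := ringDist_natCast (by omega : 0 < n) hi
  rw [Nat.cast_zero] at this
  rw [this, if_pos (Nat.zero_le i), Nat.sub_zero]

theorem isolated_tower_iff (hx : 0 < x) (hz : 0 < z) (hy : 0 < y) (h : x + z + y = n) {i : ℕ}
    (hi : i < n) : Isolated (std n 0 x z) (i : ZMod n) ↔ i = x ∨ i = x + z := by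
  have h0 : interDist (std n 0 x z) = 0 :=
    have ht := (tower_iff hx hz hy h 0).2 rfl
    Nat.sInf_eq_zero.2 (.inl ⟨0, 0, one_le_two.trans ht, one_le_two.trans ht, .inr ht,
      by simp [ringDist]⟩)
  rw [Isolated, h0, tower_eq_one_iff hx hz hy h hi]
  refine and_iff_left fun v hv _ => ?_
  obtain ⟨j, hj, rfl⟩ := exists_natCast (by omega) v
  rw [Ne, natCast_eq_iff hj hi] at hv
  rw [ringDist_natCast hi hj]
  split_ifs <;> omega

theorem neighbor_tower_iff (hx : 0 < x) (hz : 0 < z) (hy : 0 < y) (h : x + z + y = n) {i : ℕ}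
    (hi : i < n) (k : ℕ) : Neighbor (std n 0 x z) (i : ZMod n) 1 k ↔
      (i = 0 ∧ k = x) ∨ (i = x ∧ k = z) ∨ (i = x + z ∧ k = y) := by
  have hocc : ∀ i < n, Occupied (std n 0 x z) ((i : ℕ) : ZMod n) ↔ _ := fun i hi =>
    occupied_tower_iff hx hz hy h hi
  have h0 : Neighbor (std n 0 x z) ((0 : ℕ) : ZMod n) 1 x := by
    refine ⟨hx, (hocc _ (by omega)).2 (by omega), ?_, fun j hj hjk => ?_⟩ <;>
    rw [ahead_natCast, if_pos (by omega), hocc _ (by omega)] <;> omega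
  have h1 : Neighbor (std n 0 x z) (x : ZMod n) 1 z := by
    refine ⟨hz, (hocc _ (by omega)).2 (by omega), ?_, fun j hj hjk => ?_⟩ <;>
    rw [ahead_natCast, if_pos (by omega), hocc _ (by omega)] <;> omega
  have h2 : Neighbor (std n 0 x z) ((x + z : ℕ) : ZMod n) 1 y := by
    refine ⟨hy, (hocc _ (by omega)).2 (by omega), ?_, fun j hj hjk => ?_⟩
    · rw [ahead_natCast, if_neg (by omega), hocc _ (by omega)]; omega
    · rw [ahead_natCast, if_pos (by omega), hocc _ (by omega)]; omega
  constructor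
  · intro hk
    rcases (hocc i hi).1 hk.2.1 with rfl | rfl | rfl
    · exact .inl ⟨rfl, hk.unique h0⟩
    · exact .inr (.inl ⟨rfl, hk.unique h1⟩)
    · exact .inr (.inr ⟨rfl, hk.unique h2⟩)
  · rintro (⟨rfl, rfl⟩ | ⟨rfl, rfl⟩ | ⟨rfl, rfl⟩)
    exacts [h0, h1, h2]

theorem neighbor_neg_tower_iff (hx : 0 < x) (hz : 0 < z) (hy : 0 < y) (h : x + z + y = n) {i : ℕ}
    (hi : i < n) (k : ℕ) : Neighbor (std n 0 x z) (i : ZMod n) (-1) k ↔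
      (i = 0 ∧ k = y) ∨ (i = x ∧ k = x) ∨ (i = x + z ∧ k = z) := by
  have hnb := fun (i : ℕ) (hi : i < n) => neighbor_tower_iff hx hz hy h hi
  have h0 : Neighbor (std n 0 x z) ((0 : ℕ) : ZMod n) (-1) y := by
    have := ((hnb (x + z) (by omega) y).2 (by omega)).reverse
    rwa [ahead_natCast, if_neg (by omega), show x + z + y - n = 0 by omega] at this
  have h1 : Neighbor (std n 0 x z) (x : ZMod n) (-1) x := by
    have := ((hnb 0 (by omega) x).2 (by omega)).reverse
    rwa [ahead_natCast, if_pos (by omega), zero_add] at this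
  have h2 : Neighbor (std n 0 x z) ((x + z : ℕ) : ZMod n) (-1) z := by
    have := ((hnb x (by omega) z).2 (by omega)).reverse
    rwa [ahead_natCast, if_pos (by omega)] at this
  constructor
  · intro hk
    rcases (occupied_tower_iff hx hz hy h hi).1 hk.2.1 with rfl | rfl | rfl
    · exact .inl ⟨rfl, hk.unique h0⟩
    · exact .inr (.inl ⟨rfl, hk.unique h1⟩)
    · exact .inr (.inr ⟨rfl, hk.unique h2⟩)
  · rintro (⟨rfl, rfl⟩ | ⟨rfl, rfl⟩ | ⟨rfl, rfl⟩)
    exacts [h0, h1, h2]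

theorem not_isBlock_tower (hx : 1 < x) (hz : 1 < z) (hy : 1 < y) (h : x + z + y = n) (b : ZMod n)
    (s : ℕ) : ¬ IsBlock (std n 0 x z) 1 b s := by
  intro hb
  have h1 := hb.2.1 0 (by have := hb.1; omega)
  rw [zero_mul, ahead_zero] at h1
  obtain ⟨i, hi, rfl⟩ := exists_natCast (by omega) b
  rw [neighbor_tower_iff (by omega) (by omega) (by omega) h hi] at h1
  omega

/-- A reflection preserves the only tower, so it is `u ↦ -u`. As `n` is odd, it fixes no other node,
so it exchanges the two single robots, which forces `x = y`. -/
theorem not_symmetric_tower (hn : Odd n) (hx : 0 < x) (hz : 0 < z) (hy : 0 < y)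
    (h : x + z + y = n) (hxy : x ≠ y) : ¬ Symmetric (std n 0 x z) := by
  rintro ⟨a, ha⟩
  obtain rfl : a = 0 := by
    rw [← tower_iff hx hz hy h, ← sub_zero a, Tower, ha 0]
    exact (tower_iff hx hz hy h 0).2 rfl
  have h1 := ha (x : ZMod n)
  have e : (0 : ZMod n) - (x : ZMod n) = ((n - x : ℕ) : ZMod n) := by
    rw [Nat.cast_sub (by omega)]; simp
  rw [(tower_eq_one_iff hx hz hy h (by omega)).2 (.inl rfl), e,
    tower_eq_one_iff hx hz hy h (by omega)] at h1
  obtain ⟨q, rfl⟩ := hn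
  omega

theorem towerBlock_tower_iff (hx : 0 < x) (hz : 0 < z) (hy : 0 < y) (h : x + z + y = n)
    (hn : 7 < n) : TowerBlock (std n 0 x z) ↔
      (1 = x ∨ 1 = x + z) ∧ (n - 1 = x ∨ n - 1 = x + z) := by
  simp only [TowerBlock, tower_iff hx hz hy h, exists_eq_left]
  have e1 : (0 : ZMod n) + 1 = ((1 : ℕ) : ZMod n) := by simp
  have e2 : (0 : ZMod n) - 1 = ((n - 1 : ℕ) : ZMod n) := by
    rw [Nat.cast_sub (by omega)]; simp
  rw [e1, e2, tower_eq_one_iff hx hz hy h (by omega), tower_eq_one_iff hx hz hy h (by omega)]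

theorem hasTower_tower (hx : 0 < x) (hz : 0 < z) (hy : 0 < y) (h : x + z + y = n) :
    HasTower (std n 0 x z) := ⟨0, (tower_iff hx hz hy h 0).2 rfl⟩

theorem exists_occupied_atTowerDist_iff (hx : 0 < x) (hz : 0 < z) (hy : 0 < y)
    (h : x + z + y = n) {k : ℕ} (hk : 0 < k) :
    (∃ v, Occupied (std n 0 x z) v ∧ AtTowerDist (std n 0 x z) v k) ↔
      min x (z + y) = k ∨ min (x + z) y = k := by
  constructor
  · rintro ⟨v, h1, h2⟩
    obtain ⟨i, hi, rfl⟩ := exists_natCast (by omega) v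
    rw [occupied_tower_iff hx hz hy h hi] at h1
    rw [atTowerDist_iff hx hz hy h hi] at h2
    omega
  · rintro (h1 | h1)
    · refine ⟨(x : ℕ), (occupied_tower_iff hx hz hy h (by omega)).2 (by omega),
        (atTowerDist_iff hx hz hy h (by omega) k).2 (by omega)⟩
    · refine ⟨(x + z : ℕ), (occupied_tower_iff hx hz hy h (by omega)).2 (by omega),
        (atTowerDist_iff hx hz hy h (by omega) k).2 (by omega)⟩

theorem moves_tower_iff (hx : 0 < x) (hz : 0 < z) (hy : 0 < y) (h : x + z + y = n)
    (hB : ¬ TowerBlock (std n 0 x z)) (hS : ¬ TowerSole (std n 0 x z)) (u : ZMod n) (e : ℤˣ) :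
    Moves (std n 0 x z) u e ↔ Phase3 (std n 0 x z) u e := by
  have hT := hasTower_tower hx hz hy h
  rw [Moves, if_pos ⟨hB, hS⟩, if_neg (fun h => h.1 hT), if_neg (fun h => h hT)]

theorem towerGuide_tower_iff (hx : 0 < x) (hz : 0 < z) (hy : 0 < y) (h : x + z + y = n)
    (hn : 7 < n) : TowerGuide (std n 0 x z) ↔ (x = 2 ∧ z = 2) ∨ (y = 2 ∧ z = 2) := by
  have hm := fun (i : ℕ) (hi : i < n) => tower_natCast hx hz hy h hi
  have e1 : ∀ k < n, std n 0 x z (ahead 0 1 k) = std n 0 x z (k : ℕ) := by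
    intro k _; rw [ahead_one, zero_add]
  have e2 : ∀ k < n, std n 0 x z (ahead 0 (-1) k) = std n 0 x z ((n - k : ℕ) : ZMod n) := by
    intro k hk; rw [ahead_neg_one, Nat.cast_sub hk.le]; simp
  have h1 := fun (i : ℕ) (hi : i < n) => tower_eq_one_iff hx hz hy h hi
  have ht := (tower_iff hx hz hy h 0).2 rfl
  constructor
  · rintro ⟨u, e, hu, -, h2, -, h4⟩
    obtain rfl := (tower_iff hx hz hy h u).1 hu
    rcases Int.units_eq_one_or e with rfl | rfl
    · rw [e1 _ (by omega), h1 _ (by omega)] at h2 h4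
      omega
    · rw [e2 _ (by omega), h1 _ (by omega)] at h2 h4
      omega
  · rintro (⟨rfl, rfl⟩ | ⟨rfl, rfl⟩)
    · refine ⟨0, 1, ht, ?_, ?_, ?_, ?_⟩ <;> rw [e1 _ (by omega), hm _ (by omega)] <;> norm_num
    · refine ⟨0, -1, ht, ?_, ?_, ?_, ?_⟩ <;> rw [e2 _ (by omega), hm _ (by omega)] <;>
      split_ifs <;> omega

/-! #### The two robots of a symmetric configuration move away from the tower -/

theorem towerSole_tower (hx : 1 < x) (h : x + 1 + x = n) : TowerSole (std n 0 x 1) := by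
  have hx0 : 0 < x := by omega
  have hnb := fun (i : ℕ) (hi : i < n) => neighbor_tower_iff hx0 one_pos hx0 h hi
  refine ⟨hasTower_tower hx0 one_pos hx0 h, ⟨0, fun u => ?_⟩, (x : ℕ), 2, ⟨le_rfl, ?_, ?_, ?_⟩, ?_⟩
  · obtain ⟨i, hi, rfl⟩ := exists_natCast (by omega) u
    have := sub_natCast (n := n) (i := 0) hi.le
    rw [Nat.cast_zero] at this
    rw [this, tower_natCast hx0 one_pos hx0 h (by split_ifs <;> omega),
      tower_natCast hx0 one_pos hx0 h hi]
    split_ifs <;> omega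
  · intro i hi
    obtain rfl : i = 0 := by omega
    rw [zero_mul, ahead_zero, hnb _ (by omega)]
    omega
  · rw [ahead_natCast, if_pos (by omega), hnb _ (by omega)]
    omega
  · rw [neighbor_neg_tower_iff hx0 one_pos hx0 h (by omega)]
    omega
  · rintro u ⟨i, hi, rfl⟩
    have h0 := natCast_eq_iff (n := n) (i := x + i * 1) (j := 0) (by omega) (by omega)
    rw [Nat.cast_zero] at h0
    rw [tower_iff hx0 one_pos hx0 h, ahead_natCast, if_pos (by omega), h0]
    omega

section Spread

variable {q : ℕ}

theorem not_towerBlock_spread (hx : 2 ≤ x) (hxq : x ≤ q) (hz : 1 < z) (hy : 2 ≤ y)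
    (h : x + z + y = n) (hq : n = 2 * q + 1) (hn : 7 < n) : ¬ TowerBlock (std n 0 x z) := by
  rw [towerBlock_tower_iff (by omega) (by omega) (by omega) h hn]
  omega

/-- All three gaps are at least `2`, so there is no 1.block and a robot at distance `2` can only be
told to leave. The condition `ahead i (-e) 2 = 0` says that `e` points away from the tower. -/
theorem phase3_spread (hx : 2 ≤ x) (hxq : x ≤ q) (hz : 1 < z) (hy : 2 ≤ y) (hyq : y ≤ q)
    (h : x + z + y = n) (hq : n = 2 * q + 1) (hn : 7 < n) {i : ℕ} (hi : i < n) (e : ℤˣ) :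
    Moves (std n 0 x z) (i : ZMod n) e ↔
      if min i (n - i) = 2 then ahead (i : ZMod n) (-e) 2 = 0
      else (x ≠ 2 ∧ y ≠ 2) ∧ (i = x ∨ i = x + z) ∧ min i (n - i) ≠ q ∧
        (i : ZMod n) = ahead 0 e (min i (n - i)) := by
  have hx0 : 0 < x := by omega
  have hy0 : 0 < y := by omega
  have hz0 : 0 < z := by omega
  have hblk := not_isBlock_tower hx hz hy h
  have hrd := ringDist_natCast (by omega : 0 < n) hi
  rw [if_pos (Nat.zero_le _), Nat.cast_zero, Nat.sub_zero] at hrd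
  rw [moves_tower_iff hx0 hz0 hy0 h (not_towerBlock_spread hx hxq hz hy h hq hn)
    (fun h => by obtain ⟨-, -, b, s, hb, -⟩ := h; exact hblk b s hb), Phase3,
    if_pos (by rw [exists_occupied_atTowerDist_iff hx0 hz0 hy0 h one_pos]; omega),
    -- A tower-guide would put a single robot at `n - 4` from the tower along the third gap, which
    -- exceeds `q` because `n > 7`.
    if_neg (by rw [towerGuide_tower_iff hx0 hz0 hy0 h hn]; omega)]
  refine ite_prop_congr (atTowerDist_iff hx0 hz0 hy0 h hi 2) ?_ ?_
  · rw [if_neg (fun ⟨b, s, hb, _⟩ => hblk b s hb), tower_iff hx0 hz0 hy0 h]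
  · rw [exists_occupied_atTowerDist_iff hx0 hz0 hy0 h two_pos, isolated_tower_iff hx0 hz0 hy0 h hi,
      atTowerDist_iff hx0 hz0 hy0 h hi]
    simp only [tower_iff hx0 hz0 hy0 h, exists_eq_left, hrd]
    refine and_congr (by omega) (and_congr Iff.rfl (and_congr (by omega) Iff.rfl))

theorem ahead_zero_natCast_eq_iff {i k : ℕ} (hi : i < n) (hk : k < n) (e : ℤˣ) (hi0 : 0 < i) :
    (i : ZMod n) = ahead 0 e k ↔ (e = 1 ∧ i = k) ∨ (e = -1 ∧ i = n - k) := by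
  rcases Int.units_eq_one_or e with rfl | rfl
  · rw [ahead_one, zero_add, natCast_eq_iff hi hk]
    simp
  · have := sub_natCast (n := n) (i := 0) hk.le
    rw [Nat.cast_zero] at this
    rw [ahead_neg_one, this]
    have e : ¬ (-1 : ℤˣ) = 1 := by decide
    split_ifs with h0
    · rw [natCast_eq_iff hi (by omega)]; simp; omega
    · rw [natCast_eq_iff hi (by omega)]; simp

theorem ahead_natCast_eq_zero_iff {i k : ℕ} (hi : i < n) (hk : k < n) (e : ℤˣ) (hi0 : 0 < i) :
    ahead (i : ZMod n) (-e) k = 0 ↔ (e = 1 ∧ i = k) ∨ (e = -1 ∧ i = n - k) := by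
  rw [← ahead_zero_natCast_eq_iff hi hk e hi0]
  constructor
  · intro h; rw [← h, ahead, ahead]; push_cast; ring
  · intro h; rw [h, ahead_ahead_neg]

theorem not_moves_spread_tower (hx : 2 ≤ x) (hxq : x ≤ q) (hz : 1 < z) (hy : 2 ≤ y) (hyq : y ≤ q)
    (h : x + z + y = n) (hq : n = 2 * q + 1) (hn : 7 < n) (e : ℤˣ) :
    ¬ Moves (std n 0 x z) 0 e := by
  have := phase3_spread hx hxq hz hy hyq h hq hn (by omega : 0 < n) e
  rw [Nat.cast_zero] at this
  rw [this, if_neg (by omega)]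
  omega

theorem moves_spread_left (hx : 2 ≤ x) (hxq : x ≤ q) (hz : 1 < z) (hy : 2 ≤ y) (hyq : y ≤ q)
    (h : x + z + y = n) (hq : n = 2 * q + 1) (hn : 7 < n) (e : ℤˣ) :
    Moves (std n 0 x z) (x : ZMod n) e ↔ e = 1 ∧ (x = 2 ∨ y ≠ 2 ∧ x < q) := by
  rw [phase3_spread hx hxq hz hy hyq h hq hn (by omega), show min x (n - x) = x by omega,
    ahead_natCast_eq_zero_iff (by omega) (by omega) _ (by omega),
    ahead_zero_natCast_eq_iff (by omega) (by omega) _ (by omega)]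
  have hne : x ≠ n - x := by omega
  split_ifs with h2
  · subst h2; simp [hne]
  · simp only [hne, and_false, or_false, and_true, h2, false_or, ne_eq, not_false_iff, true_and,
      true_or]
    constructor
    · rintro ⟨h1, h3, h4⟩; exact ⟨h4, h1, by omega⟩
    · rintro ⟨h1, h3, h4⟩; exact ⟨h3, by omega, h1⟩

theorem moves_spread_right (hx : 2 ≤ x) (hxq : x ≤ q) (hz : 1 < z) (hy : 2 ≤ y) (hyq : y ≤ q)
    (h : x + z + y = n) (hq : n = 2 * q + 1) (hn : 7 < n) (e : ℤˣ) :
    Moves (std n 0 x z) ((x + z : ℕ) : ZMod n) e ↔ e = -1 ∧ (y = 2 ∨ x ≠ 2 ∧ y < q) := by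
  rw [phase3_spread hx hxq hz hy hyq h hq hn (by omega),
    show min (x + z) (n - (x + z)) = y by omega,
    ahead_natCast_eq_zero_iff (by omega) (by omega) _ (by omega),
    ahead_zero_natCast_eq_iff (by omega) (by omega) _ (by omega)]
  have hne : x + z ≠ y := by omega
  have heq : x + z = n - y := by omega
  split_ifs with h2
  · subst h2; simp [heq, show ¬ n - 2 = 2 by omega]
  · simp only [hne, ← heq, and_false, false_or, and_true, h2, ne_eq, not_false_iff, or_true,
      true_and]
    constructor
    · rintro ⟨h1, h3, h4⟩; exact ⟨h4, h1, by omega⟩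
    · rintro ⟨h1, h3, h4⟩; exact ⟨h3, by omega, h1⟩

end Spread

/-! #### One robot goes around the ring -/

theorem not_towerSole_tower (hn : Odd n) (hx : 0 < x) (hz : 0 < z) (hy : 0 < y)
    (h : x + z + y = n) (hxy : x ≠ y) : ¬ TowerSole (std n 0 x z) :=
  fun hs => not_symmetric_tower hn hx hz hy h hxy hs.2.1

theorem moves_towerGuide (hn : Odd n) (hn7 : 7 < n) (h : 2 + 2 + y = n) {i : ℕ}
    (hi : i < n) (e : ℤˣ) : Moves (std n 0 2 2) (i : ZMod n) e ↔ i = 4 ∧ e = -1 := by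
  have hy : 0 < y := by omega
  rw [moves_tower_iff two_pos two_pos hy h
    (by rw [towerBlock_tower_iff two_pos two_pos hy h hn7]; omega)
    (not_towerSole_tower hn two_pos two_pos hy h (by omega)), Phase3,
    if_pos (by rw [exists_occupied_atTowerDist_iff two_pos two_pos hy h one_pos]; omega),
    if_pos (by rw [towerGuide_tower_iff two_pos two_pos hy h hn7]; omega),
    atTowerDist_iff two_pos two_pos hy h hi, isolated_tower_iff two_pos two_pos hy h hi]
  constructor
  · rintro ⟨h1, h2, k, h3, h4, h5⟩
    obtain rfl : i = 4 := by omega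
    refine ⟨rfl, (Int.units_eq_one_or e).resolve_left ?_⟩
    rintro rfl
    rw [neighbor_tower_iff two_pos two_pos hy h hi] at h4
    rw [ahead_natCast, if_neg (by omega), isolated_tower_iff two_pos two_pos hy h (by omega)] at h5
    omega
  · rintro ⟨rfl, rfl⟩
    refine ⟨by omega, by omega, 2, le_rfl, ?_, ?_⟩
    · rw [neighbor_neg_tower_iff two_pos two_pos hy h hi]; omega
    · rw [ahead_neg_natCast (by omega), if_pos (by omega),
        isolated_tower_iff two_pos two_pos hy h (by omega)]
      omega

/-- The robot at distance `2` is in a 1.block, so it approaches the tower. Its presence blocks the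
retreat rule for the other single robot. -/
theorem moves_tower_pair (hn : Odd n) (hn7 : 7 < n) (h : 2 + 1 + y = n) {i : ℕ}
    (hi : i = 0 ∨ i = 2 ∨ i = 3) (e : ℤˣ) :
    Moves (std n 0 2 1) (i : ZMod n) e ↔ i = 2 ∧ e = -1 := by
  have hy : 0 < y := by omega
  have hin : i < n := by omega
  rw [moves_tower_iff two_pos one_pos hy h
    (by rw [towerBlock_tower_iff two_pos one_pos hy h hn7]; omega)
    (not_towerSole_tower hn two_pos one_pos hy h (by omega)), Phase3,
    if_pos (by rw [exists_occupied_atTowerDist_iff two_pos one_pos hy h one_pos]; omega),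
    if_neg (by rw [towerGuide_tower_iff two_pos one_pos hy h hn7]; omega)]
  have hat := atTowerDist_iff two_pos one_pos hy h hin 2
  by_cases h2 : i = 2
  · subst h2
    have hblk : InOneBlock (std n 0 2 1) ((2 : ℕ) : ZMod n) := by
      refine ⟨(2 : ℕ), 2, ⟨le_rfl, fun j hj => ?_, ?_, ?_⟩, 0, two_pos, by rw [zero_mul, ahead_zero]⟩
      · obtain rfl : j = 0 := by omega
        rw [zero_mul, ahead_zero, neighbor_tower_iff two_pos one_pos hy h hin]
        omega
      · rw [ahead_natCast, if_pos (by omega), neighbor_tower_iff two_pos one_pos hy h (by omega)]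
        omega
      · rw [neighbor_neg_tower_iff two_pos one_pos hy h hin]
        omega
    rw [if_pos (hat.2 (by omega)), if_pos hblk, tower_iff two_pos one_pos hy h]
    have := ahead_natCast_eq_zero_iff hin (by omega : 2 < n) (-e) two_pos
    rw [neg_neg] at this
    rw [this, neg_eq_iff_eq_neg]
    simp only [and_true, true_and, show ¬ 2 = n - 2 by omega, and_false, or_false]
  · rw [if_neg (by rw [hat]; omega), exists_occupied_atTowerDist_iff two_pos one_pos hy h two_pos]
    omega

/-- The tower is visible to the walker only forwards: behind it stands the robot at node `1`. -/
theorem moves_tower_walk (hn : Odd n) (hn7 : 7 < n) (hz : 2 ≤ z) (hy : 2 ≤ y) (h : 1 + z + y = n)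
    {i : ℕ} (hi : i < n) (e : ℤˣ) : Moves (std n 0 1 z) (i : ZMod n) e ↔ i = 1 + z ∧ e = 1 := by
  have hy0 : 0 < y := by omega
  have hz0 : 0 < z := by omega
  rw [moves_tower_iff one_pos hz0 hy0 h
    (by rw [towerBlock_tower_iff one_pos hz0 hy0 h hn7]; omega)
    (not_towerSole_tower hn one_pos hz0 hy0 h (by omega)), Phase3,
    if_neg (by rw [not_not, exists_occupied_atTowerDist_iff one_pos hz0 hy0 h one_pos]; omega),
    isolated_tower_iff one_pos hz0 hy0 h hi, atTowerDist_iff one_pos hz0 hy0 h hi]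
  have h0 : ∀ j < n, ((j : ℕ) : ZMod n) = 0 ↔ j = 0 := fun j hj => by
    have := natCast_eq_iff hj (by omega : 0 < n)
    rwa [Nat.cast_zero] at this
  constructor
  · rintro ⟨h1, h2, k, h3, h4⟩
    obtain rfl : i = 1 + z := by omega
    refine ⟨rfl, (Int.units_eq_one_or e).resolve_right ?_⟩
    rintro rfl
    rw [neighbor_neg_tower_iff one_pos hz0 hy0 h hi] at h3
    rw [tower_iff one_pos hz0 hy0 h, ahead_neg_natCast (by omega), if_pos (by omega),
      h0 _ (by omega)] at h4
    omega
  · rintro ⟨rfl, rfl⟩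
    refine ⟨by omega, by omega, y, ?_, ?_⟩
    · rw [neighbor_tower_iff one_pos hz0 hy0 h hi]; omega
    · rw [tower_iff one_pos hz0 hy0 h, ahead_natCast, if_neg (by omega), h0 _ (by omega)]
      omega

end WithTower

/-! ### One step of the protocol -/

section Step

variable {n : ℕ}

/-- From `p`, the configuration `q` is reached in one step, for some choice of activated robots. -/
def Step (p q : Fin 4 → ZMod n) : Prop :=
  ∀ r, q r = p r ∨ ∃ f, Moves (multiplicity p) (p r) f ∧ q r = ahead (p r) f 1

/-- Up to the isometry `isom x ε`, and up to the names of the robots, the robots of `p` are on the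
nodes `0, a, a + b, a + b + c`. -/
def Placed (p : Fin 4 → ZMod n) (x : ZMod n) (ε : ℤˣ) (σ : Equiv.Perm (Fin 4)) (a b c : ℕ) : Prop :=
  ∀ i, p (σ i) = isom x ε (stdNode a b c i : ℕ)

/-- Up to isometry and names, the robots of `p` are on the nodes `0, a, a + b, a + b + c`. -/
def Gaps (p : Fin 4 → ZMod n) (a b c : ℕ) : Prop := ∃ x ε σ, Placed p x ε σ a b c

variable {p q : Fin 4 → ZMod n} {x : ZMod n} {ε : ℤˣ} {σ : Equiv.Perm (Fin 4)} {a b c d : ℕ}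

theorem Placed.gaps (h : Placed p x ε σ a b c) : Gaps p a b c := ⟨x, ε, σ, h⟩

/-- Multiplicities ignore names, so only the isometry remains; every computation of moves for the
standard configuration thereby transfers to `p`. -/
theorem Placed.multiplicity_comp (h : Placed p x ε σ a b c) :
    multiplicity p ∘ isom x ε = std n a b c := by
  funext u
  simp only [Function.comp, multiplicity, std]
  conv_rhs => rw [← Finset.card_map σ.toEmbedding]
  congr 1
  ext r
  simp only [Finset.mem_map_equiv, Finset.mem_filter, Finset.mem_univ, true_and]
  rw [← isom_inj (x := x) (ε := ε) (u := ((stdNode a b c _ : ℕ) : ZMod n)), ← h,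
    Equiv.apply_symm_apply]

theorem Placed.moves_iff (h : Placed p x ε σ a b c) (i : Fin 4) (f : ℤˣ) :
    Moves (multiplicity p) (p (σ i)) (ε * f) ↔ Moves (std n a b c) (stdNode a b c i : ℕ) f := by
  rw [← h.multiplicity_comp, moves_comp, h]

theorem Placed.exists_moves (h : Placed p x ε σ a b c) {i : Fin 4} {f : ℤˣ}
    (hm : Moves (std n a b c) (stdNode a b c i : ℕ) f) :
    ∃ r f, Moves (multiplicity p) (p r) f := ⟨σ i, ε * f, (h.moves_iff i f).2 hm⟩

/-- The displacements of the robots in one step. -/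
theorem Placed.exists_displacement (h : Placed p x ε σ a b c) (hs : Step p q) (hqp : q ≠ p) :
    ∃ δ : Fin 4 → ℤ, (∀ i, q (σ i) = isom x ε (((stdNode a b c i : ℤ) + δ i : ℤ) : ZMod n)) ∧
      (∀ i, δ i = 0 ∨ ∃ f : ℤˣ, Moves (std n a b c) (stdNode a b c i : ℕ) f ∧ δ i = f) ∧
      ∃ i, δ i ≠ 0 := by
  have key : ∀ i, ∃ δ : ℤ, q (σ i) = isom x ε (((stdNode a b c i : ℤ) + δ : ℤ) : ZMod n) ∧
      (δ = 0 ∨ ∃ f : ℤˣ, Moves (std n a b c) (stdNode a b c i : ℕ) f ∧ δ = f) := by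
    intro i
    rcases hs (σ i) with h1 | ⟨f, h1, h2⟩
    · exact ⟨0, by rw [h1, h]; simp, .inl rfl⟩
    · obtain ⟨f, rfl⟩ := mul_unit_surjective ε f
      refine ⟨f, ?_, .inr ⟨f, (h.moves_iff i f).1 h1, rfl⟩⟩
      rw [h2, h, ← isom_ahead, ahead]
      push_cast
      simp
  choose δ h1 h2 using key
  refine ⟨δ, h1, h2, ?_⟩
  by_contra h3
  push Not at h3
  refine hqp (funext fun r => ?_)
  obtain ⟨i, rfl⟩ := σ.surjective r
  rw [h1, h, h3]
  simp

/-- New positions are compared as integers, before reduction modulo `n`, so gaps can be handled by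
linear arithmetic. The orientation and the names are unchanged; only the origin follows robot `0`.
-/
theorem placed_of_int {t : Fin 4 → ℤ} (ht : ∀ i, q (σ i) = isom x ε ((t i : ℤ) : ZMod n))
    (ha : (a : ℤ) = t 1 - t 0) (hb : (b : ℤ) = t 2 - t 1) (hc : (c : ℤ) = t 3 - t 2) :
    Placed q (isom x ε ((t 0 : ℤ) : ZMod n)) ε σ a b c := by
  have ha' : ((a : ℕ) : ZMod n) = (t 1 : ZMod n) - (t 0 : ZMod n) := by
    rw [← Int.cast_natCast, ha]; push_cast; rfl
  have hb' : ((b : ℕ) : ZMod n) = (t 2 : ZMod n) - (t 1 : ZMod n) := by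
    rw [← Int.cast_natCast, hb]; push_cast; rfl
  have hc' : ((c : ℕ) : ZMod n) = (t 3 : ZMod n) - (t 2 : ZMod n) := by
    rw [← Int.cast_natCast, hc]; push_cast; rfl
  rw [Placed, forall_fin_four]
  refine ⟨?_, ?_, ?_, ?_⟩ <;> rw [ht] <;> simp [isom, stdNode, ha', hb', hc'] <;> ring

theorem Gaps.rotate (h : Gaps p a b c) (hs : a + b + c + d = n) : Gaps p b c d := by
  obtain ⟨x, ε, σ, h⟩ := h
  refine ⟨isom x ε (a : ℕ), ε, (Equiv.addRight 1).trans σ, ?_⟩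
  have e : ((a : ZMod n) + b + c + d) = 0 := by
    rw [← Nat.cast_add, ← Nat.cast_add, ← Nat.cast_add, hs, ZMod.natCast_self]
  rw [Placed, forall_fin_four]
  refine ⟨?_, ?_, ?_, ?_⟩ <;> rw [Equiv.trans_apply, Equiv.coe_addRight, h] <;>
    simp [isom, stdNode]
  · ring
  · ring
  · linear_combination (-((ε : ℤ) : ZMod n)) * e

theorem Gaps.reverse (h : Gaps p a b c) : Gaps p c b a := by
  obtain ⟨x, ε, σ, h⟩ := h
  refine ⟨isom x ε (a + b + c : ℕ), -ε, Fin.revPerm.trans σ, ?_⟩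
  rw [Placed, forall_fin_four]
  refine ⟨?_, ?_, ?_, ?_⟩ <;> rw [Equiv.trans_apply, Fin.revPerm_apply, h] <;>
    simp [isom, stdNode, Fin.rev] <;> ring_nf

end Step

/-! ### The stages of an execution -/

/-- A measure that decreases as long as the configuration stays symmetric. -/
def symMeasure (E y O : ℕ) : ℕ :=
  2 * (E + y) + (if E = O + 1 ∧ y = 1 then 1 else 0) + if E = 2 ∧ O = 1 ∧ Even y then 3 else 0

/-- The stages of an execution: `p` is the current configuration, `V` contains the nodes visited so
far, and `k` bounds the number of steps that remain. -/
inductive Stage {n : ℕ} : ℕ → (Fin 4 → ZMod n) → Set (ZMod n) → Prop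
  | sym {k p V} (E y O : ℕ) (hE : Even E) (hE0 : 0 < E) (hy : 0 < y) (hO : Odd O)
      (h : E + y + O + y = n) (hp : Gaps p E y O) (hk : n * n + n + symMeasure E y O ≤ k)
      (hV : Set.range p ⊆ V) : Stage k p V
  | asym {k p V} (a b c d : ℕ) (ha : 0 < a) (hab : a ≤ b) (hbd : b < d) (hac : a < c)
      (h : a + b + c + d = n) (hp : Gaps p a b c) (hk : (a + b) * n + c ≤ k)
      (hV : Set.range p ⊆ V) : Stage k p V
  | spread {k p V} (q l z r : ℕ) (x : ZMod n) (ε : ℤˣ) (σ : Equiv.Perm (Fin 4)) (hl : 2 ≤ l)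
      (hlq : l ≤ q) (hz : 1 ≤ z) (hr : 2 ≤ r) (hrq : r ≤ q) (h : l + z + r = n) (hq : n = 2 * q + 1)
      (hp : Placed p x ε σ 0 l z) (hk : z ≤ k)
      (hV : ∀ j : ℤ, -r ≤ j → j ≤ l → isom x ε (j : ZMod n) ∈ V) : Stage k p V
  | guide {k p V} (x : ZMod n) (ε : ℤˣ) (σ : Equiv.Perm (Fin 4)) (hp : Placed p x ε σ 0 2 2)
      (hk : n + 1 ≤ k) (hV : ∀ j : ℕ, j ≤ 2 → isom x ε (j : ZMod n) ∈ V) : Stage k p V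
  | pair {k p V} (x : ZMod n) (ε : ℤˣ) (σ : Equiv.Perm (Fin 4)) (hp : Placed p x ε σ 0 2 1)
      (hk : n ≤ k) (hV : ∀ j : ℕ, j ≤ 3 → isom x ε (j : ZMod n) ∈ V) : Stage k p V
  | walk {k p V} (z w : ℕ) (x : ZMod n) (ε : ℤˣ) (σ : Equiv.Perm (Fin 4)) (hz : 2 ≤ z) (hw : 1 ≤ w)
      (h : 1 + z + w = n) (hp : Placed p x ε σ 0 1 z)
      (hk : w ≤ k) (hV : ∀ j : ℕ, j ≤ 1 + z → isom x ε (j : ZMod n) ∈ V) : Stage k p V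

theorem Stage.mono {n k : ℕ} {p : Fin 4 → ZMod n} {V W : Set (ZMod n)} (h : Stage k p V)
    (hVW : V ⊆ W) : Stage k p W := by
  cases h with
  | sym E y O hE hE0 hy hO h hp hk hV => exact .sym E y O hE hE0 hy hO h hp hk (hV.trans hVW)
  | asym a b c d ha hab hbd hac h hp hk hV =>
    exact .asym a b c d ha hab hbd hac h hp hk (hV.trans hVW)
  | spread q l z r x ε σ hl hlq hz hr hrq h hq hp hk hV =>
    exact .spread q l z r x ε σ hl hlq hz hr hrq h hq hp hk fun j h1 h2 => hVW (hV j h1 h2)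
  | guide x ε σ hp hk hV => exact .guide x ε σ hp hk fun j h1 => hVW (hV j h1)
  | pair x ε σ hp hk hV => exact .pair x ε σ hp hk fun j h1 => hVW (hV j h1)
  | walk z w x ε σ hz hw h hp hk hV => exact .walk z w x ε σ hz hw h hp hk fun j h1 => hVW (hV j h1)

section Descent

variable {n k : ℕ} {p q : Fin 4 → ZMod n} {V : Set (ZMod n)}

/-- Rotate a shortest gap to the front and reflect if needed, so that the smaller gap beside it
comes second. The uniform bound `n * n + n` lies below every bound of the symmetric stage. -/
theorem Gaps.stage_asym {a b c d : ℕ} (h : Gaps p a b c) (hs : a + b + c + d = n) (ha : 0 < a)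
    (hb : 0 < b) (hc : 0 < c) (hd : 0 < d) (hac : a ≠ c) (hbd : b ≠ d) (hV : Set.range p ⊆ V) :
    Stage (n * n + n) p V := by
  have key : ∀ a b c d, Gaps p a b c → a + b + c + d = n → 0 < a → a ≤ b → a < c → a ≤ d → b ≠ d →
      Stage (n * n + n) p V := by
    intro a b c d h hs ha hab hac had hbd
    have hk : ∀ b c, b + a ≤ n → c ≤ n → (a + b) * n + c ≤ n * n + n := fun b c h1 h2 =>
      Nat.add_le_add (Nat.mul_le_mul_right n (by omega)) h2
    rcases Nat.lt_or_gt_of_ne hbd with hlt | hlt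
    · exact .asym a b c d ha hab hlt hac hs h (hk b c (by omega) (by omega)) hV
    · refine .asym a d c b ha had hlt hac (by omega) ?_ (hk d c (by omega) (by omega)) hV
      exact (h.reverse.rotate (d := d) (by omega)).rotate (d := c) (by omega)
  have h1 := h.rotate hs
  have h2 := h1.rotate (d := a) (by omega)
  have h3 := h2.rotate (d := b) (by omega)
  by_cases ca : a ≤ b ∧ a ≤ c ∧ a ≤ d
  · exact key a b c d h hs ha ca.1 (by omega) ca.2.2 hbd
  by_cases cb : b ≤ a ∧ b ≤ c ∧ b ≤ d
  · exact key b c d a h1 (by omega) hb cb.2.1 (by omega) cb.1 hac.symm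
  by_cases cc : c ≤ a ∧ c ≤ b ∧ c ≤ d
  · exact key c d a b h2 (by omega) hc cc.2.2 (by omega) cc.2.1 hbd.symm
  · exact key d a b c h3 (by omega) hd (by omega) (by omega) (by omega) hac

/-- Some robot can move, and every effective step leads to a later stage. -/
def Descends (k : ℕ) (p : Fin 4 → ZMod n) (V : Set (ZMod n)) : Prop :=
  (∃ r f, Moves (multiplicity p) (p r) f) ∧
    ∀ q, Step p q → q ≠ p → ∃ k' < k, Stage k' q (V ∪ Set.range q)

end Descent

/-! ### Descent in the symmetric stage -/

section SymDescent

variable {n k E y O : ℕ} {p : Fin 4 → ZMod n} {V : Set (ZMod n)}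

theorem stdNode_cast_eq_iff {a b c d : ℕ} (ha : 0 < a) (hb : 0 < b) (hc : 0 < c) (hd : 0 < d)
    (h : a + b + c + d = n) (i j : Fin 4) :
    ((stdNode a b c i : ℕ) : ZMod n) = ((stdNode a b c j : ℕ) : ZMod n) ↔ i = j :=
  (layout_std ha hb hc hd h).injective.eq_iff

theorem odd_of_sym (hE : Even E) (hO : Odd O) (h : E + y + O + y = n) : Odd n := by
  rw [← h]; obtain ⟨q, rfl⟩ := hE; obtain ⟨r, rfl⟩ := hO; exact ⟨q + r + y, by ring⟩

theorem Placed.of_displacement {q : Fin 4 → ZMod n} {x : ZMod n} {ε : ℤˣ}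
    {σ : Equiv.Perm (Fin 4)} {a b c a' b' c' : ℕ} {δ : Fin 4 → ℤ}
    (h : ∀ i, q (σ i) = isom x ε (((stdNode a b c i : ℤ) + δ i : ℤ) : ZMod n))
    (ha : (a' : ℤ) = a + δ 1 - δ 0) (hb : (b' : ℤ) = b + δ 2 - δ 1)
    (hc : (c' : ℤ) = c + δ 3 - δ 2) : Placed q (isom x ε ((δ 0 : ℤ) : ZMod n)) ε σ a' b' c' := by
  have := placed_of_int (a := a') (b := b') (c := c') h (by simp [stdNode]; omega)
    (by simp [stdNode]; omega) (by simp [stdNode]; omega)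
  simpa [stdNode] using this

theorem descends_sym (hE : Even E) (hE0 : 0 < E) (hy : 0 < y) (hO : Odd O)
    (h : E + y + O + y = n) (hn : 7 < n) (hp : Gaps p E y O) (hk : n * n + n + symMeasure E y O ≤ k)
    (hV : Set.range p ⊆ V) : Descends k p V := by
  obtain ⟨x, ε, σ, hP⟩ := hp
  have hO0 := hO.pos
  have hnode := stdNode_cast_eq_iff hE0 hy hO0 hy h
  have hoddn := odd_of_sym hE hO h
  have hmoves := fun i f => moves_sym_iff hE hE0 hy hO h hn (stdNode E y O i : ℕ) f
  simp only [hnode] at hmoves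
  have hasym : ∀ q a b c d, Gaps q a b c → a + b + c + d = n → 0 < a → 0 < b → 0 < c → 0 < d →
      a ≠ c → b ≠ d → ∃ k' < k, Stage k' q (V ∪ Set.range q) := by
    intro q a b c d h1 h2 h3 h4 h5 h6 h7 h8
    refine ⟨n * n + n, ?_, h1.stage_asym h2 h3 h4 h5 h6 h7 h8 Set.subset_union_right⟩
    -- Losing the symmetry must strictly decrease the bound, and the asymmetric stage may start at
    -- `n * n + n`.
    have : 0 < symMeasure E y O := by unfold symMeasure; omega
    omega
  have hsym : ∀ q E' y' O', Gaps q E' y' O' → E' + y' + O' + y' = n → Even E' → 0 < E' → 0 < y' →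
      Odd O' → symMeasure E' y' O' < symMeasure E y O →
      ∃ k' < k, Stage k' q (V ∪ Set.range q) := by
    intro q E' y' O' h1 h2 h3 h4 h5 h6 h7
    exact ⟨_, by omega, .sym E' y' O' h3 h4 h5 h6 h2 h1 le_rfl Set.subset_union_right⟩
  have hE' := Nat.even_iff.1 hE
  have hO' := Nat.odd_iff.1 hO
  have hmeas : ∀ E' y' O' : ℕ, E' + y' + O' + y' = n → E' % 2 = 0 → O' % 2 = 1 → 0 < E' → 0 < y' →
      (2 * (E' + y') + (if E' = O' + 1 ∧ y' = 1 then 1 else 0) +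
        (if E' = 2 ∧ O' = 1 ∧ y' % 2 = 0 then 3 else 0) <
      2 * (E + y) + (if E = O + 1 ∧ y = 1 then 1 else 0) +
        (if E = 2 ∧ O = 1 ∧ y % 2 = 0 then 3 else 0)) → ∀ q, Gaps q E' y' O' →
      ∃ k' < k, Stage k' q (V ∪ Set.range q) := by
    intro E' y' O' h1 h2 h3 h4 h5 h6 q h7
    exact hsym q E' y' O' h7 h1 (Nat.even_iff.2 h2) h4 h5 (Nat.odd_iff.2 h3)
      (by simpa only [symMeasure, Nat.even_iff] using h6)
  by_cases hclose : y = 1 ∨ (E = O + 1 ∧ Even y ∧ 2 < E)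
  · have hm : ∀ i f, Moves (std n E y O) (stdNode E y O i : ℕ) f ↔
        (i = 0 ∧ f = 1) ∨ (i = 1 ∧ f = -1) := by
      intro i f
      rw [hmoves]
      have h1 : ¬ (E = O + 1 ∧ Even y ∧ E = 2) := by
        rintro ⟨h1, h2, h3⟩
        rcases hclose with rfl | h4
        · exact absurd h2 (by decide)
        · omega
      have h2 : ¬ (y ≠ 1 ∧ ¬ (E = O + 1 ∧ Even y)) := by tauto
      simp only [hclose, h1, h2, true_and, false_and, or_false]
    refine ⟨hP.exists_moves ((hm 0 1).2 (.inl ⟨rfl, rfl⟩)), fun q hq hqp => ?_⟩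
    obtain ⟨δ, h1, h2, h3⟩ := hP.exists_displacement hq hqp
    simp only [hm] at h2
    rw [forall_fin_four] at h2
    rw [exists_fin_four] at h3
    simp at h2
    obtain ⟨d0, d1, d2, d3⟩ := h2
    rw [Nat.even_iff] at hclose
    by_cases hboth : δ 0 = 1 ∧ δ 1 = -1
    · by_cases hE2 : E = 2
      · -- the two robots meet
        obtain rfl : y = 1 := by omega
        subst hE2
        have hQ : Placed q _ ε σ 0 2 O :=
          .of_displacement h1 (by push_cast; omega) (by push_cast; omega) (by omega)
        rw [hboth.1] at hQ
        have hcov : ∀ j : Fin 4, isom x ε ((stdNode 2 1 O j : ℕ) : ZMod n) ∈ V := fun j =>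
          hP j ▸ hV ⟨_, rfl⟩
        have hcov' : isom x ε ((1 : ℤ) : ZMod n) ∈ V ∪ Set.range q := by
          right
          refine ⟨σ 0, ?_⟩
          rw [h1, hboth.1]
          simp [stdNode]
        have hz : ((2 + 1 + O + 1 : ℕ) : ZMod n) = 0 := by rw [h, ZMod.natCast_self]
        push_cast at hz
        obtain ⟨r, rfl⟩ := hO
        -- Here `n = O + 4` and `O = 2 * r + 1`, so `(n - 1) / 2 = r + 2`. Relative to the tower,
        -- the nodes from `-2` to `2` are the four old nodes and the meeting node.
        refine ⟨2 * r + 1, ?_, .spread (r + 2) 2 (2 * r + 1) 2 _ ε σ le_rfl (by omega) (by omega) le_rfl (by omega)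
          (by omega) (by omega) hQ le_rfl ?_⟩
        · unfold symMeasure at hk
          omega
        · intro j hj1 hj2
          have c0 := hcov 0
          have c1 := hcov 1
          have c2 := hcov 2
          have c3 := hcov 3
          simp only [stdNode, Matrix.cons_val] at c0 c1 c2 c3
          obtain rfl | rfl | rfl | rfl | rfl :
            j = -2 ∨ j = -1 ∨ j = 0 ∨ j = 1 ∨ j = 2 := by omega
          · left
            convert c3 using 1
            simp only [isom]
            push_cast at hz ⊢
            linear_combination (-((ε : ℤ) : ZMod n)) * hz
          · left
            convert c0 using 1
            simp only [isom]
            push_cast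
            ring
          · convert hcov' using 1
            simp only [isom]
            push_cast
            ring
          · left
            convert c1 using 1
            simp only [isom]
            push_cast
            ring
          · left
            convert c2 using 1
            simp only [isom]
            push_cast
            ring
      -- The main term drops by `2`. The correction `3` would be gained only from the gaps `4, 1, 1,
      -- 1`, that is for `n = 7`.
      · refine hmeas (E - 2) (y + 1) O (by omega) (by omega) (by omega) (by omega) (by omega)
          (by split_ifs <;> omega) q (Placed.gaps (.of_displacement h1 ?_ ?_ ?_)) <;> omega
    -- A lone move gives the gaps `E - 1, y, O, y + 1`. They are asymmetric unless `E = O + 1`, when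
    -- a new axis passes through the gaps `y` and `y + 1`, whose parities decide their new roles.
    · have hfin : Gaps q (E - 1) y O → ∃ k' < k, Stage k' q (V ∪ Set.range q) := by
        intro hQ
        by_cases hEO : E = O + 1
        · have hQ1 := hQ.rotate (d := y + 1) (by omega)
          by_cases hy2 : y % 2 = 0
          · exact hmeas y O (y + 1) (by omega) (by omega) (by omega) hy (by omega)
              (by split_ifs <;> omega) q hQ1
          -- Here `y = 1` and the main term does not change; the correction for `E = O + 1 ∧ y = 1`
          -- exists to pay for this step.
          · have hQ3 := (hQ1.rotate (d := E - 1) (by omega)).rotate (d := y) (by omega)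
            exact hmeas (y + 1) (E - 1) y (by omega) (by omega) (by omega) (by omega) (by omega)
              (by split_ifs <;> omega) q hQ3
        · exact hasym q _ _ _ (y + 1) hQ (by omega) (by omega) hy hO0 (by omega) (by omega)
            (by omega)
      by_cases hd : δ 0 = 1
      · exact hfin (Placed.gaps (.of_displacement h1 (by omega) (by omega) (by omega)))
      · have hQ : Gaps q (E - 1) (y + 1) O :=
          Placed.gaps (.of_displacement h1 (by omega) (by omega) (by omega))
        exact hfin ((hQ.reverse.rotate (d := y) (by omega)).rotate (d := O) (by omega))
  by_cases hopen : E = O + 1 ∧ Even y ∧ E = 2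
  · have hm : ∀ i f, Moves (std n E y O) (stdNode E y O i : ℕ) f ↔
        (i = 0 ∧ f = -1) ∨ (i = 1 ∧ f = 1) := by
      intro i f
      rw [hmoves]
      have h2 : ¬ (y ≠ 1 ∧ ¬ (E = O + 1 ∧ Even y)) := by tauto
      rw [eq_false hclose, eq_true hopen, eq_false h2]
      simp only [true_and, false_and, or_false, false_or]
    refine ⟨hP.exists_moves ((hm 0 (-1)).2 (.inl ⟨rfl, rfl⟩)), fun q hq hqp => ?_⟩
    obtain ⟨δ, h1, h2, h3⟩ := hP.exists_displacement hq hqp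
    simp only [hm] at h2
    rw [forall_fin_four] at h2
    rw [exists_fin_four] at h3
    simp at h2
    obtain ⟨d0, d1, d2, d3⟩ := h2
    rw [Nat.even_iff] at hopen
    by_cases hboth : δ 0 = -1 ∧ δ 1 = 1
    -- Opening from `E = 2`, `O = 1` raises the main term by `2`; the correction `3` pays for it.
    · refine hmeas 4 (y - 1) 1 (by omega) (by omega) (by omega) (by omega) (by omega)
        (by split_ifs <;> omega) q (Placed.gaps (.of_displacement h1 ?_ ?_ ?_)) <;> omega
    · by_cases hd : δ 0 = -1
      · exact hasym q 3 y 1 (y - 1)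
          (Placed.gaps (.of_displacement h1 (by omega) (by omega) (by omega)))
          (by omega) (by omega) (by omega) (by omega) (by omega) (by omega) (by omega)
      · exact hasym q 3 (y - 1) 1 y
          (Placed.gaps (.of_displacement h1 (by omega) (by omega) (by omega)))
          (by omega) (by omega) (by omega) (by omega) (by omega) (by omega) (by omega)
  · have hspread : y ≠ 1 ∧ ¬ (E = O + 1 ∧ Even y) := by
      refine ⟨fun h => hclose (.inl h), fun ⟨h4, h5⟩ => ?_⟩
      by_cases hE2 : E = 2
      · exact hopen ⟨h4, h5, hE2⟩
      · exact hclose (.inr ⟨h4, h5, by omega⟩)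
    have hm : ∀ i f, Moves (std n E y O) (stdNode E y O i : ℕ) f ↔
        (i = 2 ∧ f = -1) ∨ (i = 3 ∧ f = 1) := by
      intro i f
      rw [hmoves]
      rw [eq_false hclose, eq_false hopen, eq_true hspread]
      simp only [true_and, false_and, false_or]
    refine ⟨hP.exists_moves ((hm 2 (-1)).2 (.inl ⟨rfl, rfl⟩)), fun q hq hqp => ?_⟩
    obtain ⟨δ, h1, h2, h3⟩ := hP.exists_displacement hq hqp
    simp only [hm] at h2
    rw [forall_fin_four] at h2
    rw [exists_fin_four] at h3
    simp at h2
    obtain ⟨d0, d1, d2, d3⟩ := h2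
    rw [Nat.even_iff] at hspread
    by_cases hboth : δ 2 = -1 ∧ δ 3 = 1
    · refine hmeas E (y - 1) (O + 2) (by omega) (by omega) (by omega) (by omega) (by omega)
        (by split_ifs <;> omega) q (Placed.gaps (.of_displacement h1 ?_ ?_ ?_)) <;> omega
    -- Again a lone move keeps a symmetry only if `E = O + 1`. Then `y` is odd and at least `3`, the
    -- gap `y - 1` becomes the even distance, and the main term drops by `2`.
    · have hfin : Gaps q E (y - 1) (O + 1) → ∃ k' < k, Stage k' q (V ∪ Set.range q) := by
        intro hQ
        by_cases hEO : E = O + 1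
        · have hQ1 := hQ.rotate (d := y) (by omega)
          exact hmeas (y - 1) (O + 1) y (by omega) (by omega) (by omega) (by omega) (by omega)
            (by split_ifs <;> omega) q hQ1
        · exact hasym q _ _ _ y hQ (by omega) (by omega) (by omega) (by omega) (by omega)
            (by omega) (by omega)
      by_cases hd : δ 2 = -1
      · exact hfin (Placed.gaps (.of_displacement h1 (by omega) (by omega) (by omega)))
      · have hQ : Gaps q E y (O + 1) :=
          Placed.gaps (.of_displacement h1 (by omega) (by omega) (by omega))
        exact hfin ((hQ.reverse.rotate (d := y - 1) (by omega)).rotate (d := O + 1) (by omega))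

end SymDescent

/-! ### Descent in the asymmetric stage -/

section AsymDescent

variable {n k a b c d : ℕ} {p : Fin 4 → ZMod n} {V : Set (ZMod n)}

theorem descends_asym (hn : Odd n) (hn7 : 7 < n) (ha : 0 < a) (hab : a ≤ b) (hbd : b < d)
    (hac : a < c) (h : a + b + c + d = n) (hp : Gaps p a b c) (hk : (a + b) * n + c ≤ k)
    (hV : Set.range p ⊆ V) : Descends k p V := by
  -- As `c' < n`, the number `(a + b) * n + c` orders the pairs `(a + b, c)` lexicographically.
  have hnext : ∀ q a' b' c' d', Gaps q a' b' c' → 0 < a' → a' ≤ b' → b' < d' → a' < c' →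
      a' + b' + c' + d' = n → (a' + b' < a + b ∨ (a' + b' = a + b ∧ c' < c)) →
      ∃ k' < k, Stage k' q (V ∪ Set.range q) := by
    intro q a' b' c' d' h1 h2 h3 h4 h5 h6 h7
    refine ⟨_, ?_, .asym a' b' c' d' h2 h3 h4 h5 h6 h1 le_rfl Set.subset_union_right⟩
    refine lt_of_lt_of_le ?_ hk
    rcases h7 with h7 | ⟨h7, h8⟩
    · have := Nat.mul_le_mul_right n (show a' + b' + 1 ≤ a + b by omega)
      rw [Nat.add_mul, one_mul] at this
      omega
    · rw [h7]; omega
  by_cases hlt : a < b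
  · obtain ⟨x, ε, σ, hP⟩ := hp
    have hnode := stdNode_cast_eq_iff ha (by omega : 0 < b) (by omega : 0 < c) (by omega : 0 < d) h
    have hm := fun i f => moves_asym_of_lt hn ha hlt hbd hac h (stdNode a b c i : ℕ) f
    simp only [hnode] at hm
    refine ⟨hP.exists_moves ((hm 2 (-1)).2 ⟨rfl, rfl⟩), fun q hq hqp => ?_⟩
    obtain ⟨δ, h1, h2, h3⟩ := hP.exists_displacement hq hqp
    simp only [hm] at h2
    rw [forall_fin_four] at h2
    rw [exists_fin_four] at h3
    simp at h2
    obtain ⟨d0, d1, d2, d3⟩ := h2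
    exact hnext q a (b - 1) (c + 1) d
      (Placed.gaps (.of_displacement h1 (by omega) (by omega) (by omega)))
      ha (by omega) (by omega) (by omega) (by omega) (by omega)
  obtain rfl : a = b := by omega
  by_cases ha1 : 1 < a
  · obtain ⟨x, ε, σ, hP⟩ := hp
    have hnode := stdNode_cast_eq_iff ha ha (by omega : 0 < c) (by omega : 0 < d) h
    have hm := fun i f => moves_asym_of_eq hn ha1 hbd hac h (stdNode a a c i : ℕ) f
    simp only [hnode] at hm
    refine ⟨hP.exists_moves ((hm 0 1).2 (.inl ⟨rfl, rfl⟩)), fun q hq hqp => ?_⟩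
    obtain ⟨δ, h1, h2, h3⟩ := hP.exists_displacement hq hqp
    simp only [hm] at h2
    rw [forall_fin_four] at h2
    rw [exists_fin_four] at h3
    simp at h2
    obtain ⟨d0, d1, d2, d3⟩ := h2
    by_cases hboth : δ 0 = 1 ∧ δ 2 = -1
    · exact hnext q (a - 1) (a - 1) (c + 1) (d + 1)
        (Placed.gaps (.of_displacement h1 (by omega) (by omega) (by omega)))
        (by omega) (by omega) (by omega) (by omega) (by omega) (by omega)
    by_cases hd : δ 0 = 1
    · exact hnext q (a - 1) a c (d + 1)
        (Placed.gaps (.of_displacement h1 (by omega) (by omega) (by omega)))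
        (by omega) (by omega) (by omega) (by omega) (by omega) (by omega)
    · have hQ : Gaps q a (a - 1) (c + 1) :=
        Placed.gaps (.of_displacement h1 (by omega) (by omega) (by omega))
      -- When only the other border robot moves, a reflection brings the shortened gap to the front
      -- and exchanges the roles of `c` and `d`.
      exact hnext q (a - 1) a d (c + 1) 
        (((hQ.reverse.rotate (d := d) (by omega))))
        (by omega) (by omega) (by omega) (by omega) (by omega) (by omega)
  obtain rfl : a = 1 := by omega
  have key : ∀ c d, 1 < c → c < d → 1 + 1 + c + d = n → Gaps p 1 1 c → (1 + 1) * n + c ≤ k →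
      Descends k p V := by
    intro c d hac hcd h hp hk
    obtain ⟨x, ε, σ, hP⟩ := hp
    have hnode := stdNode_cast_eq_iff one_pos one_pos (by omega : 0 < c) (by omega : 0 < d) h
    by_cases hc : 3 ≤ c
    · have hm := fun i f => moves_asym_one hn hc hcd h (stdNode 1 1 c i : ℕ) f
      simp only [hnode] at hm
      refine ⟨hP.exists_moves ((hm 3 (-1)).2 ⟨rfl, rfl⟩), fun q hq hqp => ?_⟩
      obtain ⟨δ, h1, h2, h3⟩ := hP.exists_displacement hq hqp
      simp only [hm] at h2
      rw [forall_fin_four] at h2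
      rw [exists_fin_four] at h3
      simp at h2
      obtain ⟨d0, d1, d2, d3⟩ := h2
      refine ⟨(1 + 1) * n + (c - 1), by omega, .asym 1 1 (c - 1) (d + 1) one_pos le_rfl (by omega)
        (by omega) (by omega) ?_ le_rfl Set.subset_union_right⟩
      exact Placed.gaps (.of_displacement h1 (by omega) (by omega) (by omega))
    · obtain rfl : c = 2 := by omega
      have hm := fun i f => moves_aTowerPlan hn hcd h (stdNode 1 1 2 i : ℕ) f
      simp only [hnode] at hm
      refine ⟨hP.exists_moves ((hm 1 (-1)).2 ⟨rfl, rfl⟩), fun q hq hqp => ?_⟩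
      obtain ⟨δ, h1, h2, h3⟩ := hP.exists_displacement hq hqp
      simp only [hm] at h2
      rw [forall_fin_four] at h2
      rw [exists_fin_four] at h3
      simp at h2
      obtain ⟨d0, d1, d2, d3⟩ := h2
      have hQ : Placed q _ ε σ 0 2 2 :=
        .of_displacement h1 (by omega) (by omega) (by omega)
      rw [d0, Int.cast_zero, isom, mul_zero, add_zero] at hQ
      -- Node `1` has just been left by the middle robot, so the nodes `0, 1, 2` were all visited
      -- before the tower formed.
      refine ⟨n + 1, by omega, .guide x ε σ hQ le_rfl fun j hj => .inl ?_⟩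
      have hcov : ∀ j : Fin 4, isom x ε ((stdNode 1 1 2 j : ℕ) : ZMod n) ∈ V := fun j =>
        hP j ▸ hV ⟨_, rfl⟩
      interval_cases j
      exacts [hcov 0, hcov 1, hcov 2]
  rcases Nat.lt_or_ge c d with hcd | hcd
  · exact key c d hac hcd h hp hk
  -- Since `n` is odd, `c ≠ d`. Reversing the configuration makes the shorter gap third, and the
  -- potential can only decrease.
  · obtain ⟨r, rfl⟩ := hn
    refine key d c hbd (by omega) (by omega) ?_ (by omega)
    exact hp.reverse.rotate (by omega)

end AsymDescent

/-! ### Descent in the stages with a tower -/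

section TowerDescent

variable {n k : ℕ} {p : Fin 4 → ZMod n} {V : Set (ZMod n)} {x : ZMod n} {ε : ℤˣ}
  {σ : Equiv.Perm (Fin 4)}

/-- The configuration contains a tower-block or a tower-sole, and every node has been visited. -/
def Finished (p : Fin 4 → ZMod n) (V : Set (ZMod n)) : Prop :=
  (TowerBlock (multiplicity p) ∨ TowerSole (multiplicity p)) ∧ ∀ u, u ∈ V

theorem finished_or_descends_spread {q l z r : ℕ} (hl : 2 ≤ l)
    (hlq : l ≤ q) (hz : 1 ≤ z) (hr : 2 ≤ r) (hrq : r ≤ q) (h : l + z + r = n) (hq : n = 2 * q + 1)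
    (hn : 7 < n) (hp : Placed p x ε σ 0 l z) (hk : z ≤ k)
    (hV : ∀ j : ℤ, -r ≤ j → j ≤ l → isom x ε (j : ZMod n) ∈ V) : Finished p V ∨ Descends k p V := by
  rcases hz.eq_or_lt with rfl | hz1
  · left
    -- With `z = 1` the identity `l + 1 + r = 2 * q + 1` forces `l = r = q`, and the visited arc
    -- from `-q` to `q` is the whole ring.
    obtain rfl : l = r := by omega
    have hs := towerSole_tower (by omega) h
    rw [← hp.multiplicity_comp, towerSole_comp] at hs
    refine ⟨.inr hs, fun u => ?_⟩
    obtain ⟨v, rfl⟩ := isom_surjective x ε u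
    obtain ⟨i, hi, rfl⟩ := exists_natCast (by omega) v
    rcases Nat.lt_or_ge l i with hi2 | hi2
    · have := hV ((i : ℤ) - n) (by omega) (by omega)
      push_cast at this
      rwa [ZMod.natCast_self, sub_zero] at this
    · have := hV i (by omega) (by omega)
      rwa [Int.cast_natCast] at this
  right
  have e0 : ∀ f, ¬ Moves (std n 0 l z) ((stdNode 0 l z 0 : ℕ) : ZMod n) f := by
    have := not_moves_spread_tower hl hlq hz1 hr hrq h hq hn
    simpa [stdNode] using this
  have e1 : ∀ f, ¬ Moves (std n 0 l z) ((stdNode 0 l z 1 : ℕ) : ZMod n) f := e0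
  have e2 : ∀ f, Moves (std n 0 l z) ((stdNode 0 l z 2 : ℕ) : ZMod n) f ↔
      f = 1 ∧ (l = 2 ∨ r ≠ 2 ∧ l < q) := by
    have := moves_spread_left hl hlq hz1 hr hrq h hq hn
    simpa only [stdNode, Matrix.cons_val, zero_add] using this
  have e3 : ∀ f, Moves (std n 0 l z) ((stdNode 0 l z 3 : ℕ) : ZMod n) f ↔
      f = -1 ∧ (r = 2 ∨ l ≠ 2 ∧ r < q) := by
    have := moves_spread_right hl hlq hz1 hr hrq h hq hn
    simpa only [stdNode, Matrix.cons_val, zero_add] using this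
  refine ⟨?_, fun s hs hsp => ?_⟩
  · by_cases hl2 : l = 2 ∨ r ≠ 2 ∧ l < q
    · exact hp.exists_moves ((e2 1).2 ⟨rfl, hl2⟩)
    · exact hp.exists_moves ((e3 (-1)).2 ⟨rfl, by omega⟩)
  obtain ⟨δ, h1, h2, h3⟩ := hp.exists_displacement hs hsp
  rw [forall_fin_four] at h2
  rw [exists_fin_four] at h3
  simp only [e0, e1, e2, e3] at h2
  simp at h2
  obtain ⟨d0, d1, d2, d3⟩ := h2
  -- Only this part of the move conditions is needed from here on: single robots never approach the
  -- tower and never go beyond distance `q`.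
  have d2' : δ 2 = 0 ∨ (δ 2 = 1 ∧ l < q) := by omega
  have d3' : δ 3 = 0 ∨ (δ 3 = -1 ∧ r < q) := by omega
  clear d2 d3
  obtain ⟨l', hl'⟩ : ∃ l' : ℕ, (l' : ℤ) = l + δ 2 := ⟨(l + δ 2).toNat, by omega⟩
  obtain ⟨r', hr'⟩ : ∃ r' : ℕ, (r' : ℤ) = r - δ 3 := ⟨(r - δ 3).toNat, by omega⟩
  obtain ⟨z', hz'⟩ : ∃ z' : ℕ, (z' : ℤ) = z + δ 3 - δ 2 := ⟨(z + δ 3 - δ 2).toNat, by omega⟩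
  have hQ : Placed s _ ε σ 0 l' z' := .of_displacement h1 (by omega) (by omega) (by omega)
  rw [d0, Int.cast_zero, isom, mul_zero, add_zero] at hQ
  refine ⟨z', by omega, .spread q l' z' r' x ε σ (by omega) (by omega) (by omega) (by omega)
    (by omega) (by omega) hq hQ le_rfl fun j hj1 hj2 => ?_⟩
  by_cases hjl : j ≤ l
  · by_cases hjr : -(r : ℤ) ≤ j
    · exact .inl (hV j hjr hjl)
    -- The only new node on this side is `-r'`, which is the position `l' + z'` modulo `n`.
    · refine .inr ⟨σ 3, (hQ 3).trans ?_⟩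
      have : (((stdNode 0 l' z' 3 : ℕ) : ℤ) : ZMod n) = ((j + n : ℤ) : ZMod n) := by
        congr 1
        simp [stdNode]
        omega
      push_cast at this
      rw [this, ZMod.natCast_self, add_zero]
  · refine .inr ⟨σ 2, (hQ 2).trans ?_⟩
    have : (((stdNode 0 l' z' 2 : ℕ) : ℤ) : ZMod n) = (j : ZMod n) := by
      congr 1
      simp [stdNode]
      omega
    rw [← this, Int.cast_natCast]

theorem descends_guide (hodd : Odd n) (hn : 7 < n) (hp : Placed p x ε σ 0 2 2) (hk : n + 1 ≤ k)
    (hV : ∀ j : ℕ, j ≤ 2 → isom x ε (j : ZMod n) ∈ V) : Descends k p V := by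
  have hm : ∀ i f, Moves (std n 0 2 2) ((stdNode 0 2 2 i : ℕ) : ZMod n) f ↔ i = 3 ∧ f = -1 := by
    have := fun i hi f => moves_towerGuide hodd hn (y := n - 4) (by omega) (i := i) hi f
    rw [forall_fin_four]
    refine ⟨fun f => ?_, fun f => ?_, fun f => ?_, fun f => ?_⟩ <;>
    rw [this _ (by simp [stdNode]; omega)] <;> simp [stdNode]
  refine ⟨hp.exists_moves ((hm 3 (-1)).2 ⟨rfl, rfl⟩), fun q hq hqp => ?_⟩
  obtain ⟨δ, h1, h2, h3⟩ := hp.exists_displacement hq hqp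
  simp only [hm] at h2
  rw [forall_fin_four] at h2
  rw [exists_fin_four] at h3
  simp at h2
  obtain ⟨d0, d1, d2, d3⟩ := h2
  have hQ : Placed q _ ε σ 0 2 1 := .of_displacement h1 (by omega) (by omega) (by omega)
  rw [d0, Int.cast_zero, isom, mul_zero, add_zero] at hQ
  refine ⟨n, by omega, .pair x ε σ hQ le_rfl fun j hj => ?_⟩
  rcases Nat.lt_or_ge 2 j with hj2 | hj2
  · obtain rfl : j = 3 := by omega
    exact .inr ⟨σ 3, hQ 3⟩
  · exact .inl (hV j hj2)

theorem descends_pair (hodd : Odd n) (hn : 7 < n) (hp : Placed p x ε σ 0 2 1) (hk : n ≤ k)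
    (hV : ∀ j : ℕ, j ≤ 3 → isom x ε (j : ZMod n) ∈ V) : Descends k p V := by
  have hm : ∀ i f, Moves (std n 0 2 1) ((stdNode 0 2 1 i : ℕ) : ZMod n) f ↔ i = 2 ∧ f = -1 := by
    have := fun i hi f => moves_tower_pair hodd hn (y := n - 3) (by omega) (i := i) hi f
    rw [forall_fin_four]
    refine ⟨fun f => ?_, fun f => ?_, fun f => ?_, fun f => ?_⟩ <;>
    rw [this _ (by simp [stdNode])] <;> simp [stdNode]
  refine ⟨hp.exists_moves ((hm 2 (-1)).2 ⟨rfl, rfl⟩), fun q hq hqp => ?_⟩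
  obtain ⟨δ, h1, h2, h3⟩ := hp.exists_displacement hq hqp
  simp only [hm] at h2
  rw [forall_fin_four] at h2
  rw [exists_fin_four] at h3
  simp at h2
  obtain ⟨d0, d1, d2, d3⟩ := h2
  have hQ : Placed q _ ε σ 0 1 2 := .of_displacement h1 (by omega) (by omega) (by omega)
  rw [d0, Int.cast_zero, isom, mul_zero, add_zero] at hQ
  exact ⟨n - 3, by omega, .walk 2 (n - 3) x ε σ le_rfl (by omega) (by omega) hQ le_rfl
    fun j hj => .inl (hV j hj)⟩

/-! ### The walk around the ring and the combined descent -/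

theorem finished_or_descends_walk {z w : ℕ} (hodd : Odd n) (hn : 7 < n) (hz : 2 ≤ z) (hw : 1 ≤ w)
    (h : 1 + z + w = n) (hp : Placed p x ε σ 0 1 z) (hk : w ≤ k)
    (hV : ∀ j : ℕ, j ≤ 1 + z → isom x ε (j : ZMod n) ∈ V) : Finished p V ∨ Descends k p V := by
  rcases hw.eq_or_lt with rfl | hw1
  · left
    have hb := (towerBlock_tower_iff one_pos (by omega) one_pos h hn).2 ⟨.inl rfl, .inr (by omega)⟩
    rw [← hp.multiplicity_comp, towerBlock_comp] at hb
    refine ⟨.inl hb, fun u => ?_⟩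
    obtain ⟨v, rfl⟩ := isom_surjective x ε u
    obtain ⟨i, hi, rfl⟩ := exists_natCast (by omega) v
    exact hV i (by omega)
  right
  have hm : ∀ i f, Moves (std n 0 1 z) ((stdNode 0 1 z i : ℕ) : ZMod n) f ↔ i = 3 ∧ f = 1 := by
    have := fun i hi f => moves_tower_walk hodd hn hz hw1 h (i := i) hi f
    rw [forall_fin_four]
    refine ⟨fun f => ?_, fun f => ?_, fun f => ?_, fun f => ?_⟩ <;>
    rw [this _ (by simp [stdNode]; omega)] <;> simp [stdNode] <;> omega
  refine ⟨hp.exists_moves ((hm 3 1).2 ⟨rfl, rfl⟩), fun q hq hqp => ?_⟩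
  obtain ⟨δ, h1, h2, h3⟩ := hp.exists_displacement hq hqp
  simp only [hm] at h2
  rw [forall_fin_four] at h2
  rw [exists_fin_four] at h3
  simp at h2
  obtain ⟨d0, d1, d2, d3⟩ := h2
  have hQ : Placed q _ ε σ 0 1 (z + 1) :=
    .of_displacement h1 (by omega) (by omega) (by push_cast; omega)
  rw [d0, Int.cast_zero, isom, mul_zero, add_zero] at hQ
  refine ⟨w - 1, by omega, .walk (z + 1) (w - 1) x ε σ (by omega) (by omega) (by omega) hQ le_rfl
    fun j hj => ?_⟩
  rcases Nat.lt_or_ge (1 + z) j with hj2 | hj2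
  · obtain rfl : j = 1 + (z + 1) := by omega
    refine .inr ⟨σ 3, (hQ 3).trans ?_⟩
    simp [stdNode]
  · exact .inl (hV j hj2)

theorem Stage.finished_or_descends (hodd : Odd n) (hn : 7 < n) (h : Stage k p V) :
    Finished p V ∨ Descends k p V := by
  cases h with
  | sym E y O hE hE0 hy hO h hp hk hV => exact .inr (descends_sym hE hE0 hy hO h hn hp hk hV)
  | asym a b c d ha hab hbd hac h hp hk hV =>
    exact .inr (descends_asym hodd hn ha hab hbd hac h hp hk hV)
  | spread q l z r x ε σ hl hlq hz hr hrq h hq hp hk hV =>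
    exact finished_or_descends_spread hl hlq hz hr hrq h hq hn hp hk hV
  | guide x ε σ hp hk hV => exact .inr (descends_guide hodd hn hp hk hV)
  | pair x ε σ hp hk hV => exact .inr (descends_pair hodd hn hp hk hV)
  | walk z w x ε σ hz hw h hp hk hV => exact finished_or_descends_walk hodd hn hz hw h hp hk hV

end TowerDescent

/-! ### Executions -/

section Execution

variable {n : ℕ}

/-- Sorting the robots by their representatives in `0, …, n - 1` gives the cyclic order; the fourth
gap wraps around. -/
theorem exists_gaps_of_injective (hn : 0 < n) {p : Fin 4 → ZMod n} (hp : Function.Injective p) :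
    ∃ a b c d, 0 < a ∧ 0 < b ∧ 0 < c ∧ 0 < d ∧ a + b + c + d = n ∧ Gaps p a b c := by
  have : NeZero n := ⟨hn.ne'⟩
  set f : Fin 4 → ℕ := fun r => (p r).val with hf
  have hfi : Function.Injective f := (ZMod.val_injective n).comp hp
  have hmono : StrictMono (f ∘ Tuple.sort f) :=
    (Tuple.monotone_sort f).strictMono_of_injective (hfi.comp (Tuple.sort f).injective)
  set t := f ∘ Tuple.sort f with ht
  have h01 : t 0 < t 1 := hmono (by decide)
  have h12 : t 1 < t 2 := hmono (by decide)
  have h23 : t 2 < t 3 := hmono (by decide)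
  have h3 : t 3 < n := ZMod.val_lt _
  have hpt : ∀ i, p (Tuple.sort f i) = isom 0 1 (((t i : ℕ) : ℤ) : ZMod n) := by
    intro i
    rw [isom_one, zero_add, Int.cast_natCast]
    exact (ZMod.natCast_zmod_val _).symm
  refine ⟨t 1 - t 0, t 2 - t 1, t 3 - t 2, n - t 3 + t 0, by omega, by omega, by omega, by omega,
    by omega, Placed.gaps (placed_of_int hpt ?_ ?_ ?_)⟩ <;> omega

theorem exists_stage_of_injective (hodd : Odd n) {p : Fin 4 → ZMod n}
    (hp : Function.Injective p) : ∃ k, Stage k p (Set.range p) := by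
  obtain ⟨a, b, c, d, ha, hb, hc, hd, hs, hg⟩ := exists_gaps_of_injective hodd.pos hp
  have key : ∀ a b c d, 0 < a → 0 < b → 0 < c → b = d → a + b + c + d = n → Gaps p a b c →
      ∃ k, Stage k p (Set.range p) := by
    rintro a b c d ha hb hc rfl hs hg
    -- With `b = d` and `n` odd, `a + c` is odd, so exactly one of `a` and `c` can serve as the even
    -- distance.
    rcases Nat.even_or_odd a with ha2 | ha2
    · have : Odd c := by
        by_contra hc2
        rw [Nat.not_odd_iff_even] at hc2
        rw [← hs] at hodd
        rw [Nat.odd_iff] at hodd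
        rw [Nat.even_iff] at ha2 hc2
        omega
      exact ⟨_, .sym a b c ha2 ha hb this hs hg le_rfl subset_rfl⟩
    · have : Even c := by
        by_contra hc2
        rw [Nat.not_even_iff_odd] at hc2
        rw [← hs] at hodd
        rw [Nat.odd_iff] at hodd ha2 hc2
        omega
      exact ⟨_, .sym c b a this hc hb ha2 (by omega)
        ((hg.rotate hs).rotate (d := a) (by omega)) le_rfl subset_rfl⟩
  by_cases hbd : b = d
  · exact key a b c d ha hb hc hbd hs hg
  by_cases hac : a = c
  · exact key b c d a hb hc hd hac.symm (by omega) (hg.rotate hs)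
  · exact ⟨_, hg.stage_asym hs ha hb hc hd hac hbd subset_rfl⟩

variable {act : ℕ → Finset (Fin 4)} {ori : ℕ → Fin 4 → ℤˣ} {p : ℕ → Fin 4 → ZMod n}

theorem IsExecution.step (h : IsExecution (oddExploration n) act ori p) (t : ℕ) :
    Step (p t) (p (t + 1)) := by
  intro r
  rw [h t r]
  split_ifs
  · rcases cycle_oddExploration (p := p t) r (ori t r) with h1 | ⟨-, h1⟩
    · exact .inr h1
    · exact .inl h1
  · exact .inl rfl

theorem ahead_one_ne (hn : 1 < n) (u : ZMod n) (e : ℤˣ) : ahead u e 1 ≠ u := by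
  have : Fact (1 < n) := ⟨hn⟩
  rcases Int.units_eq_one_or e with rfl | rfl <;> simp [ahead]

theorem IsExecution.ne_of_moves (hn : 1 < n) (h : IsExecution (oddExploration n) act ori p)
    {t : ℕ} {r : Fin 4} (hr : r ∈ act t) {f : ℤˣ} (hf : Moves (multiplicity (p t)) (p t r) f) :
    p (t + 1) ≠ p t := by
  intro he
  have h1 := h t r
  rw [if_pos hr, he] at h1
  rcases cycle_oddExploration (p := p t) r (ori t r) with ⟨g, -, h2⟩ | ⟨h2, -⟩
  · exact ahead_one_ne hn _ _ (h2.symm.trans h1.symm)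
  · exact h2 f hf

/-- The nodes visited up to time `t`. -/
def visited (p : ℕ → Fin 4 → ZMod n) (t : ℕ) : Set (ZMod n) := {u | ∃ s ≤ t, ∃ r, p s r = u}

/-- The start time is quantified inside the induction on `k`, since each descent restarts the
argument at a later time with a larger visited set. -/
theorem exists_finished (hodd : Odd n) (hn : 7 < n) (hfair : IsFair act)
    (h : IsExecution (oddExploration n) act ori p) (k : ℕ) :
    ∀ t, Stage k (p t) (visited p t) → ∃ T, Finished (p T) (visited p T) := by
  induction k using Nat.strong_induction_on with
  | _ k ih =>
    intro t ht
    rcases ht.finished_or_descends hodd hn with hfin | ⟨⟨r, f, hf⟩, hdesc⟩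
    · exact ⟨t, hfin⟩
    -- If nothing ever changed, the robot that may move would still be allowed to move when fairness
    -- activates it. The first change therefore occurs from the very configuration `p t` to which
    -- the descent applies.
    have hex : ∃ i, p (t + i + 1) ≠ p (t + i) := by
      by_contra hc
      push Not at hc
      have hconst : ∀ i, p (t + i) = p t := by
        intro i
        induction i with
        | zero => rfl
        | succ i hi => exact (hc i).trans hi
      obtain ⟨t', htt', hr⟩ := hfair r t
      obtain ⟨i, rfl⟩ := Nat.exists_eq_add_of_le htt'
      refine h.ne_of_moves (by omega) hr (f := f) ?_ (hc i)
      rwa [hconst]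
    classical
    have hmin : ∀ j, j < Nat.find hex → ¬ (p (t + j + 1) ≠ p (t + j)) :=
      fun j hj => Nat.find_min hex hj
    have hspec := Nat.find_spec hex
    set i := Nat.find hex
    have hconst : ∀ j, j ≤ i → p (t + j) = p t := by
      intro j
      induction j with
      | zero => exact fun _ => rfl
      | succ j hj =>
        intro hji
        have := hmin j (by omega)
        rw [not_not] at this
        exact this.trans (hj (by omega))
    have hstep := h.step (t + i)
    rw [hconst i le_rfl] at hspec hstep
    obtain ⟨k', hk', hst⟩ := hdesc _ hstep hspec
    refine ih k' hk' (t + i + 1) (hst.mono ?_)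
    rintro u (⟨s, hs, r, hr⟩ | ⟨r, hr⟩)
    · exact ⟨s, by omega, r, hr⟩
    · exact ⟨t + i + 1, le_rfl, r, hr⟩

theorem IsExecution.eq_of_isTerminal {P : Protocol n} (h : IsExecution P act ori p) {T : ℕ}
    (hT : IsTerminal P (p T)) (t : ℕ) (ht : T ≤ t) : p t = p T := by
  induction t, ht using Nat.le_induction with
  | base => rfl
  | succ t _ ih =>
    funext r
    rw [h t r, ih]
    split_ifs
    · rw [cycle, hT r]
    · rfl

end Execution

end RingExploration

theorem mainTheorem4 (n : ℕ) (hodd : Odd n) (hn : 7 < n)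
    (act : ℕ → Finset (Fin 4)) (ori : ℕ → Fin 4 → ℤˣ) (p : ℕ → Fin 4 → ZMod n)
    (hfair : RingExploration.IsFair act)
    (hexec : RingExploration.IsExecution (RingExploration.oddExploration n) act ori p)
    (hinit : Function.Injective (p 0)) :
    ∃ T : ℕ,
      (RingExploration.TowerBlock (RingExploration.multiplicity (p T)) ∨
        RingExploration.TowerSole (RingExploration.multiplicity (p T))) ∧
      RingExploration.IsTerminal (RingExploration.oddExploration n) (p T) ∧
      (∀ t, T ≤ t → p t = p T) ∧
      ∀ u : ZMod n, ∃ t, t ≤ T ∧ ∃ r : Fin 4, p t r = u := by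
  obtain ⟨k, hk⟩ := RingExploration.exists_stage_of_injective hodd hinit
  have hk' : RingExploration.Stage k (p 0) (RingExploration.visited p 0) :=
    hk.mono (by rintro u ⟨r, rfl⟩; exact ⟨0, le_rfl, r, rfl⟩)
  obtain ⟨T, hT, hV⟩ := RingExploration.exists_finished hodd hn hfair hexec k 0 hk'
  have hterm := RingExploration.isTerminal_oddExploration hT
  exact ⟨T, hT, hterm, hexec.eq_of_isTerminal hterm, hV⟩
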